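/- Let $\pi\colon P\to M$ be a smooth principal $G$-bundle ($G$ a Lie group with Lie algebra $\mathfrak g$) with space of connections $\mathcal A_P$, let $\mathcal V$ be the vector bundle associated with $P$ and a smooth representation of $G$ on a finite-dimensional real vector space $V$, and let $\rho$ be the induced representation of $\mathfrak g$. Write $F_A$ for the curvature of $A\in\mathcal A_P$ and $d_A$ for the covariant exterior derivative on forms with values in $\mathcal V$ or in $\mathrm{ad}P$. On the graded manifold $$\mathcal F_M=\mathcal A_P\times\Omega^\bullet(M,\mathcal V)\times\mathfrak X[1](M)\times\Omega^0[1](M,\mathrm{ad}P)\ni(A,\Phi,\xi,c),$$ in which $A$ and $\Phi$ have ghost number $0$ and $\xi$ and $c$ have ghost number $1$, define a vector field $Q$ of degree $1$ by $$QA=\iota_\xi F_A-d_Ac,\qquad Q\Phi=L^A_\xi\Phi-\rho(c)\Phi,\qquad Qc=\tfrac12\iota_\xi\iota_\xi F_A-\tfrac12[c,c],\qquad Q\xi=\tfrac12[\xi,\xi],$$ where $L^A_\xi=[\iota_\xi,d_A]=\iota_\xi d_A-d_A\iota_\xi$, and where signs are governed by the total degree (form degree plus ghost number), so that $\iota_\xi$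 is an even operator and $d_A$ is an odd one. Then $Q$ is a well-defined vector field of degree $1$ on $\mathcal F_M$, and it is cohomological: $[Q,Q]=0$. -/

import Mathlib

open scoped Manifold ContDiff

noncomputable section

namespace GaugeDiffeo

/-! In Mathlib the tangent space `TangentSpace I x` of a manifold modelled on `E` is, by definition,
the model space `E` itself (read in the preferred chart at `x`). Values of differential forms at a
point are therefore written below as alternating maps on the model space. -/

/-! ### Differential forms on a manifold -/

section Forms

variable {EP HP P W : Type*} [NormedAddCommGroup EP] [NormedSpace ℝ EP] [TopologicalSpace HP]
  [TopologicalSpace P] [ChartedSpace HP P] [NormedAddCommGroup W] [NormedSpace ℝ W]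

/-- The differential at `y` of the inverse of the chart centred at `p₀`. -/
def tangentOfChart (J : ModelWithCorners ℝ EP HP) (p₀ : P) (y : EP) : EP →L[ℝ] EP :=
  mfderivWithin 𝓘(ℝ, EP) J (extChartAt J p₀).symm (Set.range J) y

/-- The differential at `p` of the chart centred at `p`. -/
def tangentToChart (J : ModelWithCorners ℝ EP HP) (p : P) : EP →L[ℝ] EP :=
  mfderiv J 𝓘(ℝ, EP) (extChartAt J p) p

/-- The local expression of the `W`-valued `k`-form `τ` in the chart centred at `p₀`. -/
def inChart (J : ModelWithCorners ℝ EP HP) {k : ℕ} (τ : P → EP [⋀^Fin k]→L[ℝ] W) (p₀ : P) (y : EP) :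
    EP [⋀^Fin k]→L[ℝ] W :=
  (τ ((extChartAt J p₀).symm y)).compContinuousLinearMap
    (tangentOfChart J p₀ y)

/-- A form is smooth if all its local expressions are. -/
def IsSmoothForm (J : ModelWithCorners ℝ EP HP) {k : ℕ} (τ : P → EP [⋀^Fin k]→L[ℝ] W) : Prop :=
  ∀ p₀ : P, ContDiffOn ℝ ∞ (inChart J τ p₀) (extChartAt J p₀).target

/-- The exterior derivative of a form, computed in charts. -/
def extD (J : ModelWithCorners ℝ EP HP) {k : ℕ} (τ : P → EP [⋀^Fin k]→L[ℝ] W) (p : P) :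
    EP [⋀^Fin (k + 1)]→L[ℝ] W :=
  (extDerivWithin (inChart J τ p) (Set.range J) (extChartAt J p p)).compContinuousLinearMap
    (tangentToChart J p)

/-- A linear form regarded as an alternating form of degree one. -/
def asForm {E : Type*} [NormedAddCommGroup E] [NormedSpace ℝ E] (α : E →L[ℝ] W) :
    E [⋀^Fin 1]→L[ℝ] W :=
  ContinuousAlternatingMap.ofSubsingleton ℝ E W (0 : Fin 1) α

/-- An alternating form of degree one regarded as a linear form. -/
def asLin {E : Type*} [NormedAddCommGroup E] [NormedSpace ℝ E] (α : E [⋀^Fin 1]→L[ℝ] W) :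
    E →L[ℝ] W :=
  (ContinuousAlternatingMap.ofSubsingleton ℝ E W (0 : Fin 1)).symm α

end Forms

/-! ### The Lie algebra of a Lie group and representations -/

section LieGroup

variable {EG : Type*} [NormedAddCommGroup EG] [NormedSpace ℝ EG]
  (G : Type*) [TopologicalSpace G] [ChartedSpace EG G] [Group G]

/-- The bracket of the Lie algebra `T₁G = EG` of `G` (Mathlib's bracket on `GroupLieAlgebra`). -/
def lieBr (X Y : EG) : EG :=
  (⁅(show GroupLieAlgebra 𝓘(ℝ, EG) G from X), (show GroupLieAlgebra 𝓘(ℝ, EG) G from Y)⁆ :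
    GroupLieAlgebra 𝓘(ℝ, EG) G)

variable {G}

/-- The adjoint action `Ad g` of `G` on its Lie algebra. -/
def Ad (g : G) : EG →L[ℝ] EG :=
  mfderiv 𝓘(ℝ, EG) 𝓘(ℝ, EG) (fun h : G => g * h * g⁻¹) 1

/-- The representation `ρ` of the Lie algebra obtained by differentiating a representation `R` of
`G` at the identity. -/
def infRep {V : Type*} [NormedAddCommGroup V] [NormedSpace ℝ V] (R : G → V →L[ℝ] V) :
    EG →L[ℝ] (V →L[ℝ] V) :=
  mfderiv 𝓘(ℝ, EG) 𝓘(ℝ, V →L[ℝ] V) R 1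

end LieGroup

/-! ### Principal bundles -/

/-- A smooth principal `G`-bundle with total space `P` over `M`: a smooth right action of `G` on `P`
and a smooth projection which are locally, over the members of an open cover of `M`, diffeomorphic
to `U × G` with right multiplication. -/
structure PrincipalBundle {E H EP HP : Type*} (EG : Type*) [NormedAddCommGroup E] [NormedSpace ℝ E]
    [TopologicalSpace H] [NormedAddCommGroup EG] [NormedSpace ℝ EG]
    [NormedAddCommGroup EP] [NormedSpace ℝ EP] [TopologicalSpace HP]
    (I : ModelWithCorners ℝ E H) (J : ModelWithCorners ℝ EP HP)
    (M : Type*) [TopologicalSpace M] [ChartedSpace H M]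
    (G : Type*) [TopologicalSpace G] [ChartedSpace EG G] [Group G]
    (P : Type*) [TopologicalSpace P] [ChartedSpace HP P] where
  proj : P → M
  act : P → G → P
  act_one : ∀ p, act p 1 = p
  act_mul : ∀ p g h, act p (g * h) = act (act p g) h
  proj_act : ∀ p g, proj (act p g) = proj p
  smooth_proj : ContMDiff J I ∞ proj
  smooth_act : ContMDiff (J.prod 𝓘(ℝ, EG)) J ∞ (fun q : P × G => act q.1 q.2)
  locally_trivial : ∀ x : M, ∃ (U : Set M) (e : OpenPartialHomeomorph P (M × G)),
    IsOpen U ∧ x ∈ U ∧ e.source = proj ⁻¹' U ∧ e.target = U ×ˢ Set.univ ∧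
    ContMDiffOn J (I.prod 𝓘(ℝ, EG)) ∞ e e.source ∧
    ContMDiffOn (I.prod 𝓘(ℝ, EG)) J ∞ e.symm e.target ∧
    (∀ p ∈ e.source, (e p).1 = proj p) ∧
    (∀ p ∈ e.source, ∀ g, e (act p g) = ((e p).1, (e p).2 * g))

section Gauge

variable {E H EG EP HP : Type*} [NormedAddCommGroup E] [NormedSpace ℝ E]
  [TopologicalSpace H] [NormedAddCommGroup EG] [NormedSpace ℝ EG]
  [NormedAddCommGroup EP] [NormedSpace ℝ EP] [TopologicalSpace HP]
  {I : ModelWithCorners ℝ E H} {J : ModelWithCorners ℝ EP HP}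
  {M : Type*} [TopologicalSpace M] [ChartedSpace H M]
  {G : Type*} [TopologicalSpace G] [ChartedSpace EG G] [Group G]
  {P : Type*} [TopologicalSpace P] [ChartedSpace HP P]
  {V : Type*} [NormedAddCommGroup V] [NormedSpace ℝ V]
  {W : Type*} [NormedAddCommGroup W] [NormedSpace ℝ W]

/-! ### Forms on the base with values in an associated bundle -/

/-- The fibre over `x` of the bundle associated with `P` and a representation `R` of `G` on `W`,
i.e. the quotient of `P_x × W` by `(p g, w) ∼ (p, R g w)`, is the space of maps `f : P_x → W` with
`f (p g) = R g⁻¹ (f p)`. A `k`-form on `M` with values in this bundle is hence given by an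
alternating `k`-form on `T_xM` with values in `W` for every point `p` of `P`, where `x = π p`;
equivariance and smoothness are imposed by `IsForm`. -/
abbrev BForm (E P W : Type*) [NormedAddCommGroup E] [NormedSpace ℝ E]
    [NormedAddCommGroup W] [NormedSpace ℝ W] (k : ℕ) : Type _ :=
  P → E [⋀^Fin k]→L[ℝ] W

/-- The differential `T_pP → T_{π p}M` of the projection. -/
def dproj (B : PrincipalBundle EG I J M G P) (p : P) : EP →L[ℝ] E :=
  mfderiv J I B.proj p

/-- The map `T₁G → T_pP` whose value at `X` is the fundamental vector field of `X` at `p`. -/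
def fundVec (B : PrincipalBundle EG I J M G P) (p : P) : EG →L[ℝ] EP :=
  mfderiv 𝓘(ℝ, EG) J (fun g : G => B.act p g) 1

/-- The differential `T_pP → T_{pg}P` of the right translation by `g`. -/
def dact (B : PrincipalBundle EG I J M G P) (g : G) (p : P) : EP →L[ℝ] EP :=
  mfderiv J J (fun q => B.act q g) p

/-- The pull-back to `P` of a bundle-valued form on `M`, a `W`-valued form on `P`. -/
def pull (B : PrincipalBundle EG I J M G P) {k : ℕ} (τ : BForm E P W k) (p : P) :
    EP [⋀^Fin k]→L[ℝ] W :=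
  (τ p).compContinuousLinearMap (dproj B p)

/-- `τ` is a smooth `k`-form on `M` with values in the bundle associated with `R`. -/
structure IsForm (B : PrincipalBundle EG I J M G P) (R : G → W →L[ℝ] W) {k : ℕ}
    (τ : BForm E P W k) : Prop where
  smooth : IsSmoothForm J (pull B τ)
  equivariant : ∀ p g (u : Fin k → E), τ (B.act p g) u = R g⁻¹ (τ p u)

/-- `A` is a (smooth) principal connection form on `P`. -/
structure IsConnection (B : PrincipalBundle EG I J M G P) (A : P → EP →L[ℝ] EG) : Prop where
  smooth : IsSmoothForm J (fun p => asForm (A p))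
  vertical : ∀ p (X : EG), A p (fundVec B p X) = X
  equivariant : ∀ p g (w : EP), A (B.act p g) (dact B g p w) = Ad g⁻¹ (A p w)

/-- The horizontal lift `T_{π p}M → T_pP`: the lift of `u` is the vector `w` with `dπ w = u` and
`A w = 0`. -/
def hlift (B : PrincipalBundle EG I J M G P) (A : P → EP →L[ℝ] EG) (p : P) : E →L[ℝ] EP :=
  (((dproj B p).prod (A p)).inverse).comp (ContinuousLinearMap.inl ℝ E EG)

/-- The covariant exterior derivative `d_A`: the exterior derivative on `P` evaluated on horizontal
lifts. -/
def covD (B : PrincipalBundle EG I J M G P) (A : P → EP →L[ℝ] EG) {k : ℕ} (τ : BForm E P W k) :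
    BForm E P W (k + 1) :=
  fun p => (extD J (pull B τ) p).compContinuousLinearMap (hlift B A p)

/-- The curvature `F_A`, a two-form on `M` with values in `ad P`. -/
def curvature (B : PrincipalBundle EG I J M G P) (A : P → EP →L[ℝ] EG) : BForm E P EG 2 :=
  fun p => (extD J (fun q => asForm (A q)) p).compContinuousLinearMap (hlift B A p)

/-- Contraction of a bundle-valued form with a vector field on `M`. -/
def iota (B : PrincipalBundle EG I J M G P) {k : ℕ} (ξ : ∀ x : M, TangentSpace I x)
    (τ : BForm E P W (k + 1)) : BForm E P W k :=
  fun p => (τ p).curryLeft (ξ (B.proj p) : E)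

variable (G) in
/-- The bracket of sections of `ad P`. -/
def adBr (c c' : BForm E P EG 0) : BForm E P EG 0 :=
  fun p => ContinuousAlternatingMap.constOfIsEmpty ℝ E (Fin 0) (lieBr G (c p 0) (c' p 0))

/-- The action `ρ(c) τ` of a section `c` of `ad P` on a form with values in the bundle associated
with `R`. -/
def rhoAct (R : G → V →L[ℝ] V) {k : ℕ} (c : BForm E P EG 0) (τ : BForm E P V k) : BForm E P V k :=
  fun p => (infRep R (c p 0)).compContinuousAlternatingMap (τ p)

/-! ### The graded manifold of fields

The graded manifold `𝒜_P × Ω^•(M, 𝒱) × 𝔛[1](M) × Ω⁰[1](M, ad P)` has body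
`𝒜_P × Ω^•(M, 𝒱)` (ghost number 0) and odd directions `𝔛(M) × Ω⁰(M, ad P)` (ghost number 1). Its
functions of ghost number `n` with values in a vector space are the maps on the body with values in
alternating `n`-linear maps on `𝔛(M) × Ω⁰(M, ad P)`: if `θ₁, θ₂, …` are odd parameters, then the
function `f` takes at the generic odd point `η = ∑ θᵢ ηᵢ` the value
`(1/n!) ∑ θ_{i₁} ⋯ θ_{iₙ} f(η_{i₁}, …, η_{iₙ})`. -/

variable (E EG EP P V) in
/-- A pair `(A, Φ)`, where `Φ` has a component in each form degree. -/
structure Fields where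
  A : P → EP →L[ℝ] EG
  Φ : ∀ k, BForm E P V k

variable (E EG P V) in
/-- A variation of a pair `(A, Φ)`. -/
structure FieldVar where
  A : BForm E P EG 1
  Φ : ∀ k, BForm E P V k

variable (EG I M P) in
/-- A pair `(ξ, c)`. -/
abbrev Ghost : Type _ := (∀ x : M, TangentSpace I x) × BForm E P EG 0

/-- `(A, Φ)` is a point of `𝒜_P × Ω^•(M, 𝒱)`. -/
structure IsField (B : PrincipalBundle EG I J M G P) (R : G → V →L[ℝ] V)
    (x : Fields E EG EP P V) : Prop where
  A : IsConnection B x.A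
  Φ : ∀ k, IsForm B R (x.Φ k)

/-- The variation is tangent to `𝒜_P × Ω^•(M, 𝒱)`. -/
structure IsFieldVar (B : PrincipalBundle EG I J M G P) (R : G → V →L[ℝ] V)
    (v : FieldVar E EG P V) : Prop where
  A : IsForm B (Ad : G → EG →L[ℝ] EG) v.A
  Φ : ∀ k, IsForm B R (v.Φ k)

/-- `ξ` is a smooth vector field on `M`. -/
def IsVF (I : ModelWithCorners ℝ E H) [IsManifold I ∞ M] (ξ : ∀ x : M, TangentSpace I x) : Prop :=
  ContMDiff I I.tangent ∞ (fun x => (⟨x, ξ x⟩ : TangentBundle I M))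

/-- `(ξ, c)` belongs to `𝔛(M) × Ω⁰(M, ad P)`. -/
structure IsGhost [IsManifold I ∞ M] (B : PrincipalBundle EG I J M G P) (η : Ghost EG I M P) : Prop where
  ξ : IsVF I η.1
  c : IsForm B (Ad : G → EG →L[ℝ] EG) η.2

/-- The point `(A, Φ) + t v` of the affine space `𝒜_P × Ω^•(M, 𝒱)`. -/
def Fields.line (B : PrincipalBundle EG I J M G P) (x : Fields E EG EP P V) (v : FieldVar E EG P V)
    (t : ℝ) : Fields E EG EP P V where
  A := fun p => x.A p + t • (asLin (v.A p)).comp (dproj B p)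
  Φ := fun k p => x.Φ k p + t • v.Φ k p

variable (E EG EP I M P V) in
/-- Functions of ghost number `n` with values in `T` on the graded manifold of fields. -/
abbrev GFun (n : ℕ) (T : Type*) : Type _ := Fields E EG EP P V → (Fin n → Ghost EG I M P) → T

/-- `f` is a well-defined function of ghost number `n` with values in the subspace of `T` cut out by
`valid`: an alternating `n`-linear function of the ghosts, differentiable along all lines in the
body. -/
structure IsGFun [IsManifold I ∞ M] (B : PrincipalBundle EG I J M G P) (R : G → V →L[ℝ] V) {n : ℕ} {T : Type*}
    [AddCommGroup T] [Module ℝ T] [TopologicalSpace T] (valid : T → Prop)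
    (f : GFun E EG EP I M P V n T) : Prop where
  mem : ∀ x, IsField B R x → ∀ η, (∀ i, IsGhost B (η i)) → valid (f x η)
  linear : ∀ x, IsField B R x → ∀ η, (∀ i, IsGhost B (η i)) →
    ∀ i u v, IsGhost B u → IsGhost B v → ∀ a : ℝ,
      f x (Function.update η i (a • u + v)) =
        a • f x (Function.update η i u) + f x (Function.update η i v)
  alternating : ∀ x, IsField B R x → ∀ η, (∀ i, IsGhost B (η i)) →
    ∀ i j, i ≠ j → η i = η j → f x η = 0
  differentiable : ∀ x, IsField B R x → ∀ v, IsFieldVar B R v → ∀ η, (∀ i, IsGhost B (η i)) →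
    DifferentiableAt ℝ (fun t : ℝ => f (x.line B v t) η) 0

/-! ### Vector fields on the graded manifold -/

variable (E EG EP I M P V) in
/-- A vector field of degree `d` on the graded manifold, given by its components, i.e. by its values
on the coordinates `A`, `Φ` (of ghost number 0) and `ξ`, `c` (of ghost number 1). -/
structure VecField (d : ℕ) where
  A : GFun E EG EP I M P V d (BForm E P EG 1)
  Φ : GFun E EG EP I M P V d (∀ k, BForm E P V k)
  ξ : GFun E EG EP I M P V (d + 1) (∀ x : M, TangentSpace I x)
  c : GFun E EG EP I M P V (d + 1) (BForm E P EG 0)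

/-- The components of the vector field are well-defined functions with values in the (shifted)
tangent space of `𝒜_P × Ω^•(M, 𝒱) × 𝔛[1](M) × Ω⁰[1](M, ad P)`. -/
structure VecField.IsVecField [IsManifold I ∞ M] (B : PrincipalBundle EG I J M G P) (R : G → V →L[ℝ] V) {d : ℕ}
    (X : VecField E EG EP I M P V d) : Prop where
  A : IsGFun B R (fun a => IsForm B (Ad : G → EG →L[ℝ] EG) a) X.A
  Φ : IsGFun B R (fun φ => ∀ k, IsForm B R (φ k)) X.Φ
  ξ : IsGFun B R (fun ξ => IsVF I ξ) X.ξ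
  c : IsGFun B R (fun c => IsForm B (Ad : G → EG →L[ℝ] EG) c) X.c

/-- The part of the derivation `f ↦ X f` in which `X`, of degree 1, acts on the ghost coordinates:
`(1/(n-1)!) f(Xη, η, …, η)`, where `Xη = ½ ∑ θᵢ θⱼ (Xη)(ηᵢ, ηⱼ)`. -/
def VecField.ghostPart {T : Type*} [AddCommGroup T] [Module ℝ T] (X : VecField E EG EP I M P V 1) :
    ∀ {n : ℕ}, GFun E EG EP I M P V n T → GFun E EG EP I M P V (n + 1) T
  | 0, _ => fun _ _ => 0
  | n + 1, f => fun x η => (1 / 2 : ℝ) • ∑ i : Fin (n + 2), ∑ j : Fin (n + 1),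
      (-1 : ℝ) ^ (i + j : ℕ) •
        f x (Fin.cons (X.ξ x ![η i, i.removeNth η j], X.c x ![η i, i.removeNth η j])
          (j.removeNth (i.removeNth η)) : Fin (n + 1) → Ghost EG I M P)

/-- The action `f ↦ X f` of a vector field `X` of degree 1, as an odd derivation, on functions with
values in a topological vector space: the derivative of `f` along the body components of `X` plus
the part acting on the ghosts. -/
def VecField.apply {T : Type*} [AddCommGroup T] [Module ℝ T] [TopologicalSpace T]
    (B : PrincipalBundle EG I J M G P) (X : VecField E EG EP I M P V 1) {n : ℕ}
    (f : GFun E EG EP I M P V n T) : GFun E EG EP I M P V (n + 1) T :=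
  fun x η => (∑ i : Fin (n + 1), (-1 : ℝ) ^ (i : ℕ) •
      deriv (fun t : ℝ => f (x.line B ⟨X.A x ![η i], X.Φ x ![η i]⟩ t) (i.removeNth η)) 0)
    + X.ghostPart f x η

/-- The graded commutator `[X, Y] = X Y + Y X` of vector fields of degree 1, given by its components,
i.e. by its values on the coordinates `A`, `Φ`, `ξ`, `c`. -/
def VecField.bracket (B : PrincipalBundle EG I J M G P) (X Y : VecField E EG EP I M P V 1) :
    VecField E EG EP I M P V 2 where
  A := fun x η => X.apply B Y.A x η + Y.apply B X.A x η
  Φ := fun x η => X.apply B Y.Φ x η + Y.apply B X.Φ x η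
  ξ := fun x η => X.apply B Y.ξ x η + Y.apply B X.ξ x η
  c := fun x η => X.apply B Y.c x η + Y.apply B X.c x η

/-- The vector field vanishes on the graded manifold of fields. -/
structure VecField.Vanishes [IsManifold I ∞ M] (B : PrincipalBundle EG I J M G P) (R : G → V →L[ℝ] V) {d : ℕ}
    (X : VecField E EG EP I M P V d) : Prop where
  A : ∀ x, IsField B R x → ∀ η, (∀ i, IsGhost B (η i)) → X.A x η = 0
  Φ : ∀ x, IsField B R x → ∀ η, (∀ i, IsGhost B (η i)) → X.Φ x η = 0
  ξ : ∀ x, IsField B R x → ∀ η, (∀ i, IsGhost B (η i)) → X.ξ x η = 0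
  c : ∀ x, IsField B R x → ∀ η, (∀ i, IsGhost B (η i)) → X.c x η = 0

/-! ### Graded operations on functions with values in forms

Signs follow the total degree (form degree plus ghost number): the operators `d_A` (degree 1) and
`ι_v` (degree -1, for an ordinary vector field `v`) anticommute with the odd parameters. Hence
`ι_ξ`, for `ξ` of ghost number 1, is an even operator. -/

/-- The coordinate function `ξ`. -/
def xiCoord : GFun E EG EP I M P V 1 (∀ x : M, TangentSpace I x) := fun _ η => (η 0).1

/-- The coordinate function `c`. -/
def cCoord : GFun E EG EP I M P V 1 (BForm E P EG 0) := fun _ η => (η 0).2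

/-- The coordinate function given by the degree `k` component of `Φ`. -/
def phiCoord (k : ℕ) : GFun E EG EP I M P V 0 (BForm E P V k) := fun x _ => x.Φ k

/-- The function `F_A`. -/
def curvFun (B : PrincipalBundle EG I J M G P) : GFun E EG EP I M P V 0 (BForm E P EG 2) :=
  fun x _ => curvature B x.A

/-- The product, through a bilinear map `b`, of a function `α` of ghost number 1 with a function `f`
of ghost number `n`. -/
def oddMul {S T U : Type*} [AddCommGroup U] [Module ℝ U] {n : ℕ} (b : S → T → U)
    (α : GFun E EG EP I M P V 1 S) (f : GFun E EG EP I M P V n T) :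
    GFun E EG EP I M P V (n + 1) U :=
  fun x η => ∑ i : Fin (n + 1), (-1 : ℝ) ^ (i : ℕ) • b (α x ![η i]) (f x (i.removeNth η))

/-- The operator `d_A` on form-valued functions of ghost number `n`. -/
def gD (B : PrincipalBundle EG I J M G P) {n k : ℕ} (f : GFun E EG EP I M P V n (BForm E P W k)) :
    GFun E EG EP I M P V n (BForm E P W (k + 1)) :=
  fun x η => (-1 : ℝ) ^ n • covD B x.A (f x η)

/-- The operator `ι_ξ` on form-valued functions of ghost number `n`. -/
def gIota (B : PrincipalBundle EG I J M G P) {n k : ℕ}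
    (f : GFun E EG EP I M P V n (BForm E P W (k + 1))) :
    GFun E EG EP I M P V (n + 1) (BForm E P W k) :=
  fun x η => (-1 : ℝ) ^ n • oddMul (iota B) xiCoord f x η

/-- The covariant Lie derivative `L^A_ξ = [ι_ξ, d_A] = ι_ξ d_A - d_A ι_ξ` (on forms of degree zero,
`ι_ξ` vanishes and only the first term is present). -/
def covLie (B : PrincipalBundle EG I J M G P) {n : ℕ} :
    ∀ {k : ℕ}, GFun E EG EP I M P V n (BForm E P W k) →
      GFun E EG EP I M P V (n + 1) (BForm E P W k)
  | 0, f => gIota B (gD B f)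
  | _ + 1, f => fun x η => gIota B (gD B f) x η - gD B (gIota B f) x η

/-- The vector field `Q`:
`Q A = ι_ξ F_A - d_A c`, `Q Φ = L^A_ξ Φ - ρ(c) Φ`, `Q ξ = ½ [ξ, ξ]`,
`Q c = ½ ι_ξ ι_ξ F_A - ½ [c, c]`. -/
def Q (B : PrincipalBundle EG I J M G P) (R : G → V →L[ℝ] V) : VecField E EG EP I M P V 1 where
  A := fun x η => gIota B (curvFun B) x η - gD B cCoord x η
  Φ := fun x η k => covLie B (phiCoord k) x η - oddMul (rhoAct R) cCoord (phiCoord k) x η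
  ξ := fun x η => (1 / 2 : ℝ) • oddMul (VectorField.mlieBracket I) xiCoord xiCoord x η
  c := fun x η => (1 / 2 : ℝ) • gIota B (gIota B (curvFun B)) x η
    - (1 / 2 : ℝ) • oddMul (adBr G) cCoord cCoord x η

end Gauge

end GaugeDiffeo

end

/-! Everything is transported to the total space `P`. Given a connection `A`, a pair of ghosts `η =
(ξ, c)` is the same thing as a `G`-invariant vector field `X_η` on `P`, its `lift`, characterised by
`dπ X_η = ξ` and `A(X_η) = c`. A bundle-valued form is determined by its pull-back to `P`
(`pull_inj`), and after pull-back the components of `Q` lose every covariant term: `Q A` becomes the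
Lie derivative of `A` along `X_η` (`pull_Q_A`), `Q Φ` the Lie derivative of `Φ` (`pull_Q_Φ`), and `Q
c` on two ghosts becomes `dA(X₀, X₁)` (`pull_Q_c`). The inputs are the structure equation
`curvature_dproj` and the formula `d_A = d + ρ(A)∧` (`pull_covD`), both consequences of
infinitesimal equivariance. Smoothness, equivariance and multilinearity of `Q` can then be read off
on `P`.

So `Q` is the Chevalley-Eilenberg differential of the invariant vector fields on `P` acting on `(A,
Φ)`, written in coordinates that depend on `A`. The lift moves with the connection: replacing `A` by
`A + t a` changes `X_η` by `-t` times the vertical field with `A`-value `a(ξ)` (`lift_line`).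
Accordingly `[X_u, X_v]` is the lift of `Q(u, v)` plus two vertical terms of this kind
(`vfBr_lift`), and these are exactly what differentiating the lifts along `Q A` produces.

With this, `Q² = 0` splits into classical identities: on `A` and `Φ` it is the commutator formula
for Lie derivatives (`lieD_lift_commutator`), on `ξ` the Jacobi identity, and on `c` the closedness
of `dA`, contracted with three lifts (`contr_lieD_cyclic`). Since `Q` is odd, `[Q, Q] = 2 Q²`. -/

set_option linter.unusedSectionVars false

noncomputable section

open scoped Topology
open Set Filter ContinuousAlternatingMap

namespace GaugeDiffeo

/-! ### Alternating forms -/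

section Alternating

variable {X E F W W' : Type*} [NormedAddCommGroup X] [NormedSpace ℝ X]
  [NormedAddCommGroup E] [NormedSpace ℝ E] [NormedAddCommGroup F] [NormedSpace ℝ F]
  [NormedAddCommGroup W] [NormedSpace ℝ W] [NormedAddCommGroup W'] [NormedSpace ℝ W']

/-- A basis of the finite-dimensional domain writes `f y` as a finite sum of rank-one maps, each
depending linearly on one value `f y (b i)`. -/
theorem contDiffWithinAt_of_clm_apply [FiniteDimensional ℝ E] {n : WithTop ℕ∞}
    {f : X → E →L[ℝ] F} {s : Set X} {x : X}
    (h : ∀ v, ContDiffWithinAt ℝ n (fun y => f y v) s x) : ContDiffWithinAt ℝ n f s x := by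
  let b := Module.finBasis ℝ E
  have hf : f = fun y => ∑ i, (ContinuousLinearMap.smulRightL ℝ E F
      (LinearMap.toContinuousLinearMap (b.coord i))) (f y (b i)) := by
    funext y
    ext v
    conv_lhs => rw [← b.sum_repr v, _root_.map_sum]
    simp
  rw [hf]
  exact ContDiffWithinAt.sum fun i _ => (ContinuousLinearMap.contDiff _).comp_contDiffWithinAt (h _)

theorem contDiffWithinAt_curryLeft {n : WithTop ℕ∞} {k : ℕ} {f : X → E [⋀^Fin (k + 1)]→L[ℝ] W}
    {s : Set X} {x : X} (h : ContDiffWithinAt ℝ n f s x) :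
    ContDiffWithinAt ℝ n (fun y => (f y).curryLeft) s x := by
  have hc := LinearIsometry.contDiff (n := n) (𝕜 := ℝ) (E := E [⋀^Fin (k + 1)]→L[ℝ] W)
    (F := E →L[ℝ] E [⋀^Fin k]→L[ℝ] W) curryLeftLI
  exact hc.comp_contDiffWithinAt h

theorem contDiffWithinAt_alternatizeUncurryFin {n : WithTop ℕ∞} {k : ℕ}
    {f : X → E →L[ℝ] E [⋀^Fin k]→L[ℝ] W} {s : Set X} {x : X} (h : ContDiffWithinAt ℝ n f s x) :
    ContDiffWithinAt ℝ n (fun y => alternatizeUncurryFin (f y)) s x := by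
  have hc := ContinuousLinearMap.contDiff (n := n) (𝕜 := ℝ) (E := E →L[ℝ] E [⋀^Fin k]→L[ℝ] W)
    (F := E [⋀^Fin (k + 1)]→L[ℝ] W) (alternatizeUncurryFinCLM ℝ E W)
  exact hc.comp_contDiffWithinAt h

/-- Currying has a continuous linear left inverse: alternatizing a curried form of degree `k + 1`
returns `k + 1` times the form. -/
theorem contDiffWithinAt_of_curryLeft {n : WithTop ℕ∞} {k : ℕ} {f : X → E [⋀^Fin (k + 1)]→L[ℝ] W}
    {s : Set X} {x : X} (h : ContDiffWithinAt ℝ n (fun y => (f y).curryLeft) s x) :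
    ContDiffWithinAt ℝ n f s x := by
  have hf : f = fun y => ((k : ℝ) + 1)⁻¹ • alternatizeUncurryFin (f y).curryLeft := by
    funext y
    rw [alternatizeUncurryFin_curryLeft, ← Nat.cast_smul_eq_nsmul ℝ, smul_smul]
    push_cast
    rw [inv_mul_cancel₀ (by positivity), one_smul]
  rw [hf]
  exact (contDiffWithinAt_alternatizeUncurryFin h).const_smul _

/-- Induction on the degree: freezing the first argument `v` leaves the pull-back by `L y` of the
contraction of `τ y` with `L y v`, which has lower degree. -/
theorem contDiffWithinAt_compContinuousLinearMap [FiniteDimensional ℝ E] {n : WithTop ℕ∞} {k : ℕ}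
    {τ : X → F [⋀^Fin k]→L[ℝ] W} {L : X → E →L[ℝ] F} {s : Set X} {x : X}
    (hτ : ContDiffWithinAt ℝ n τ s x) (hL : ContDiffWithinAt ℝ n L s x) :
    ContDiffWithinAt ℝ n (fun y => (τ y).compContinuousLinearMap (L y)) s x := by
  induction k with
  | zero =>
    have h : (fun y => (τ y).compContinuousLinearMap (L y)) =
        fun y => constOfIsEmptyLIE ℝ E W (Fin 0) ((constOfIsEmptyLIE ℝ F W (Fin 0)).symm (τ y)) := by
      funext y
      ext v
      simp only [compContinuousLinearMap_apply, constOfIsEmptyLIE_apply, constOfIsEmpty_apply]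
      change τ y _ = τ y _
      congr 1
      exact Subsingleton.elim _ _
    rw [h]
    exact (LinearIsometryEquiv.contDiff _).comp_contDiffWithinAt
      ((LinearIsometryEquiv.contDiff _).comp_contDiffWithinAt hτ)
  | succ k ih =>
    refine contDiffWithinAt_of_curryLeft (contDiffWithinAt_of_clm_apply fun v => ?_)
    simp only [curryLeft_compContinuousLinearMap]
    exact ih ((contDiffWithinAt_curryLeft hτ).clm_apply (hL.clm_apply contDiffWithinAt_const))

theorem contDiffWithinAt_compContinuousAlternatingMap {n : WithTop ℕ∞} {k : ℕ}
    {S : X → W →L[ℝ] W'} {τ : X → E [⋀^Fin k]→L[ℝ] W} {s : Set X} {x : X}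
    (hS : ContDiffWithinAt ℝ n S s x) (hτ : ContDiffWithinAt ℝ n τ s x) :
    ContDiffWithinAt ℝ n (fun y => (S y).compContinuousAlternatingMap (τ y)) s x := by
  have hc := ContinuousLinearMap.contDiff (n := n) (𝕜 := ℝ) (E := W →L[ℝ] W')
    (F := (E [⋀^Fin k]→L[ℝ] W) →L[ℝ] (E [⋀^Fin k]→L[ℝ] W'))
    (ContinuousLinearMap.compContinuousAlternatingMapCLM ℝ E W W' (Fin k))
  exact (hc.comp_contDiffWithinAt hS).clm_apply hτ

/-- Contraction of alternating forms with a fixed vector. -/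
def contract {k : ℕ} (v : E) : (E [⋀^Fin (k + 1)]→L[ℝ] W) →L[ℝ] E [⋀^Fin k]→L[ℝ] W :=
  (ContinuousLinearMap.apply ℝ (E [⋀^Fin k]→L[ℝ] W) v).comp
    (curryLeftLI (𝕜 := ℝ) (E := E) (F := W) (n := k)).toContinuousLinearMap

@[simp]
theorem contract_apply {k : ℕ} (v : E) (τ : E [⋀^Fin (k + 1)]→L[ℝ] W) :
    contract v τ = τ.curryLeft v := rfl

theorem curryLeft_alternatizeUncurryFin_zero (f : E →L[ℝ] E [⋀^Fin 0]→L[ℝ] W) (v : E) :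
    (alternatizeUncurryFin f).curryLeft v = f v := by
  ext w
  rw [curryLeft_apply_apply, alternatizeUncurryFin_apply]
  simp only [Nat.reduceAdd, Finset.univ_unique, Fin.default_eq_zero, Finset.sum_singleton]
  simp

/-- The summand of index `0` gives `f v`; the others have `v` as first argument of the form, with
the sign shifted by one. With `f` the derivative of a form this is the algebraic core of Cartan's
formula. -/
theorem curryLeft_alternatizeUncurryFin {k : ℕ} (f : E →L[ℝ] E [⋀^Fin (k + 1)]→L[ℝ] W) (v : E) :
    (alternatizeUncurryFin f).curryLeft v = f v - alternatizeUncurryFin ((contract v).comp f) := by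
  ext w
  rw [curryLeft_apply_apply, alternatizeUncurryFin_apply, Fin.sum_univ_succ]
  simp only [ContinuousAlternatingMap.sub_apply, alternatizeUncurryFin_apply,
    ContinuousLinearMap.comp_apply, contract_apply, curryLeft_apply_apply]
  rw [sub_eq_add_neg, ← Finset.sum_neg_distrib]
  congr 1
  · simp
  · refine Finset.sum_congr rfl fun i _ => ?_
    rw [Fin.val_succ, pow_succ, mul_neg_one, neg_smul]
    congr 2
    simp only [Matrix.cons_val_succ]
    congr 1
    funext j
    refine Fin.cases ?_ (fun j => ?_) j
    · simp [Fin.removeNth]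
    · simp [Fin.removeNth, Fin.succ_succAbove_succ]

/-- Polarisation of the vanishing of the double contraction with `v + w`. -/
theorem curryLeft_swap {k : ℕ} (τ : E [⋀^Fin (k + 2)]→L[ℝ] W) (v w : E) :
    (τ.curryLeft v).curryLeft w = -(τ.curryLeft w).curryLeft v := by
  have h := curryLeft_same τ (v + w)
  simp only [_root_.map_add, curryLeft_add, _root_.add_apply, curryLeft_same] at h
  rw [zero_add, add_zero] at h
  exact eq_neg_of_add_eq_zero_right h

theorem alternatizeUncurryFin_compContinuousLinearMap {k : ℕ} (f : F →L[ℝ] F [⋀^Fin k]→L[ℝ] W)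
    (L : E →L[ℝ] F) :
    (alternatizeUncurryFin f).compContinuousLinearMap L = alternatizeUncurryFin
      ((compContinuousLinearMapCLM L).comp (f.comp L)) := by
  ext v
  simp only [compContinuousLinearMap_apply, alternatizeUncurryFin_apply]
  rfl

theorem compContinuousAlternatingMap_alternatizeUncurryFin {k : ℕ} (S : W →L[ℝ] W')
    (f : E →L[ℝ] E [⋀^Fin k]→L[ℝ] W) :
    S.compContinuousAlternatingMap (alternatizeUncurryFin f) = alternatizeUncurryFin
      ((ContinuousLinearMap.compContinuousAlternatingMapCLM ℝ E W W' (Fin k) S).comp f) := by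
  ext v
  simp [alternatizeUncurryFin_apply, _root_.map_sum]

end Alternating

/-! ### Forms in charts and pull-backs -/

section Charts

variable {EN HN N EP HP P W : Type*}
  [NormedAddCommGroup EN] [NormedSpace ℝ EN] [TopologicalSpace HN]
  [TopologicalSpace N] [ChartedSpace HN N]
  [NormedAddCommGroup EP] [NormedSpace ℝ EP] [TopologicalSpace HP]
  [TopologicalSpace P] [ChartedSpace HP P] [NormedAddCommGroup W] [NormedSpace ℝ W]
  {JN : ModelWithCorners ℝ EN HN} {J : ModelWithCorners ℝ EP HP}

/-- The differential at `q` of the chart centred at `p₀`. -/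
def chartDiff (J : ModelWithCorners ℝ EP HP) (p₀ q : P) : EP →L[ℝ] EP :=
  mfderiv J 𝓘(ℝ, EP) (extChartAt J p₀) q

/-- The differential of a map between manifolds, as a map between model spaces. -/
def diffMap (JN : ModelWithCorners ℝ EN HN) (J : ModelWithCorners ℝ EP HP) (f : N → P) (q : N) :
    EN →L[ℝ] EP :=
  mfderiv JN J f q

/-- The local expression of a map in the charts centred at `q₀` and `p₀`. -/
def mapInChart (JN : ModelWithCorners ℝ EN HN) (J : ModelWithCorners ℝ EP HP) (f : N → P)
    (q₀ : N) (p₀ : P) (y : EN) : EP :=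
  extChartAt J p₀ (f ((extChartAt JN q₀).symm y))

theorem mapInChart_mem_range (f : N → P) (q₀ : N) (p₀ : P) (y : EN) :
    mapInChart JN J f q₀ p₀ y ∈ range J := by
  simp [mapInChart]

theorem tangentToChart_eq [IsManifold J 1 P] (p : P) :
    tangentToChart J p = ContinuousLinearMap.id ℝ EP :=
  mfderiv_extChartAt_self

theorem chartDiff_self [IsManifold J 1 P] (p : P) :
    chartDiff J p p = ContinuousLinearMap.id ℝ EP :=
  mfderiv_extChartAt_self

theorem chartDiff_comp_tangentOfChart [IsManifold J 1 P] {p₀ : P} {y : EP}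
    (hy : y ∈ (extChartAt J p₀).target) :
    (chartDiff J p₀ ((extChartAt J p₀).symm y)).comp (tangentOfChart J p₀ y) =
      ContinuousLinearMap.id ℝ EP :=
  mfderiv_extChartAt_comp_mfderivWithin_extChartAt_symm hy

theorem tangentOfChart_comp_chartDiff [IsManifold J 1 P] {p₀ : P} {y : EP}
    (hy : y ∈ (extChartAt J p₀).target) :
    (tangentOfChart J p₀ y).comp (chartDiff J p₀ ((extChartAt J p₀).symm y)) =
      ContinuousLinearMap.id ℝ EP :=
  mfderivWithin_extChartAt_symm_comp_mfderiv_extChartAt hy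

theorem tangentOfChart_self [IsManifold J 1 P] (p : P) :
    tangentOfChart J p (extChartAt J p p) = ContinuousLinearMap.id ℝ EP :=
  mfderivWithin_range_extChartAt_symm

theorem inChart_self [IsManifold J 1 P] {k : ℕ} (τ : P → EP [⋀^Fin k]→L[ℝ] W) (p : P) :
    inChart J τ p (extChartAt J p p) = τ p := by
  rw [inChart, tangentOfChart_self, extChartAt_to_inv]
  rfl

theorem contDiffWithinAt_mapInChart [IsManifold JN ∞ N] [IsManifold J ∞ P] {f : N → P} {q₀ : N}
    {p₀ : P} {y : EN} (hy : y ∈ (extChartAt JN q₀).target)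
    (hf : ContMDiffAt JN J ∞ f ((extChartAt JN q₀).symm y))
    (hp : f ((extChartAt JN q₀).symm y) ∈ (extChartAt J p₀).source) :
    ContDiffWithinAt ℝ ∞ (mapInChart JN J f q₀ p₀) (range JN) y := by
  rw [← contMDiffWithinAt_iff_contDiffWithinAt]
  rw [extChartAt_source] at hp
  have h1 := contMDiffWithinAt_extChartAt_symm_range (n := ∞) q₀ hy
  have h2 := contMDiffAt_extChartAt' (I := J) (n := ∞) hp
  exact h2.comp_contMDiffWithinAt y (hf.comp_contMDiffWithinAt y h1)

/-- Near `y`, `f` after the inverse chart of `N` agrees with the inverse chart of `P` after the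
local expression of `f`. The chain rule differentiates both sides, and derivatives within `range JN`
are unique. -/
theorem diffMap_comp_tangentOfChart [IsManifold JN ∞ N] [IsManifold J ∞ P] {f : N → P} {q₀ : N}
    {p₀ : P} {y : EN} (hy : y ∈ (extChartAt JN q₀).target)
    (hf : ContMDiffAt JN J ∞ f ((extChartAt JN q₀).symm y))
    (hp : f ((extChartAt JN q₀).symm y) ∈ (extChartAt J p₀).source) :
    (diffMap JN J f ((extChartAt JN q₀).symm y)).comp (tangentOfChart JN q₀ y) =
      (tangentOfChart J p₀ (mapInChart JN J f q₀ p₀ y)).comp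
        (fderivWithin ℝ (mapInChart JN J f q₀ p₀) (range JN) y) := by
  have : IsManifold JN 1 N := .of_le (n := ∞) (by simp)
  have : IsManifold J 1 P := .of_le (n := ∞) (by simp)
  have hyr : y ∈ range JN := extChartAt_target_subset_range q₀ hy
  have hu : UniqueMDiffWithinAt 𝓘(ℝ, EN) (range JN) y :=
    (JN.uniqueDiffOn.uniqueDiffWithinAt hyr).uniqueMDiffWithinAt
  have hs := mdifferentiableWithinAt_extChartAt_symm (I := JN) hy
  have hfd := hf.mdifferentiableAt (by simp)
  have hc := (contDiffWithinAt_mapInChart hy hf hp).differentiableWithinAt (by simp)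
  have ht : mapInChart JN J f q₀ p₀ y ∈ (extChartAt J p₀).target := (extChartAt J p₀).map_source hp
  have hps := mdifferentiableWithinAt_extChartAt_symm (I := J) ht
  have h1 := (hfd.hasMFDerivAt.comp_hasMFDerivWithinAt y hs.hasMFDerivWithinAt)
  have h2 := hps.hasMFDerivWithinAt.comp y hc.mdifferentiableWithinAt.hasMFDerivWithinAt
    (fun z _ => mapInChart_mem_range f q₀ p₀ z)
  have h3 : (f ∘ (extChartAt JN q₀).symm) =ᶠ[𝓝[range JN] y]
      ((extChartAt J p₀).symm ∘ mapInChart JN J f q₀ p₀) := by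
    have hcont : ContinuousWithinAt (f ∘ (extChartAt JN q₀).symm) (range JN) y :=
      h1.continuousWithinAt
    filter_upwards [hcont ((isOpen_extChartAt_source p₀).mem_nhds hp)] with z hz
    exact ((extChartAt J p₀).left_inv hz).symm
  have h4 := h2.congr_of_eventuallyEq h3 (h3.eq_of_nhdsWithin hyr)
  have h5 := hu.eq h1 h4
  rw [mfderivWithin_eq_fderivWithin] at h5
  exact h5

end Charts

theorem minSmoothness_two_le_infty : minSmoothness ℝ 2 ≤ (∞ : WithTop ℕ∞) := by
  rw [minSmoothness_of_isRCLikeNormedField]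
  exact WithTop.coe_le_coe.2 (le_top : (2 : ℕ∞) ≤ ⊤)

/-! ### Exterior derivative on a manifold: naturality, vanishing square, Leibniz rule -/

section ExteriorDerivative

variable {EN HN N EP HP P W W' : Type*}
  [NormedAddCommGroup EN] [NormedSpace ℝ EN] [TopologicalSpace HN]
  [TopologicalSpace N] [ChartedSpace HN N]
  [NormedAddCommGroup EP] [NormedSpace ℝ EP] [TopologicalSpace HP]
  [TopologicalSpace P] [ChartedSpace HP P] [NormedAddCommGroup W] [NormedSpace ℝ W]
  [NormedAddCommGroup W'] [NormedSpace ℝ W']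
  {JN : ModelWithCorners ℝ EN HN} {J : ModelWithCorners ℝ EP HP}

/-- The pull-back of a form along a map of manifolds. -/
def pullForm (JN : ModelWithCorners ℝ EN HN) (J : ModelWithCorners ℝ EP HP) (f : N → P) {k : ℕ}
    (τ : P → EP [⋀^Fin k]→L[ℝ] W) (q : N) : EN [⋀^Fin k]→L[ℝ] W :=
  (τ (f q)).compContinuousLinearMap (diffMap JN J f q)

theorem pullForm_id {k : ℕ} (τ : P → EP [⋀^Fin k]→L[ℝ] W) : pullForm J J id τ = τ := by
  funext p
  have h : diffMap J J (id : P → P) p = ContinuousLinearMap.id ℝ EP := mfderiv_id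
  rw [pullForm, h]
  rfl

theorem inChart_pullForm [IsManifold JN ∞ N] [IsManifold J ∞ P] {f : N → P} {k : ℕ}
    (τ : P → EP [⋀^Fin k]→L[ℝ] W) {q₀ : N} {p₀ : P} {y : EN}
    (hy : y ∈ (extChartAt JN q₀).target)
    (hf : ContMDiffAt JN J ∞ f ((extChartAt JN q₀).symm y))
    (hp : f ((extChartAt JN q₀).symm y) ∈ (extChartAt J p₀).source) :
    inChart JN (pullForm JN J f τ) q₀ y =
      (inChart J τ p₀ (mapInChart JN J f q₀ p₀ y)).compContinuousLinearMap
        (fderivWithin ℝ (mapInChart JN J f q₀ p₀) (range JN) y) := by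
  have h := diffMap_comp_tangentOfChart hy hf hp
  have h' : (extChartAt J p₀).symm (mapInChart JN J f q₀ p₀ y) =
    f ((extChartAt JN q₀).symm y) := (extChartAt J p₀).left_inv hp
  rw [inChart, pullForm, inChart, h']
  ext v
  simp only [compContinuousLinearMap_apply]
  congr 1
  funext i
  exact DFunLike.congr_fun h (v i)

theorem inChart_pullForm_eventuallyEq [IsManifold JN ∞ N] [IsManifold J ∞ P] {f : N → P}
    (hf : ContMDiff JN J ∞ f) {k : ℕ} (τ : P → EP [⋀^Fin k]→L[ℝ] W) {q₀ : N} {p₀ : P} {y : EN}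
    (hy : y ∈ (extChartAt JN q₀).target)
    (hp : f ((extChartAt JN q₀).symm y) ∈ (extChartAt J p₀).source) :
    inChart JN (pullForm JN J f τ) q₀ =ᶠ[𝓝[range JN] y]
      fun z => (inChart J τ p₀ (mapInChart JN J f q₀ p₀ z)).compContinuousLinearMap
        (fderivWithin ℝ (mapInChart JN J f q₀ p₀) (range JN) z) := by
  have hc : ContinuousWithinAt (fun z => f ((extChartAt JN q₀).symm z)) (range JN) y :=
    hf.continuous.continuousAt.comp_continuousWithinAt
      (contMDiffWithinAt_extChartAt_symm_range (n := ∞) q₀ hy).continuousWithinAt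
  filter_upwards [hc ((isOpen_extChartAt_source p₀).mem_nhds hp),
    extChartAt_target_mem_nhdsWithin_of_mem hy] with z hz hz'
  exact inChart_pullForm τ hz' (hf _) hz

theorem IsSmoothForm.contDiffWithinAt {k : ℕ} {τ : P → EP [⋀^Fin k]→L[ℝ] W}
    (hτ : IsSmoothForm J τ) {p₀ : P} {y : EP} (hy : y ∈ (extChartAt J p₀).target) :
    ContDiffWithinAt ℝ ∞ (inChart J τ p₀) (range J) y :=
  (hτ p₀ y hy).mono_of_mem_nhdsWithin (extChartAt_target_mem_nhdsWithin_of_mem hy)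

theorem IsSmoothForm.self {k : ℕ} {τ : P → EP [⋀^Fin k]→L[ℝ] W}
    (hτ : IsSmoothForm J τ) (p : P) :
    ContDiffWithinAt ℝ ∞ (inChart J τ p) (range J) (extChartAt J p p) :=
  hτ.contDiffWithinAt (mem_extChartAt_target p)

theorem contDiffWithinAt_inChart_pullForm [FiniteDimensional ℝ EN] [IsManifold JN ∞ N]
    [IsManifold J ∞ P] {f : N → P} (hf : ContMDiff JN J ∞ f) {k : ℕ}
    {τ : P → EP [⋀^Fin k]→L[ℝ] W} {q₀ : N} {y : EN} (hy : y ∈ (extChartAt JN q₀).target)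
    (hτ : ∀ p : P, ContDiffWithinAt ℝ ∞ (inChart J τ p) (range J) (extChartAt J p p)) :
    ContDiffWithinAt ℝ ∞ (inChart JN (pullForm JN J f τ) q₀) (range JN) y := by
  have hp := mem_extChartAt_source (I := J) (f ((extChartAt JN q₀).symm y))
  have hyr : y ∈ range JN := extChartAt_target_subset_range q₀ hy
  have he := inChart_pullForm_eventuallyEq hf τ hy hp
  refine ContDiffWithinAt.congr_of_eventuallyEq ?_ he (he.eq_of_nhdsWithin hyr)
  have hm := contDiffWithinAt_mapInChart hy (hf _) hp
  refine contDiffWithinAt_compContinuousLinearMap ?_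
    (hm.fderivWithin_right JN.uniqueDiffOn (by simp) hyr)
  exact (hτ _).comp y hm (fun z _ => mapInChart_mem_range _ _ _ z)

/-- A change of chart is a pull-back along the identity, so smoothness need only be tested at the
centre of each chart, where the chart differentials are the identity. -/
theorem isSmoothForm_iff [FiniteDimensional ℝ EP] [IsManifold J ∞ P] {k : ℕ}
    {τ : P → EP [⋀^Fin k]→L[ℝ] W} : IsSmoothForm J τ ↔
      ∀ p : P, ContDiffWithinAt ℝ ∞ (inChart J τ p) (range J) (extChartAt J p p) := by
  refine ⟨fun h => h.self, fun h p y hy => ?_⟩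
  have := contDiffWithinAt_inChart_pullForm (contMDiff_id (I := J) (M := P)) hy h
  rw [pullForm_id] at this
  exact this.mono (extChartAt_target_subset_range p)

theorem IsSmoothForm.pullForm [FiniteDimensional ℝ EN] [FiniteDimensional ℝ EP]
    [IsManifold JN ∞ N] [IsManifold J ∞ P] {f : N → P} (hf : ContMDiff JN J ∞ f) {k : ℕ}
    {τ : P → EP [⋀^Fin k]→L[ℝ] W} (hτ : IsSmoothForm J τ) :
    IsSmoothForm JN (pullForm JN J f τ) :=
  isSmoothForm_iff.2 fun q =>
    contDiffWithinAt_inChart_pullForm hf (mem_extChartAt_target q) hτ.self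

theorem extD_eq [IsManifold J ∞ P] {k : ℕ} (τ : P → EP [⋀^Fin k]→L[ℝ] W) (p : P) :
    extD J τ p = extDerivWithin (inChart J τ p) (range J) (extChartAt J p p) := by
  have : IsManifold J 1 P := .of_le (n := ∞) (by simp)
  rw [extD, tangentToChart_eq]
  rfl

/-- Common source of chart independence of `d` (with `f = id`) and of naturality. The chart of `P`
is centred at the image point, where `extD` needs no change of basis, so that the Euclidean
pull-back formula applies directly. -/
theorem extDerivWithin_inChart_pullForm [IsManifold JN ∞ N] [IsManifold J ∞ P] {f : N → P}
    (hf : ContMDiff JN J ∞ f) {k : ℕ} {τ : P → EP [⋀^Fin k]→L[ℝ] W} (hτ : IsSmoothForm J τ)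
    {q₀ : N} {y : EN} (hy : y ∈ (extChartAt JN q₀).target) :
    extDerivWithin (inChart JN (pullForm JN J f τ) q₀) (range JN) y =
      (extD J τ (f ((extChartAt JN q₀).symm y))).compContinuousLinearMap
        ((diffMap JN J f ((extChartAt JN q₀).symm y)).comp (tangentOfChart JN q₀ y)) := by
  have : IsManifold J 1 P := .of_le (n := ∞) (by simp)
  have hp := mem_extChartAt_source (I := J) (f ((extChartAt JN q₀).symm y))
  have hyr : y ∈ range JN := extChartAt_target_subset_range q₀ hy
  have he := inChart_pullForm_eventuallyEq hf τ hy hp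
  have hm := contDiffWithinAt_mapInChart hy (hf _) hp
  have hd : DifferentiableWithinAt ℝ (inChart J τ (f ((extChartAt JN q₀).symm y))) (range J)
      (mapInChart JN J f q₀ (f ((extChartAt JN q₀).symm y)) y) :=
    (hτ.self _).differentiableWithinAt (by simp)
  rw [he.extDerivWithin_eq_of_mem hyr, extDerivWithin_pullback (t := range J) (r := ∞)
    hd hm minSmoothness_two_le_infty JN.uniqueDiffOn
    (JN.range_subset_closure_interior hyr) hyr (fun z _ => mapInChart_mem_range _ _ _ z),
    extD_eq, diffMap_comp_tangentOfChart hy (hf _) hp]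
  congr 1
  have h : mapInChart JN J f q₀ (f ((extChartAt JN q₀).symm y)) y =
    extChartAt J (f ((extChartAt JN q₀).symm y)) (f ((extChartAt JN q₀).symm y)) := rfl
  rw [h, tangentOfChart_self]
  rfl

theorem inChart_extD [IsManifold J ∞ P] {k : ℕ} {τ : P → EP [⋀^Fin k]→L[ℝ] W}
    (hτ : IsSmoothForm J τ) {p₀ : P} {y : EP} (hy : y ∈ (extChartAt J p₀).target) :
    inChart J (extD J τ) p₀ y = extDerivWithin (inChart J τ p₀) (range J) y := by
  have h := extDerivWithin_inChart_pullForm (contMDiff_id (I := J) (M := P)) hτ hy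
  have h' : diffMap J J (id : P → P) ((extChartAt J p₀).symm y) = ContinuousLinearMap.id ℝ EP :=
    mfderiv_id
  rw [pullForm_id, h'] at h
  rw [h]
  rfl

/-- Naturality of the exterior derivative. -/
theorem extD_pullForm [IsManifold JN ∞ N] [IsManifold J ∞ P] {f : N → P}
    (hf : ContMDiff JN J ∞ f) {k : ℕ} {τ : P → EP [⋀^Fin k]→L[ℝ] W} (hτ : IsSmoothForm J τ) :
    extD JN (pullForm JN J f τ) = pullForm JN J f (extD J τ) := by
  have : IsManifold JN 1 N := .of_le (n := ∞) (by simp)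
  funext q
  rw [extD_eq, extDerivWithin_inChart_pullForm hf hτ (mem_extChartAt_target q),
    tangentOfChart_self, extChartAt_to_inv]
  rfl

theorem IsSmoothForm.extD [FiniteDimensional ℝ EP] [IsManifold J ∞ P] {k : ℕ}
    {τ : P → EP [⋀^Fin k]→L[ℝ] W} (hτ : IsSmoothForm J τ) : IsSmoothForm J (extD J τ) := by
  intro p₀ y hy
  have h : ContDiffWithinAt ℝ ∞ (extDerivWithin (inChart J τ p₀) (range J)) (range J) y :=
    contDiffWithinAt_alternatizeUncurryFin ((hτ.contDiffWithinAt hy).fderivWithin_right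
      J.uniqueDiffOn (by simp) (extChartAt_target_subset_range p₀ hy))
  exact (h.mono (extChartAt_target_subset_range p₀)).congr
    (fun z hz => inChart_extD hτ hz) (inChart_extD hτ hy)

theorem extD_extD [IsManifold J ∞ P] {k : ℕ} {τ : P → EP [⋀^Fin k]→L[ℝ] W}
    (hτ : IsSmoothForm J τ) : extD J (extD J τ) = 0 := by
  funext p
  have he : inChart J (extD J τ) p =ᶠ[𝓝[range J] (extChartAt J p p)]
      extDerivWithin (inChart J τ p) (range J) := by
    filter_upwards [extChartAt_target_mem_nhdsWithin p] with z hz using inChart_extD hτ hz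
  have hr : extChartAt J p p ∈ range J := extChartAt_target_subset_range p (mem_extChartAt_target p)
  rw [extD_eq, he.extDerivWithin_eq_of_mem hr]
  exact extDerivWithin_extDerivWithin_apply (hτ.self p) minSmoothness_two_le_infty J.uniqueDiffOn
    (J.range_subset_closure_interior hr) hr

theorem inChart_add {k : ℕ} (τ τ' : P → EP [⋀^Fin k]→L[ℝ] W) (p₀ : P) :
    inChart J (τ + τ') p₀ = inChart J τ p₀ + inChart J τ' p₀ := rfl

theorem inChart_smul {k : ℕ} (a : ℝ) (τ : P → EP [⋀^Fin k]→L[ℝ] W) (p₀ : P) :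
    inChart J (a • τ) p₀ = a • inChart J τ p₀ := rfl

theorem IsSmoothForm.add {k : ℕ} {τ τ' : P → EP [⋀^Fin k]→L[ℝ] W} (hτ : IsSmoothForm J τ)
    (hτ' : IsSmoothForm J τ') : IsSmoothForm J (τ + τ') := fun p => by
  rw [inChart_add]
  exact (hτ p).add (hτ' p)

theorem IsSmoothForm.smul {k : ℕ} {τ : P → EP [⋀^Fin k]→L[ℝ] W} (a : ℝ)
    (hτ : IsSmoothForm J τ) : IsSmoothForm J (a • τ) := fun p => by
  rw [inChart_smul]
  exact (hτ p).const_smul a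

theorem IsSmoothForm.neg {k : ℕ} {τ : P → EP [⋀^Fin k]→L[ℝ] W}
    (hτ : IsSmoothForm J τ) : IsSmoothForm J (-τ) := by
  rw [← neg_one_smul ℝ τ]
  exact hτ.smul _

theorem uniqueDiffWithinAt_range (p : P) :
    UniqueDiffWithinAt ℝ (range J) (extChartAt J p p) :=
  J.uniqueDiffOn _ (extChartAt_target_subset_range p (mem_extChartAt_target p))

theorem extD_add [IsManifold J ∞ P] {k : ℕ} {τ τ' : P → EP [⋀^Fin k]→L[ℝ] W}
    (hτ : IsSmoothForm J τ) (hτ' : IsSmoothForm J τ') :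
    extD J (τ + τ') = extD J τ + extD J τ' := by
  funext p
  rw [Pi.add_apply, extD_eq, extD_eq, extD_eq, inChart_add]
  exact extDerivWithin_add (uniqueDiffWithinAt_range p)
    ((hτ.self p).differentiableWithinAt (by simp)) ((hτ'.self p).differentiableWithinAt (by simp))

theorem extD_smul [IsManifold J ∞ P] {k : ℕ} (a : ℝ) (τ : P → EP [⋀^Fin k]→L[ℝ] W) :
    extD J (a • τ) = a • extD J τ := by
  funext p
  rw [Pi.smul_apply, extD_eq, extD_eq, inChart_smul]
  exact extDerivWithin_smul a _ (uniqueDiffWithinAt_range p)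

theorem extD_neg [IsManifold J ∞ P] {k : ℕ} (τ : P → EP [⋀^Fin k]→L[ℝ] W) :
    extD J (-τ) = -extD J τ := by
  rw [← neg_one_smul ℝ τ, extD_smul, neg_one_smul]

theorem extD_sub [IsManifold J ∞ P] {k : ℕ} {τ τ' : P → EP [⋀^Fin k]→L[ℝ] W}
    (hτ : IsSmoothForm J τ) (hτ' : IsSmoothForm J τ') :
    extD J (τ - τ') = extD J τ - extD J τ' := by
  rw [sub_eq_add_neg, extD_add hτ hτ'.neg, extD_neg, sub_eq_add_neg]

/-- The action of a function with values in linear maps on a form. -/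
def opForm {k : ℕ} (S : P → W →L[ℝ] W') (τ : P → EP [⋀^Fin k]→L[ℝ] W) (p : P) :
    EP [⋀^Fin k]→L[ℝ] W' :=
  (S p).compContinuousAlternatingMap (τ p)

theorem contDiffWithinAt_comp_extChartAt_symm {F : Type*} [NormedAddCommGroup F] [NormedSpace ℝ F]
    {S : P → F} {p : P} (hS : ContMDiffAt J 𝓘(ℝ, F) ∞ S p) :
    ContDiffWithinAt ℝ ∞ (S ∘ (extChartAt J p).symm) (range J) (extChartAt J p p) :=
  (contMDiffAt_iff.1 hS).2

theorem diffMap_eq_fderivWithin {F : Type*} [NormedAddCommGroup F] [NormedSpace ℝ F]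
    {S : P → F} {p : P} (hS : ContMDiffAt J 𝓘(ℝ, F) ∞ S p) :
    diffMap J 𝓘(ℝ, F) S p =
      fderivWithin ℝ (S ∘ (extChartAt J p).symm) (range J) (extChartAt J p p) := by
  have h := (hS.mdifferentiableAt (by simp)).hasMFDerivAt
  have h' : HasFDerivWithinAt (S ∘ (extChartAt J p).symm) (diffMap J 𝓘(ℝ, F) S p) (range J)
    (extChartAt J p p) := h.2
  exact (h'.fderivWithin (uniqueDiffWithinAt_range p)).symm

theorem IsSmoothForm.opForm [FiniteDimensional ℝ EP] [IsManifold J ∞ P] {k : ℕ}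
    {S : P → W →L[ℝ] W'} (hS : ContMDiff J 𝓘(ℝ, W →L[ℝ] W') ∞ S)
    {τ : P → EP [⋀^Fin k]→L[ℝ] W} (hτ : IsSmoothForm J τ) : IsSmoothForm J (opForm S τ) :=
  isSmoothForm_iff.2 fun p => contDiffWithinAt_compContinuousAlternatingMap
    (contDiffWithinAt_comp_extChartAt_symm (hS p)) (hτ.self p)

/-- The Leibniz rule for the action of functions on forms. -/
theorem extD_opForm [IsManifold J ∞ P] {k : ℕ}
    {S : P → W →L[ℝ] W'} {p : P} (hS : ContMDiffAt J 𝓘(ℝ, W →L[ℝ] W') ∞ S p)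
    {τ : P → EP [⋀^Fin k]→L[ℝ] W} (hτ : IsSmoothForm J τ) :
    extD J (opForm S τ) p =
      alternatizeUncurryFin (((ContinuousLinearMap.compContinuousAlternatingMapCLM ℝ EP W W'
        (Fin k)).flip (τ p)).comp (diffMap J 𝓘(ℝ, W →L[ℝ] W') S p)) +
      (S p).compContinuousAlternatingMap (extD J τ p) := by
  have : IsManifold J 1 P := .of_le (n := ∞) (by simp)
  rw [extD_eq, extD_eq, diffMap_eq_fderivWithin hS]
  have hS' := (contDiffWithinAt_comp_extChartAt_symm hS).differentiableWithinAt (by simp)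
  have hτ' := (hτ.self p).differentiableWithinAt (by simp)
  have h := ((ContinuousLinearMap.compContinuousAlternatingMapCLM ℝ EP W W'
        (Fin k))).hasFDerivWithinAt_of_bilinear hS'.hasFDerivWithinAt hτ'.hasFDerivWithinAt
  have h' := h.fderivWithin (uniqueDiffWithinAt_range p)
  have h'' : (fun y => (ContinuousLinearMap.compContinuousAlternatingMapCLM ℝ EP W W' (Fin k))
    ((S ∘ (extChartAt J p).symm) y) (inChart J τ p y)) = inChart J (opForm S τ) p := rfl
  rw [h''] at h'
  rw [extDerivWithin, h', inChart_self, alternatizeUncurryFin_add, extDerivWithin,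
    compContinuousAlternatingMap_alternatizeUncurryFin]
  refine (add_comm _ _).trans ?_
  congr 1
  rw [Function.comp_apply, extChartAt_to_inv]
  rfl

theorem opForm_const_extD [IsManifold J ∞ P] {k : ℕ} (S : W →L[ℝ] W')
    {τ : P → EP [⋀^Fin k]→L[ℝ] W} (hτ : IsSmoothForm J τ) :
    extD J (opForm (fun _ => S) τ) = opForm (fun _ => S) (extD J τ) := by
  funext p
  rw [extD_opForm contMDiffAt_const hτ]
  have h : diffMap J 𝓘(ℝ, W →L[ℝ] W') (fun _ : P => S) p = 0 := mfderiv_const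
  rw [h, ContinuousLinearMap.comp_zero]
  change alternatizeUncurryFinCLM ℝ EP W' 0 + _ = _
  rw [_root_.map_zero, zero_add]
  rfl

end ExteriorDerivative

/-! ### Vector fields and Cartan calculus -/

section Cartan

variable {EP HP P W : Type*}
  [NormedAddCommGroup EP] [NormedSpace ℝ EP] [TopologicalSpace HP]
  [TopologicalSpace P] [ChartedSpace HP P] [NormedAddCommGroup W] [NormedSpace ℝ W]
  {J : ModelWithCorners ℝ EP HP}

/-- The local expression of a vector field in the chart centred at `p₀`. -/
def vfInChart (J : ModelWithCorners ℝ EP HP) (X : P → EP) (p₀ : P) (y : EP) : EP :=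
  chartDiff J p₀ ((extChartAt J p₀).symm y) (X ((extChartAt J p₀).symm y))

/-- Smoothness of a vector field, read in charts. -/
def IsSmoothVF (J : ModelWithCorners ℝ EP HP) (X : P → EP) : Prop :=
  ∀ p : P, ContDiffWithinAt ℝ ∞ (vfInChart J X p) (range J) (extChartAt J p p)

/-- The Lie bracket of vector fields. -/
def vfBr (J : ModelWithCorners ℝ EP HP) (X Y : P → EP) (p : P) : EP :=
  VectorField.mlieBracket J (fun q => (show TangentSpace J q from X q))
    (fun q => (show TangentSpace J q from Y q)) p

/-- The derivative of the local expression of a form. -/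
def jetForm (J : ModelWithCorners ℝ EP HP) {k : ℕ} (τ : P → EP [⋀^Fin k]→L[ℝ] W) (p : P) :
    EP →L[ℝ] EP [⋀^Fin k]→L[ℝ] W :=
  fderivWithin ℝ (inChart J τ p) (range J) (extChartAt J p p)

/-- The derivative of the local expression of a vector field. -/
def jetVF (J : ModelWithCorners ℝ EP HP) (X : P → EP) (p : P) : EP →L[ℝ] EP :=
  fderivWithin ℝ (vfInChart J X p) (range J) (extChartAt J p p)

/-- Contraction of a form with a vector field. -/
def contr {k : ℕ} (X : P → EP) (τ : P → EP [⋀^Fin (k + 1)]→L[ℝ] W) (p : P) :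
    EP [⋀^Fin k]→L[ℝ] W :=
  (τ p).curryLeft (X p)

theorem extChartAt_self_mem_range (p : P) : extChartAt J p p ∈ range J :=
  extChartAt_target_subset_range p (mem_extChartAt_target p)

theorem vfInChart_self [IsManifold J ∞ P] (X : P → EP) (p : P) :
    vfInChart J X p (extChartAt J p p) = X p := by
  have : IsManifold J 1 P := .of_le (n := ∞) (by simp)
  rw [vfInChart, extChartAt_to_inv, chartDiff_self]
  rfl

theorem tangentOfChart_vfInChart [IsManifold J ∞ P] (X : P → EP) {p₀ : P} {y : EP}
    (hy : y ∈ (extChartAt J p₀).target) :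
    tangentOfChart J p₀ y (vfInChart J X p₀ y) = X ((extChartAt J p₀).symm y) := by
  have : IsManifold J 1 P := .of_le (n := ∞) (by simp)
  exact DFunLike.congr_fun (tangentOfChart_comp_chartDiff hy) _

theorem vfInChart_eq_of_tangentOfChart [IsManifold J ∞ P] {X : P → EP} {p₀ : P} {y v : EP}
    (hy : y ∈ (extChartAt J p₀).target)
    (hv : tangentOfChart J p₀ y v = X ((extChartAt J p₀).symm y)) : vfInChart J X p₀ y = v := by
  have : IsManifold J 1 P := .of_le (n := ∞) (by simp)
  rw [vfInChart, ← hv]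
  exact DFunLike.congr_fun (chartDiff_comp_tangentOfChart hy) _

theorem inChart_contr [IsManifold J ∞ P] {k : ℕ} (X : P → EP)
    (τ : P → EP [⋀^Fin (k + 1)]→L[ℝ] W) {p₀ : P} {y : EP} (hy : y ∈ (extChartAt J p₀).target) :
    inChart J (contr X τ) p₀ y = (inChart J τ p₀ y).curryLeft (vfInChart J X p₀ y) := by
  rw [inChart, inChart, curryLeft_compContinuousLinearMap, tangentOfChart_vfInChart X hy]
  rfl

theorem inChart_contr_eventuallyEq [IsManifold J ∞ P] {k : ℕ} (X : P → EP)
    (τ : P → EP [⋀^Fin (k + 1)]→L[ℝ] W) (p : P) :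
    inChart J (contr X τ) p =ᶠ[𝓝[range J] (extChartAt J p p)]
      fun y => (inChart J τ p y).curryLeft (vfInChart J X p y) := by
  filter_upwards [extChartAt_target_mem_nhdsWithin p] with y hy using inChart_contr X τ hy

theorem IsSmoothForm.contr [FiniteDimensional ℝ EP] [IsManifold J ∞ P] {k : ℕ} {X : P → EP}
    (hX : IsSmoothVF J X) {τ : P → EP [⋀^Fin (k + 1)]→L[ℝ] W} (hτ : IsSmoothForm J τ) :
    IsSmoothForm J (contr X τ) :=
  isSmoothForm_iff.2 fun p =>
    ((contDiffWithinAt_curryLeft (hτ.self p)).clm_apply (hX p)).congr_of_eventuallyEq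
      (inChart_contr_eventuallyEq X τ p)
      ((inChart_contr_eventuallyEq X τ p).eq_of_nhdsWithin (extChartAt_self_mem_range p))

theorem vfInChart_add (X Y : P → EP) (p : P) :
    vfInChart J (X + Y) p = vfInChart J X p + vfInChart J Y p := by
  funext y
  simp [vfInChart]

theorem vfInChart_smul (a : ℝ) (X : P → EP) (p : P) :
    vfInChart J (a • X) p = a • vfInChart J X p := by
  funext y
  simp [vfInChart]

theorem IsSmoothVF.add {X Y : P → EP} (hX : IsSmoothVF J X) (hY : IsSmoothVF J Y) :
    IsSmoothVF J (X + Y) := fun p => by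
  rw [vfInChart_add]
  exact (hX p).add (hY p)

theorem IsSmoothVF.smul (a : ℝ) {X : P → EP} (hX : IsSmoothVF J X) :
    IsSmoothVF J (a • X) := fun p => by
  rw [vfInChart_smul]
  exact (hX p).const_smul a

theorem hasFDerivWithinAt_curryLeft {X : Type*} [NormedAddCommGroup X] [NormedSpace ℝ X] {k : ℕ}
    {f : X → EP [⋀^Fin (k + 1)]→L[ℝ] W} {f' : X →L[ℝ] EP [⋀^Fin (k + 1)]→L[ℝ] W} {s : Set X}
    {x : X} (h : HasFDerivWithinAt f f' s x) :
    HasFDerivWithinAt (fun y => (f y).curryLeft) ((LinearIsometry.toContinuousLinearMap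
      (curryLeftLI (𝕜 := ℝ) (E := EP) (F := W) (n := k))).comp f') s x := by
  let L : (EP [⋀^Fin (k + 1)]→L[ℝ] W) →L[ℝ] (EP →L[ℝ] EP [⋀^Fin k]→L[ℝ] W) :=
    LinearIsometry.toContinuousLinearMap curryLeftLI
  have hc : HasFDerivAt (𝕜 := ℝ) (E := EP [⋀^Fin (k + 1)]→L[ℝ] W)
    (F := EP →L[ℝ] EP [⋀^Fin k]→L[ℝ] W) L L (f x) := ContinuousLinearMap.hasFDerivAt _
  exact HasFDerivAt.comp_hasFDerivWithinAt (𝕜 := ℝ) (F := EP [⋀^Fin (k + 1)]→L[ℝ] W)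
    (G := EP →L[ℝ] EP [⋀^Fin k]→L[ℝ] W) (g := L) (g' := L) x hc h

theorem extD_eq_jetForm [IsManifold J ∞ P] {k : ℕ} (τ : P → EP [⋀^Fin k]→L[ℝ] W) (p : P) :
    extD J τ p = alternatizeUncurryFin (jetForm J τ p) := extD_eq τ p

theorem jetForm_contr [IsManifold J ∞ P] {k : ℕ} {X : P → EP} (hX : IsSmoothVF J X)
    {τ : P → EP [⋀^Fin (k + 1)]→L[ℝ] W} (hτ : IsSmoothForm J τ) (p : P) :
    jetForm J (contr X τ) p =
      (contract (X p)).comp (jetForm J τ p) + (τ p).curryLeft.comp (jetVF J X p) := by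
  have : IsManifold J 1 P := .of_le (n := ∞) (by simp)
  rw [jetForm, (inChart_contr_eventuallyEq X τ p).fderivWithin_eq_of_mem
    (extChartAt_self_mem_range p)]
  have h1 := (contDiffWithinAt_curryLeft (hτ.self p)).differentiableWithinAt (by simp)
  have h2 := (hX p).differentiableWithinAt (by simp)
  have h3 := (hτ.self p).differentiableWithinAt (by simp)
  rw [fderivWithin_clm_apply (uniqueDiffWithinAt_range p) h1 h2, inChart_self, vfInChart_self,
    add_comm]
  congr 1
  have h4 := hasFDerivWithinAt_curryLeft h3.hasFDerivWithinAt
  have h5 := h4.fderivWithin (uniqueDiffWithinAt_range p)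
  rw [h5]
  rfl

/-- The manifold bracket pulls fields back by inverting the differential of the inverse chart; on
the chart target that inverse is the differential of the chart, which gives `vfInChart`. -/
theorem vfBr_eq [IsManifold J ∞ P] (X Y : P → EP) (p : P) :
    vfBr J X Y p = VectorField.lieBracketWithin ℝ (vfInChart J X p) (vfInChart J Y p) (range J)
      (extChartAt J p p) := by
  have : IsManifold J 1 P := .of_le (n := ∞) (by simp)
  have key : ∀ Z : P → EP, VectorField.mpullbackWithin 𝓘(ℝ, EP) J (extChartAt J p).symm
      (fun q => (show TangentSpace J q from Z q)) (range J)
      =ᶠ[𝓝[range J] (extChartAt J p p)] vfInChart J Z p := by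
    intro Z
    filter_upwards [extChartAt_target_mem_nhdsWithin p] with y hy
    change (tangentOfChart J p y).inverse (Z ((extChartAt J p).symm y)) = _
    rw [vfInChart, ContinuousLinearMap.inverse_eq (tangentOfChart_comp_chartDiff hy)
      (chartDiff_comp_tangentOfChart hy)]
  have h1 : vfBr J X Y p = (chartDiff J p p).inverse (VectorField.lieBracketWithin ℝ
      (VectorField.mpullbackWithin 𝓘(ℝ, EP) J (extChartAt J p).symm
        (fun q => (show TangentSpace J q from X q)) (range J))
      (VectorField.mpullbackWithin 𝓘(ℝ, EP) J (extChartAt J p).symm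
        (fun q => (show TangentSpace J q from Y q)) (range J))
      ((extChartAt J p).symm ⁻¹' univ ∩ range J) (extChartAt J p p)) := rfl
  rw [h1, chartDiff_self, ContinuousLinearMap.inverse_id, preimage_univ, univ_inter]
  exact (key X).lieBracketWithin_vectorField_eq_of_mem (key Y) (extChartAt_self_mem_range p)

theorem vfBr_eq_jet [IsManifold J ∞ P] (X Y : P → EP) (p : P) :
    vfBr J X Y p = jetVF J Y p (X p) - jetVF J X p (Y p) := by
  rw [vfBr_eq, VectorField.lieBracketWithin, vfInChart_self, vfInChart_self]
  rfl

/-- The Lie derivative of a form along a vector field, through Cartan's formula. -/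
def lieD (J : ModelWithCorners ℝ EP HP) (X : P → EP) :
    ∀ {k : ℕ}, (P → EP [⋀^Fin k]→L[ℝ] W) → P → EP [⋀^Fin k]→L[ℝ] W
  | 0, τ => contr X (extD J τ)
  | _ + 1, τ => contr X (extD J τ) + extD J (contr X τ)

theorem lieD_zero_apply [IsManifold J ∞ P] (X : P → EP) (τ : P → EP [⋀^Fin 0]→L[ℝ] W) (p : P) :
    lieD J X τ p = jetForm J τ p (X p) := by
  rw [lieD, contr, extD_eq_jetForm, curryLeft_alternatizeUncurryFin_zero]

/-- In the two halves of Cartan's formula the terms that contract the derivative of `τ` with `X` and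
then alternate cancel, leaving the directional derivative and the term with the derivative of `X`.
-/
theorem lieD_succ_apply [IsManifold J ∞ P] {k : ℕ} {X : P → EP} (hX : IsSmoothVF J X)
    {τ : P → EP [⋀^Fin (k + 1)]→L[ℝ] W} (hτ : IsSmoothForm J τ) (p : P) :
    lieD J X τ p =
      jetForm J τ p (X p) + alternatizeUncurryFin ((τ p).curryLeft.comp (jetVF J X p)) := by
  rw [lieD, Pi.add_apply, contr, extD_eq_jetForm, extD_eq_jetForm, jetForm_contr hX hτ,
    curryLeft_alternatizeUncurryFin, alternatizeUncurryFin_add]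
  abel

/-- The commutator of the Lie derivative with a contraction. -/
theorem contr_vfBr [IsManifold J ∞ P] [FiniteDimensional ℝ EP] {k : ℕ} {X Y : P → EP}
    (hX : IsSmoothVF J X) (hY : IsSmoothVF J Y)
    {τ : P → EP [⋀^Fin (k + 1)]→L[ℝ] W} (hτ : IsSmoothForm J τ) :
    contr (vfBr J X Y) τ = lieD J X (contr Y τ) - contr Y (lieD J X τ) := by
  funext p
  rw [Pi.sub_apply, contr, contr, lieD_succ_apply hX hτ, curryLeft_add, _root_.add_apply,
    vfBr_eq_jet, _root_.map_sub]
  cases k with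
  | zero =>
    rw [lieD_zero_apply, jetForm_contr hY hτ, curryLeft_alternatizeUncurryFin_zero]
    simp only [_root_.add_apply, ContinuousLinearMap.comp_apply, contract_apply]
    abel
  | succ k =>
    rw [lieD_succ_apply hX (hτ.contr hY), jetForm_contr hY hτ, curryLeft_alternatizeUncurryFin]
    -- The derivative of `X` occupies the first slot of `τ`; bringing `Y` there instead costs the
    -- sign.
    have h : (contract (Y p)).comp ((τ p).curryLeft.comp (jetVF J X p)) =
        -((GaugeDiffeo.contr Y τ p).curryLeft.comp (jetVF J X p)) := by
      ext v
      simp only [ContinuousLinearMap.comp_apply, contract_apply, _root_.neg_apply]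
      rw [curryLeft_swap]
      rfl
    have h' : alternatizeUncurryFin (-((GaugeDiffeo.contr Y τ p).curryLeft.comp (jetVF J X p))) =
        -alternatizeUncurryFin ((GaugeDiffeo.contr Y τ p).curryLeft.comp (jetVF J X p)) :=
      _root_.map_neg (alternatizeUncurryFinCLM ℝ EP W) _
    rw [h, h']
    simp only [_root_.add_apply, ContinuousLinearMap.comp_apply, contract_apply]
    abel

theorem contr_add_left {k : ℕ} (X Y : P → EP) (τ : P → EP [⋀^Fin (k + 1)]→L[ℝ] W) :
    contr (X + Y) τ = contr X τ + contr Y τ := by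
  funext p
  simp [contr]

theorem contr_smul_left {k : ℕ} (a : ℝ) (X : P → EP) (τ : P → EP [⋀^Fin (k + 1)]→L[ℝ] W) :
    contr (a • X) τ = a • contr X τ := by
  funext p
  simp [contr]

theorem contr_add {k : ℕ} (X : P → EP) (τ τ' : P → EP [⋀^Fin (k + 1)]→L[ℝ] W) :
    contr X (τ + τ') = contr X τ + contr X τ' := by
  funext p
  simp [contr]

theorem contr_smul {k : ℕ} (a : ℝ) (X : P → EP) (τ : P → EP [⋀^Fin (k + 1)]→L[ℝ] W) :
    contr X (a • τ) = a • contr X τ := by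
  funext p
  simp [contr]

theorem contr_zero {k : ℕ} (X : P → EP) :
    contr X (0 : P → EP [⋀^Fin (k + 1)]→L[ℝ] W) = 0 := by
  funext p
  simp [contr]

theorem contr_contr_swap {k : ℕ} (X Y : P → EP) (τ : P → EP [⋀^Fin (k + 2)]→L[ℝ] W) :
    contr X (contr Y τ) = -contr Y (contr X τ) := by
  funext p
  exact curryLeft_swap _ _ _

theorem IsSmoothForm.lieD [FiniteDimensional ℝ EP] [IsManifold J ∞ P] {k : ℕ} {X : P → EP}
    (hX : IsSmoothVF J X) {τ : P → EP [⋀^Fin k]→L[ℝ] W} (hτ : IsSmoothForm J τ) :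
    IsSmoothForm J (lieD J X τ) := by
  cases k with
  | zero => exact hτ.extD.contr hX
  | succ k => exact (hτ.extD.contr hX).add (hτ.contr hX).extD

theorem lieD_add [FiniteDimensional ℝ EP] [IsManifold J ∞ P] {k : ℕ} {X : P → EP}
    (hX : IsSmoothVF J X) {τ τ' : P → EP [⋀^Fin k]→L[ℝ] W} (hτ : IsSmoothForm J τ)
    (hτ' : IsSmoothForm J τ') : lieD J X (τ + τ') = lieD J X τ + lieD J X τ' := by
  cases k with
  | zero => rw [lieD, lieD, lieD, extD_add hτ hτ', contr_add]
  | succ k =>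
    rw [lieD, lieD, lieD, extD_add hτ hτ', contr_add, contr_add,
      extD_add (hτ.contr hX) (hτ'.contr hX)]
    abel

theorem lieD_smul [IsManifold J ∞ P] {k : ℕ} (a : ℝ) (X : P → EP)
    (τ : P → EP [⋀^Fin k]→L[ℝ] W) : lieD J X (a • τ) = a • lieD J X τ := by
  cases k with
  | zero => rw [lieD, lieD, extD_smul, contr_smul]
  | succ k => rw [lieD, lieD, extD_smul, contr_smul, contr_smul, extD_smul, smul_add]

theorem lieD_add_left [FiniteDimensional ℝ EP] [IsManifold J ∞ P] {k : ℕ} {X Y : P → EP}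
    (hX : IsSmoothVF J X) (hY : IsSmoothVF J Y) {τ : P → EP [⋀^Fin k]→L[ℝ] W}
    (hτ : IsSmoothForm J τ) : lieD J (X + Y) τ = lieD J X τ + lieD J Y τ := by
  cases k with
  | zero => rw [lieD, lieD, lieD, contr_add_left]
  | succ k =>
    rw [lieD, lieD, lieD, contr_add_left, contr_add_left, extD_add (hτ.contr hX) (hτ.contr hY)]
    abel

theorem lieD_smul_left [IsManifold J ∞ P] {k : ℕ} (a : ℝ) (X : P → EP)
    (τ : P → EP [⋀^Fin k]→L[ℝ] W) : lieD J (a • X) τ = a • lieD J X τ := by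
  cases k with
  | zero => rw [lieD, lieD, contr_smul_left]
  | succ k => rw [lieD, lieD, contr_smul_left, contr_smul_left, extD_smul, smul_add]

theorem lieD_sub_left [FiniteDimensional ℝ EP] [IsManifold J ∞ P] {k : ℕ} {X Y : P → EP}
    (hX : IsSmoothVF J X) (hY : IsSmoothVF J Y) {τ : P → EP [⋀^Fin k]→L[ℝ] W}
    (hτ : IsSmoothForm J τ) : lieD J (X - Y) τ = lieD J X τ - lieD J Y τ := by
  rw [sub_eq_add_neg, ← neg_one_smul ℝ Y, lieD_add_left hX (hY.smul _) hτ, lieD_smul_left,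
    neg_one_smul, sub_eq_add_neg]

theorem extD_zero [IsManifold J ∞ P] {k : ℕ} : extD J (0 : P → EP [⋀^Fin k]→L[ℝ] W) = 0 := by
  have := extD_smul (J := J) (0 : ℝ) (0 : P → EP [⋀^Fin k]→L[ℝ] W)
  rwa [zero_smul, zero_smul] at this

theorem lieD_extD [FiniteDimensional ℝ EP] [IsManifold J ∞ P] {k : ℕ} {X : P → EP}
    (hX : IsSmoothVF J X) {τ : P → EP [⋀^Fin k]→L[ℝ] W} (hτ : IsSmoothForm J τ) :
    lieD J X (extD J τ) = extD J (lieD J X τ) := by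
  rw [lieD, extD_extD hτ, contr_zero, zero_add]
  cases k with
  | zero => rfl
  | succ k =>
    rw [lieD, extD_add (hτ.extD.contr hX) (hτ.contr hX).extD, extD_extD (hτ.contr hX), add_zero]

/-- The Lie derivative along a Lie bracket is the commutator of the Lie derivatives. -/
theorem lieD_vfBr [FiniteDimensional ℝ EP] [IsManifold J ∞ P] {k : ℕ} {X Y : P → EP}
    (hX : IsSmoothVF J X) (hY : IsSmoothVF J Y) {τ : P → EP [⋀^Fin k]→L[ℝ] W}
    (hτ : IsSmoothForm J τ) :
    lieD J (vfBr J X Y) τ = lieD J X (lieD J Y τ) - lieD J Y (lieD J X τ) := by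
  cases k with
  | zero => rw [lieD, contr_vfBr hX hY hτ.extD, lieD_extD hX hτ]; rfl
  | succ k =>
    have hs : ∀ {X : P → EP}, IsSmoothVF J X → lieD J X τ = contr X (extD J τ) +
      extD J (contr X τ) := fun _ => rfl
    rw [lieD, contr_vfBr hX hY hτ.extD, contr_vfBr hX hY hτ,
      extD_sub ((hτ.contr hY).lieD hX) ((hτ.lieD hX).contr hY), ← lieD_extD hX (hτ.contr hY),
      lieD_extD hX hτ, hs hY, lieD_add hX (hτ.extD.contr hY) (hτ.contr hY).extD]
    change _ = _ - (contr Y (extD J (lieD J X τ)) + extD J (contr Y (lieD J X τ)))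
    abel

/-- A smooth section of the tangent bundle is a smooth vector field in charts. -/
theorem isSmoothVF_of_contMDiff [CompleteSpace EP] [IsManifold J ∞ P]
    {X : ∀ p : P, TangentSpace J p}
    (hX : ContMDiff J J.tangent ∞ (fun p => (⟨p, X p⟩ : TangentBundle J P))) :
    IsSmoothVF J (fun p => (X p : EP)) := by
  have : IsManifold J 1 P := .of_le (n := ∞) (by simp)
  have : IsManifold J (∞ + 1) P := .of_le (n := ∞) (by simp)
  intro p
  have h := VectorField.contMDiffWithinAt_mpullbackWithin_extChartAt_symm (n := ∞) (m := ∞)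
    (hX p).contMDiffWithinAt uniqueMDiffOn_univ (mem_univ p) (by simp)
  rw [preimage_univ, inter_univ] at h
  have h' := (contMDiffWithinAt_vectorSpace_iff_contDiffWithinAt.1 h).mono_of_mem_nhdsWithin
    (extChartAt_target_mem_nhdsWithin p)
  have he : vfInChart J (fun p => (X p : EP)) p =ᶠ[𝓝[range J] (extChartAt J p p)]
      VectorField.mpullbackWithin 𝓘(ℝ, EP) J (extChartAt J p).symm X (range J) := by
    filter_upwards [extChartAt_target_mem_nhdsWithin p] with y hy
    change _ = (tangentOfChart J p y).inverse (X ((extChartAt J p).symm y))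
    rw [ContinuousLinearMap.inverse_eq (tangentOfChart_comp_chartDiff hy)
      (chartDiff_comp_tangentOfChart hy)]
    rfl
  exact h'.congr_of_eventuallyEq he (he.eq_of_nhdsWithin (extChartAt_self_mem_range p))

end Cartan

/-! ### Differentials of maps -/

section DiffMap

variable {E₁ H₁ M₁ E₂ H₂ M₂ E₃ H₃ M₃ W : Type*}
  [NormedAddCommGroup E₁] [NormedSpace ℝ E₁] [TopologicalSpace H₁]
  [TopologicalSpace M₁] [ChartedSpace H₁ M₁]
  [NormedAddCommGroup E₂] [NormedSpace ℝ E₂] [TopologicalSpace H₂]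
  [TopologicalSpace M₂] [ChartedSpace H₂ M₂]
  [NormedAddCommGroup E₃] [NormedSpace ℝ E₃] [TopologicalSpace H₃]
  [TopologicalSpace M₃] [ChartedSpace H₃ M₃] [NormedAddCommGroup W] [NormedSpace ℝ W]
  {I₁ : ModelWithCorners ℝ E₁ H₁} {I₂ : ModelWithCorners ℝ E₂ H₂} {I₃ : ModelWithCorners ℝ E₃ H₃}

theorem diffMap_comp {g : M₂ → M₃} {f : M₁ → M₂} {x : M₁} (hg : MDifferentiableAt I₂ I₃ g (f x))
    (hf : MDifferentiableAt I₁ I₂ f x) :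
    diffMap I₁ I₃ (g ∘ f) x = (diffMap I₂ I₃ g (f x)).comp (diffMap I₁ I₂ f x) :=
  mfderiv_comp x hg hf

theorem diffMap_const (x : M₁) (y : M₂) : diffMap I₁ I₂ (fun _ : M₁ => y) x = 0 := mfderiv_const

theorem diffMap_id (x : M₁) : diffMap I₁ I₁ (fun y : M₁ => y) x = ContinuousLinearMap.id ℝ E₁ :=
  mfderiv_id

theorem diffMap_fst (x : M₁ × M₂) :
    diffMap (I₁.prod I₂) I₁ Prod.fst x = ContinuousLinearMap.fst ℝ E₁ E₂ := mfderiv_fst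

theorem diffMap_snd (x : M₁ × M₂) :
    diffMap (I₁.prod I₂) I₂ Prod.snd x = ContinuousLinearMap.snd ℝ E₁ E₂ := mfderiv_snd

theorem diffMap_congr {f g : M₁ → M₂} {x : M₁} (h : f =ᶠ[𝓝 x] g) :
    diffMap I₁ I₂ f x = diffMap I₁ I₂ g x := h.mfderiv_eq

theorem fderivWithin_mapInChart_self [IsManifold I₁ ∞ M₁] [IsManifold I₂ ∞ M₂] {f : M₁ → M₂}
    (hf : ContMDiff I₁ I₂ ∞ f) (x : M₁) :
    fderivWithin ℝ (mapInChart I₁ I₂ f x (f x)) (range I₁) (extChartAt I₁ x x) =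
      diffMap I₁ I₂ f x := by
  have : IsManifold I₁ 1 M₁ := .of_le (n := ∞) (by simp)
  have : IsManifold I₂ 1 M₂ := .of_le (n := ∞) (by simp)
  have h := diffMap_comp_tangentOfChart (q₀ := x) (p₀ := f x) (mem_extChartAt_target (I := I₁) x)
    (hf _) (by rw [extChartAt_to_inv]; exact mem_extChartAt_source _)
  have h' : mapInChart I₁ I₂ f x (f x) (extChartAt I₁ x x) = extChartAt I₂ (f x) (f x) := by
    rw [mapInChart, extChartAt_to_inv]
  rw [h', tangentOfChart_self, tangentOfChart_self, extChartAt_to_inv] at h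
  exact h.symm

/-- Relatedness of vector fields read in charts. Equality on a whole neighbourhood, rather than at
the centre alone, is what allows it to be differentiated. -/
theorem fderivWithin_mapInChart_vfInChart [IsManifold I₁ ∞ M₁] [IsManifold I₂ ∞ M₂] {f : M₁ → M₂}
    (hf : ContMDiff I₁ I₂ ∞ f) {X : M₁ → E₁} {X' : M₂ → E₂}
    (hX : ∀ x, diffMap I₁ I₂ f x (X x) = X' (f x)) (x : M₁) :
    (fun y => fderivWithin ℝ (mapInChart I₁ I₂ f x (f x)) (range I₁) y (vfInChart I₁ X x y))
      =ᶠ[𝓝[range I₁] (extChartAt I₁ x x)]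
      fun y => vfInChart I₂ X' (f x) (mapInChart I₁ I₂ f x (f x) y) := by
  have : IsManifold I₂ 1 M₂ := .of_le (n := ∞) (by simp)
  have hc : ContinuousWithinAt (fun z => f ((extChartAt I₁ x).symm z)) (range I₁)
      (extChartAt I₁ x x) := hf.continuous.continuousAt.comp_continuousWithinAt
    (contMDiffWithinAt_extChartAt_symm_range_self (n := ∞) x).continuousWithinAt
  have hs : f ((extChartAt I₁ x).symm (extChartAt I₁ x x)) ∈ (extChartAt I₂ (f x)).source := by
    rw [extChartAt_to_inv]; exact mem_extChartAt_source _
  filter_upwards [extChartAt_target_mem_nhdsWithin x,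
    hc ((isOpen_extChartAt_source _).mem_nhds hs)] with y hy hy'
  have h := DFunLike.congr_fun (diffMap_comp_tangentOfChart hy (hf _) hy') (vfInChart I₁ X x y)
  simp only [ContinuousLinearMap.comp_apply] at h
  rw [tangentOfChart_vfInChart X hy, hX] at h
  have ht : mapInChart I₁ I₂ f x (f x) y ∈ (extChartAt I₂ (f x)).target :=
    (extChartAt I₂ (f x)).map_source hy'
  refine (vfInChart_eq_of_tangentOfChart ht ?_).symm
  rw [← h]
  congr 1
  exact ((extChartAt I₂ (f x)).left_inv hy').symm

theorem contDiffWithinAt_mapInChart_self [IsManifold I₁ ∞ M₁] [IsManifold I₂ ∞ M₂] {f : M₁ → M₂}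
    (hf : ContMDiff I₁ I₂ ∞ f) (x : M₁) :
    ContDiffWithinAt ℝ ∞ (mapInChart I₁ I₂ f x (f x)) (range I₁) (extChartAt I₁ x x) :=
  contDiffWithinAt_mapInChart (mem_extChartAt_target x) (hf _)
    (by rw [extChartAt_to_inv]; exact mem_extChartAt_source _)

theorem mapInChart_self (f : M₁ → M₂) (x : M₁) :
    mapInChart I₁ I₂ f x (f x) (extChartAt I₁ x x) = extChartAt I₂ (f x) (f x) := by
  rw [mapInChart, extChartAt_to_inv]

/-- The Lie bracket of related vector fields. -/
theorem diffMap_vfBr [IsManifold I₁ ∞ M₁] [IsManifold I₂ ∞ M₂] {f : M₁ → M₂}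
    (hf : ContMDiff I₁ I₂ ∞ f) {X Y : M₁ → E₁} {X' Y' : M₂ → E₂}
    (hXs : IsSmoothVF I₁ X) (hYs : IsSmoothVF I₁ Y) (hXs' : IsSmoothVF I₂ X')
    (hYs' : IsSmoothVF I₂ Y')
    (hX : ∀ x, diffMap I₁ I₂ f x (X x) = X' (f x))
    (hY : ∀ x, diffMap I₁ I₂ f x (Y x) = Y' (f x)) (x : M₁) :
    diffMap I₁ I₂ f x (vfBr I₁ X Y x) = vfBr I₂ X' Y' (f x) := by
  have hm := contDiffWithinAt_mapInChart_self hf x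
  have hr := extChartAt_self_mem_range (J := I₁) x
  have h := VectorField.fderivWithin_apply_lieBracket hm minSmoothness_two_le_infty
    I₁.uniqueDiffOn (I₁.range_subset_closure_interior hr) hr
    ((hYs x).differentiableWithinAt (by simp)) ((hXs x).differentiableWithinAt (by simp))
  -- The pushed-forward field equals `Z'` composed with the local expression of `f`, so the chain
  -- rule expresses its derivative by the derivative of `Z'`.
  have key : ∀ {Z : M₁ → E₁} {Z' : M₂ → E₂}, IsSmoothVF I₂ Z' →
      (∀ x, diffMap I₁ I₂ f x (Z x) = Z' (f x)) → ∀ v : E₁,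
      fderivWithin ℝ (fun y => fderivWithin ℝ (mapInChart I₁ I₂ f x (f x)) (range I₁) y
        (vfInChart I₁ Z x y)) (range I₁) (extChartAt I₁ x x) v =
        jetVF I₂ Z' (f x) (diffMap I₁ I₂ f x v) := by
    intro Z Z' hZs' hZ v
    rw [(fderivWithin_mapInChart_vfInChart hf hZ x).fderivWithin_eq_of_mem hr]
    have hd : DifferentiableWithinAt ℝ (vfInChart I₂ Z' (f x)) (range I₂)
        (mapInChart I₁ I₂ f x (f x) (extChartAt I₁ x x)) := by
      rw [mapInChart_self]
      exact (hZs' (f x)).differentiableWithinAt (by simp)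
    have hc := fderivWithin_fun_comp (extChartAt I₁ x x) hd (hm.differentiableWithinAt (by simp))
      (fun z _ => mapInChart_mem_range f x (f x) z) (uniqueDiffWithinAt_range x)
    rw [hc, fderivWithin_mapInChart_self hf, mapInChart_self]
    rfl
  rw [key hYs' hY, key hXs' hX, ← vfBr_eq, fderivWithin_mapInChart_self hf, vfInChart_self,
    vfInChart_self, hX, hY] at h
  rw [h, vfBr_eq_jet]

end DiffMap

/-- The exterior derivative of a one-form in terms of the Lie bracket. -/
theorem contr_vfBr_one {EP HP P W : Type*}
    [NormedAddCommGroup EP] [NormedSpace ℝ EP] [FiniteDimensional ℝ EP] [TopologicalSpace HP]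
    [TopologicalSpace P] [ChartedSpace HP P] [NormedAddCommGroup W] [NormedSpace ℝ W]
    {J : ModelWithCorners ℝ EP HP} [IsManifold J ∞ P] {X Y : P → EP}
    (hX : IsSmoothVF J X) (hY : IsSmoothVF J Y)
    {τ : P → EP [⋀^Fin 1]→L[ℝ] W} (hτ : IsSmoothForm J τ) :
    contr (vfBr J X Y) τ = contr X (extD J (contr Y τ)) - contr Y (extD J (contr X τ)) -
      contr Y (contr X (extD J τ)) := by
  rw [contr_vfBr hX hY hτ, lieD, lieD, contr_add]
  abel

/-! ### Lifts of vector fields to the principal bundle -/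

section Lift

variable {E H EG EP HP : Type*} [NormedAddCommGroup E] [NormedSpace ℝ E] [FiniteDimensional ℝ E]
  [TopologicalSpace H] [NormedAddCommGroup EG] [NormedSpace ℝ EG] [FiniteDimensional ℝ EG]
  [NormedAddCommGroup EP] [NormedSpace ℝ EP] [FiniteDimensional ℝ EP] [TopologicalSpace HP]
  {I : ModelWithCorners ℝ E H} {J : ModelWithCorners ℝ EP HP}
  {M : Type*} [TopologicalSpace M] [ChartedSpace H M] [IsManifold I ∞ M]
  {G : Type*} [TopologicalSpace G] [ChartedSpace EG G] [Group G] [LieGroup 𝓘(ℝ, EG) ∞ G]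
  {P : Type*} [TopologicalSpace P] [ChartedSpace HP P] [IsManifold J ∞ P]
  {W : Type*} [NormedAddCommGroup W] [NormedSpace ℝ W]

theorem PrincipalBundle.contMDiff_act_left (B : PrincipalBundle EG I J M G P) (p : P) :
    ContMDiff 𝓘(ℝ, EG) J ∞ (fun g : G => B.act p g) :=
  B.smooth_act.comp (contMDiff_const.prodMk contMDiff_id)

theorem PrincipalBundle.contMDiff_act_right (B : PrincipalBundle EG I J M G P) (g : G) :
    ContMDiff J J ∞ (fun p : P => B.act p g) :=
  B.smooth_act.comp (contMDiff_id.prodMk contMDiff_const)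

theorem dproj_fundVec (B : PrincipalBundle EG I J M G P) (p : P) (Y : EG) :
    dproj B p (fundVec B p Y) = 0 := by
  have h1 : MDifferentiableAt J I B.proj (B.act p (1 : G)) :=
    (B.smooth_proj _).mdifferentiableAt (by simp)
  have h2 : MDifferentiableAt 𝓘(ℝ, EG) J (fun g : G => B.act p g) 1 :=
    (B.contMDiff_act_left p 1).mdifferentiableAt (by simp)
  have h := diffMap_comp h1 h2
  have hc : B.proj ∘ (fun g : G => B.act p g) = fun _ => B.proj p := funext fun g => B.proj_act p g
  rw [hc, diffMap_const, B.act_one] at h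
  exact (DFunLike.congr_fun h Y).symm

theorem dproj_dact (B : PrincipalBundle EG I J M G P) (g : G) (p : P) (w : EP) :
    dproj B (B.act p g) (dact B g p w) = dproj B p w := by
  have h1 : MDifferentiableAt J I B.proj (B.act p g) :=
    (B.smooth_proj _).mdifferentiableAt (by simp)
  have h2 : MDifferentiableAt J J (fun q : P => B.act q g) p :=
    (B.contMDiff_act_right g p).mdifferentiableAt (by simp)
  have h := diffMap_comp (g := B.proj) (f := fun q : P => B.act q g) (x := p) h1 h2
  have hc : B.proj ∘ (fun q : P => B.act q g) = B.proj := funext fun q => B.proj_act q g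
  rw [hc] at h
  exact (DFunLike.congr_fun h w).symm

/-- Local triviality at the level of tangent spaces: the tangent space of `P` has the dimension of
the product, and vertical vectors are fundamental. -/
theorem exists_tangent_trivialization (B : PrincipalBundle EG I J M G P) (p : P) :
    ∃ L : EP →L[ℝ] E × EG, Function.Bijective L ∧ (∀ w, (L w).1 = dproj B p w) ∧
      ∀ y : EG, ∃ Y : EG, L (fundVec B p Y) = (0, y) := by
  obtain ⟨U, e, hU, hxU, hs, ht, he, hes, hp, ha⟩ := B.locally_trivial (B.proj p)
  have hps : p ∈ e.source := by rw [hs]; exact hxU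
  have hmd : e.MDifferentiable J (I.prod 𝓘(ℝ, EG)) :=
    ⟨he.mdifferentiableOn (by simp), hes.mdifferentiableOn (by simp)⟩
  have hd : MDifferentiableAt J (I.prod 𝓘(ℝ, EG)) e p := hmd.mdifferentiableAt hps
  refine ⟨diffMap J (I.prod 𝓘(ℝ, EG)) e p, hmd.mfderiv_bijective hps, fun w => ?_, fun y => ?_⟩
  · have h := diffMap_comp (I₃ := I) (g := Prod.fst) (f := e) (x := p) mdifferentiableAt_fst hd
    have hc : (Prod.fst ∘ e) =ᶠ[𝓝 p] B.proj := by
      filter_upwards [e.open_source.mem_nhds hps] with q hq using hp q hq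
    rw [diffMap_congr hc, diffMap_fst] at h
    exact (DFunLike.congr_fun h w).symm
  · set g₀ : G := (e p).2
    -- In the trivialization the orbit map through `p`, reparametrised by `l`, is `g ↦ (π p, g)`.
    -- Its differential at `g₀` is the inclusion of the group directions, so each of these comes
    -- from a fundamental vector.
    let l : G → G := fun g => g₀⁻¹ * g
    have hl : MDifferentiableAt 𝓘(ℝ, EG) 𝓘(ℝ, EG) l g₀ :=
      (contMDiff_mul_left (I := 𝓘(ℝ, EG)) (n := ∞) (a := g₀⁻¹) g₀).mdifferentiableAt (by simp)
    have hl0 : l g₀ = 1 := inv_mul_cancel g₀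
    have h1 : MDifferentiableAt 𝓘(ℝ, EG) J (fun g : G => B.act p g) (l g₀) :=
      (B.contMDiff_act_left p _).mdifferentiableAt (by simp)
    have h2 := diffMap_comp h1 hl
    have h3 : MDifferentiableAt 𝓘(ℝ, EG) J ((fun g : G => B.act p g) ∘ l) g₀ := h1.comp g₀ hl
    have hpt : ((fun g : G => B.act p g) ∘ l) g₀ = p := by
      simp only [Function.comp_apply, hl0, B.act_one]
    have hd' : MDifferentiableAt J (I.prod 𝓘(ℝ, EG)) e (((fun g : G => B.act p g) ∘ l) g₀) := by
      rw [hpt]; exact hd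
    have h4 := diffMap_comp hd' h3
    have hc : e ∘ ((fun g : G => B.act p g) ∘ l) = fun g => ((e p).1, g) := by
      funext g
      simp only [Function.comp_apply]
      rw [ha p hps]
      simp [l, g₀]
    have h5 : diffMap 𝓘(ℝ, EG) (I.prod 𝓘(ℝ, EG)) (fun g : G => ((e p).1, g)) g₀ =
        ContinuousLinearMap.inr ℝ E EG := mfderiv_prod_right
    rw [hc, h5, hpt, h2, hl0] at h4
    exact ⟨diffMap 𝓘(ℝ, EG) 𝓘(ℝ, EG) l g₀ y, (DFunLike.congr_fun h4 y).symm⟩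

/-- The vector of `T_pP` with given image in `T_{π p}M` and given value of the connection form. -/
def liftVec (B : PrincipalBundle EG I J M G P) (A : P → EP →L[ℝ] EG) (p : P) : E × EG →L[ℝ] EP :=
  ((dproj B p).prod (A p)).inverse

/-- A vector killed by `dπ` is fundamental, and `A` recovers its generator, so the map is injective;
local triviality makes the two dimensions equal. -/
theorem isInvertible_dproj_prod {B : PrincipalBundle EG I J M G P} {A : P → EP →L[ℝ] EG} {p : P}
    (hA : ∀ X, A p (fundVec B p X) = X) : ((dproj B p).prod (A p)).IsInvertible := by
  obtain ⟨L, hL, hL1, hL2⟩ := exists_tangent_trivialization B p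
  have hinj : Function.Injective ((dproj B p).prod (A p)) := by
    rw [injective_iff_map_eq_zero]
    intro w hw
    have hw1 : dproj B p w = 0 := congr_arg Prod.fst hw
    have hw2 : A p w = 0 := congr_arg Prod.snd hw
    obtain ⟨Y, hY⟩ := hL2 (L w).2
    have hwY : w = fundVec B p Y := hL.1 (by rw [hY]; exact Prod.ext (by rw [hL1, hw1]) rfl)
    rw [hwY, hA] at hw2
    rw [hwY, hw2, _root_.map_zero]
  have hdim : Module.finrank ℝ EP = Module.finrank ℝ (E × EG) :=
    (LinearEquiv.ofBijective L.toLinearMap hL).finrank_eq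
  have hbij : Function.Bijective ((dproj B p).prod (A p)).toLinearMap :=
    ⟨hinj, (LinearMap.injective_iff_surjective_of_finrank_eq_finrank hdim).1 hinj⟩
  exact ⟨(LinearEquiv.ofBijective _ hbij).toContinuousLinearEquiv, rfl⟩

section

variable {B : PrincipalBundle EG I J M G P} {A : P → EP →L[ℝ] EG}

theorem dproj_prod_liftVec (hA : IsConnection B A) (p : P) (z : E × EG) :
    ((dproj B p).prod (A p)) (liftVec B A p z) = z :=
  (isInvertible_dproj_prod (hA.vertical p)).self_apply_inverse z

theorem dproj_liftVec (hA : IsConnection B A) (p : P) (z : E × EG) :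
    dproj B p (liftVec B A p z) = z.1 := congr_arg Prod.fst (dproj_prod_liftVec hA p z)

theorem conn_liftVec (hA : IsConnection B A) (p : P) (z : E × EG) :
    A p (liftVec B A p z) = z.2 := congr_arg Prod.snd (dproj_prod_liftVec hA p z)

theorem eq_liftVec (hA : IsConnection B A) {p : P} {w : EP} {z : E × EG} (h1 : dproj B p w = z.1)
    (h2 : A p w = z.2) : w = liftVec B A p z := by
  apply (isInvertible_dproj_prod (hA.vertical p)).injective
  rw [dproj_prod_liftVec hA]
  exact Prod.ext h1 h2

theorem dact_liftVec (hA : IsConnection B A) (g : G) (p : P) (z : E × EG) :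
    dact B g p (liftVec B A p z) = liftVec B A (B.act p g) (z.1, Ad g⁻¹ z.2) := by
  apply eq_liftVec hA
  · rw [dproj_dact, dproj_liftVec hA]
  · rw [hA.equivariant, conn_liftVec hA]

/-- The vector field on `P` determined by a vector field on `M` and a section of `ad P`. -/
def lift (B : PrincipalBundle EG I J M G P) (A : P → EP →L[ℝ] EG) (η : Ghost EG I M P) (p : P) :
    EP :=
  liftVec B A p ((η.1 (B.proj p) : E), η.2 p 0)

theorem dproj_lift (hA : IsConnection B A) (η : Ghost EG I M P) (p : P) :
    dproj B p (lift B A η p) = η.1 (B.proj p) := dproj_liftVec hA p _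

theorem conn_lift (hA : IsConnection B A) (η : Ghost EG I M P) (p : P) :
    A p (lift B A η p) = η.2 p 0 := conn_liftVec hA p _

/-- The equivariances of `A` and of `c` match. This invariance is why Lie derivatives along lifts
preserve equivariant forms. -/
theorem dact_lift (hA : IsConnection B A) {η : Ghost EG I M P} (hη : IsGhost B η) (g : G) (p : P) :
    dact B g p (lift B A η p) = lift B A η (B.act p g) := by
  rw [lift, dact_liftVec hA, lift, B.proj_act]
  congr 2
  exact (hη.c.equivariant p g 0).symm

theorem IsGhost.isSmoothVF {η : Ghost EG I M P} (hη : IsGhost B η) :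
    IsSmoothVF I (fun x => (η.1 x : E)) := by
  have : CompleteSpace E := FiniteDimensional.complete ℝ E
  exact isSmoothVF_of_contMDiff hη.ξ

theorem pull_zero_apply (B : PrincipalBundle EG I J M G P) (τ : BForm E P W 0) (p : P)
    (v : Fin 0 → EP) : pull B τ p v = τ p 0 := by
  rw [pull, compContinuousLinearMap_apply]
  congr 1
  exact Subsingleton.elim _ _

theorem contDiffWithinAt_eval_zero {k : ℕ} {X : Type*} [NormedAddCommGroup X] [NormedSpace ℝ X]
    {f : X → EP [⋀^Fin k]→L[ℝ] W} {s : Set X} {x : X} (hf : ContDiffWithinAt ℝ ∞ f s x)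
    (v : Fin k → EP) : ContDiffWithinAt ℝ ∞ (fun y => f y v) s x := by
  have hc := ContinuousLinearMap.contDiff (n := ∞) (𝕜 := ℝ) (E := EP [⋀^Fin k]→L[ℝ] W)
    (F := W) (ContinuousAlternatingMap.apply ℝ EP W v)
  exact hc.comp_contDiffWithinAt hf

/-- In a chart the lift solves the linear system `n y (X y) = r y`, where `n` is the local
expression of `(dπ, A)` and `r` that of `(ξ, c)`. Both are smooth, `n` is invertible near the
centre, and inversion of operators is smooth. -/
theorem isSmoothVF_lift (hA : IsConnection B A) {η : Ghost EG I M P} (hη : IsGhost B η) :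
    IsSmoothVF J (lift B A η) := by
  have : IsManifold J 1 P := .of_le (n := ∞) (by simp)
  have : IsManifold I 1 M := .of_le (n := ∞) (by simp)
  have : CompleteSpace EP := FiniteDimensional.complete ℝ EP
  intro p
  set y₀ := extChartAt J p p
  set π := mapInChart J I B.proj p (B.proj p)
  have hr := extChartAt_self_mem_range (J := J) p
  have hπ : ContDiffWithinAt ℝ ∞ π (range J) y₀ := contDiffWithinAt_mapInChart_self B.smooth_proj p
  let a : EP → EP →L[ℝ] EG := fun y => (A ((extChartAt J p).symm y)).comp (tangentOfChart J p y)
  have ha : ContDiffWithinAt ℝ ∞ a (range J) y₀ := by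
    have h1 := hA.smooth.self p
    refine contDiffWithinAt_of_clm_apply fun v => ?_
    have h2 := contDiffWithinAt_eval_zero h1 (fun _ => v)
    exact h2
  let n : EP → EP →L[ℝ] E × EG := fun y => (fderivWithin ℝ π (range J) y).prod (a y)
  have hn : ContDiffWithinAt ℝ ∞ n (range J) y₀ := by
    refine contDiffWithinAt_of_clm_apply fun v => ?_
    exact ((hπ.fderivWithin_right J.uniqueDiffOn (by simp) hr).clm_apply
      contDiffWithinAt_const).prodMk (ha.clm_apply contDiffWithinAt_const)
  let r : EP → E × EG := fun y => (vfInChart I (fun x => (η.1 x : E)) (B.proj p) (π y),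
    inChart J (pull B η.2) p y 0)
  have hrs : ContDiffWithinAt ℝ ∞ r (range J) y₀ := by
    refine ContDiffWithinAt.prodMk ?_ (contDiffWithinAt_eval_zero (hη.c.smooth.self p) 0)
    have h1 := hη.isSmoothVF (B.proj p)
    rw [← mapInChart_self (I₁ := J) B.proj p] at h1
    exact h1.comp y₀ hπ (fun z _ => mapInChart_mem_range _ _ _ z)
  have hn0 : n y₀ = (dproj B p).prod (A p) := by
    have h1 : fderivWithin ℝ π (range J) y₀ = dproj B p :=
      fderivWithin_mapInChart_self B.smooth_proj p
    have h2 : a y₀ = A p := by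
      simp only [a, y₀]
      rw [extChartAt_to_inv, tangentOfChart_self]
      rfl
    simp only [n, h1, h2]
  obtain ⟨e, he⟩ := isInvertible_dproj_prod (hA.vertical p)
  have hinv : ∀ᶠ y in 𝓝[range J] y₀, (n y).IsInvertible := by
    have h1 : ∀ᶠ L in 𝓝 (n y₀), L.IsInvertible := by
      rw [hn0, ← he]
      exact ContinuousLinearEquiv.nhds e
    exact hn.continuousWithinAt.eventually h1
  have hsol : ∀ᶠ y in 𝓝[range J] y₀, n y (vfInChart J (lift B A η) p y) = r y := by
    have h1 := fderivWithin_mapInChart_vfInChart B.smooth_proj (X := lift B A η)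
      (X' := fun x => (η.1 x : E)) (fun q => dproj_lift hA η q) p
    filter_upwards [h1, extChartAt_target_mem_nhdsWithin p] with y hy hy'
    refine Prod.ext hy ?_
    change A _ (tangentOfChart J p y _) = pull B η.2 _ _
    rw [tangentOfChart_vfInChart _ hy', conn_lift hA, pull_zero_apply]
  have heq : vfInChart J (lift B A η) p =ᶠ[𝓝[range J] y₀] fun y => (n y).inverse (r y) := by
    filter_upwards [hinv, hsol] with y hy1 hy2
    rw [← hy2, hy1.inverse_apply_self]
  have hinvs : ContDiffAt ℝ ∞ ContinuousLinearMap.inverse (n y₀) := by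
    rw [hn0, ← he]
    exact contDiffAt_map_inverse e
  exact ((hinvs.comp_contDiffWithinAt y₀ hn).clm_apply hrs).congr_of_eventuallyEq heq
    (heq.eq_of_nhdsWithin hr)

end

end Lift

/-! ### The adjoint representation -/

section Adjoint

variable {EG : Type*} [NormedAddCommGroup EG] [NormedSpace ℝ EG]
  {G : Type*} [TopologicalSpace G] [ChartedSpace EG G] [Group G] [LieGroup 𝓘(ℝ, EG) ∞ G]

theorem contMDiff_conj (g : G) :
    ContMDiff 𝓘(ℝ, EG) 𝓘(ℝ, EG) ∞ (fun h : G => g * h * g⁻¹) :=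
  (contMDiff_const.mul contMDiff_id).mul contMDiff_const

theorem Ad_one : (Ad (1 : G) : EG →L[ℝ] EG) = ContinuousLinearMap.id ℝ EG := by
  have h : (fun h : G => (1 : G) * h * (1 : G)⁻¹) = fun h => h := by
    funext h
    simp
  change diffMap 𝓘(ℝ, EG) 𝓘(ℝ, EG) (fun h : G => (1 : G) * h * (1 : G)⁻¹) 1 = _
  rw [h, diffMap_id]

theorem Ad_mul (g h : G) : (Ad (g * h) : EG →L[ℝ] EG) = (Ad g).comp (Ad h) := by
  have hc : (fun k : G => g * h * k * (g * h)⁻¹) =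
      (fun k : G => g * k * g⁻¹) ∘ fun k : G => h * k * h⁻¹ := by
    funext k
    simp [mul_assoc]
  have h1 : h * 1 * h⁻¹ = 1 := by simp
  have hd := diffMap_comp (I₁ := 𝓘(ℝ, EG)) (I₂ := 𝓘(ℝ, EG)) (I₃ := 𝓘(ℝ, EG))
    (g := fun k : G => g * k * g⁻¹) (f := fun k : G => h * k * h⁻¹) (x := 1)
    ((contMDiff_conj g _).mdifferentiableAt (by simp))
    ((contMDiff_conj h _).mdifferentiableAt (by simp))
  rw [← hc, h1] at hd
  exact hd

variable (EG G) in
/-- The adjoint representation of a Lie group. -/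
def adRep : G →* (EG →L[ℝ] EG) where
  toFun := Ad
  map_one' := Ad_one
  map_mul' := Ad_mul

/-- The differential in the second variable at `1` depends smoothly on the first variable. Its
target is the tangent space at the moving point `f g 1`, whence the composition with the chart at `f
g₀ 1`. Conjugation gives `Ad`, and multiplication the invariant vector fields. -/
theorem contMDiffAt_chartDiff_comp_diffMap (f : G → G → G)
    (hf : ContMDiff (𝓘(ℝ, EG).prod 𝓘(ℝ, EG)) 𝓘(ℝ, EG) ∞ (Function.uncurry f)) (g₀ : G) :
    ContMDiffAt 𝓘(ℝ, EG) 𝓘(ℝ, EG →L[ℝ] EG) ∞ (fun g => (chartDiff 𝓘(ℝ, EG) (f g₀ 1) (f g 1)).comp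
      (diffMap 𝓘(ℝ, EG) 𝓘(ℝ, EG) (f g) 1)) g₀ := by
  have : IsManifold 𝓘(ℝ, EG) 1 G := .of_le (n := ∞) (by simp)
  have h := ContMDiffAt.mfderiv (I := 𝓘(ℝ, EG)) (I' := 𝓘(ℝ, EG)) (J := 𝓘(ℝ, EG)) (n := ∞) (m := ∞)
    (x₀ := g₀) f (fun _ => 1) hf.contMDiffAt contMDiffAt_const (by simp)
  refine h.congr_of_eventuallyEq ?_
  have hc : ContinuousAt (fun g => f g 1) g₀ :=
    (hf.continuous.comp (continuous_id.prodMk continuous_const)).continuousAt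
  filter_upwards [hc ((chartAt EG (f g₀ 1)).open_source.mem_nhds (mem_chart_source _ _))] with g hg
  have hy : g ∈ (fun g => f g 1) ⁻¹' (chartAt EG (f g₀ 1)).source := hg
  have h1 := inTangentCoordinates_eq_mfderiv_comp (I := 𝓘(ℝ, EG)) (I' := 𝓘(ℝ, EG))
    (f := fun _ : G => (1 : G)) (g := fun g => f g 1)
    (ϕ := fun g => mfderiv 𝓘(ℝ, EG) 𝓘(ℝ, EG) (f g) 1) (x₀ := g₀) (x := g) (mem_chart_source _ _) hy
  have h2 := tangentOfChart_self (J := 𝓘(ℝ, EG)) (1 : G)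
  refine Eq.trans ?_ h1.symm
  refine Eq.trans ?_ (congr_arg (fun L => (chartDiff 𝓘(ℝ, EG) (f g₀ 1) (f g 1)).comp
    ((diffMap 𝓘(ℝ, EG) 𝓘(ℝ, EG) (f g) 1).comp L)) h2.symm)
  rfl

theorem contMDiff_adRep : ContMDiff 𝓘(ℝ, EG) 𝓘(ℝ, EG →L[ℝ] EG) ∞ (adRep EG G) := by
  have : IsManifold 𝓘(ℝ, EG) 1 G := .of_le (n := ∞) (by simp)
  intro g₀
  have h := contMDiffAt_chartDiff_comp_diffMap (EG := EG) (fun g h : G => g * h * g⁻¹)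
    ((contMDiff_fst.mul contMDiff_snd).mul contMDiff_fst.inv) g₀
  refine h.congr_of_eventuallyEq (Eventually.of_forall fun g => ?_)
  have h1 : ∀ g : G, g * 1 * g⁻¹ = 1 := by simp
  simp only [h1, chartDiff_self]
  rfl

/-- The invariant vector fields are smooth. -/
theorem isSmoothVF_mulInvariantVectorField (v : EG) :
    IsSmoothVF 𝓘(ℝ, EG) (fun g : G => diffMap 𝓘(ℝ, EG) 𝓘(ℝ, EG) (fun h => g * h) 1 v) := by
  have : IsManifold 𝓘(ℝ, EG) 1 G := .of_le (n := ∞) (by simp)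
  intro g₀
  have h := contMDiffAt_chartDiff_comp_diffMap (EG := EG) (fun g h : G => g * h)
    (contMDiff_fst.mul contMDiff_snd) g₀
  have h' := (contDiffWithinAt_comp_extChartAt_symm h).clm_apply (contDiffWithinAt_const (c := v))
  have he : vfInChart 𝓘(ℝ, EG) (fun g : G => diffMap 𝓘(ℝ, EG) 𝓘(ℝ, EG) (fun h => g * h) 1 v) g₀ =
      fun y => ((fun g => (chartDiff 𝓘(ℝ, EG) (g₀ * 1) (g * 1)).comp
      (diffMap 𝓘(ℝ, EG) 𝓘(ℝ, EG) (fun h => g * h) 1)) ∘ (extChartAt 𝓘(ℝ, EG) g₀).symm) y v := by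
    funext y
    simp only [mul_one]
    rfl
  rw [he]
  exact h'

end Adjoint

/-! ### Vertical derivatives of equivariant forms -/

section Vertical

variable {E H EG EP HP : Type*} [NormedAddCommGroup E] [NormedSpace ℝ E] [FiniteDimensional ℝ E]
  [TopologicalSpace H] [NormedAddCommGroup EG] [NormedSpace ℝ EG] [FiniteDimensional ℝ EG]
  [NormedAddCommGroup EP] [NormedSpace ℝ EP] [FiniteDimensional ℝ EP] [TopologicalSpace HP]
  {I : ModelWithCorners ℝ E H} {J : ModelWithCorners ℝ EP HP}
  {M : Type*} [TopologicalSpace M] [ChartedSpace H M] [IsManifold I ∞ M]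
  {G : Type*} [TopologicalSpace G] [ChartedSpace EG G] [Group G] [LieGroup 𝓘(ℝ, EG) ∞ G]
  {P : Type*} [TopologicalSpace P] [ChartedSpace HP P] [IsManifold J ∞ P]
  {W : Type*} [NormedAddCommGroup W] [NormedSpace ℝ W]
  {B : PrincipalBundle EG I J M G P}

theorem diffMap_act_inl (B : PrincipalBundle EG I J M G P) (p : P) (g : G) (w : EP) :
    diffMap (J.prod 𝓘(ℝ, EG)) J (fun q : P × G => B.act q.1 q.2) (p, g) (w, 0) =
      dact B g p w := by
  have h := diffMap_comp (I₁ := J) (g := fun q : P × G => B.act q.1 q.2) (f := fun q : P => (q, g))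
    (x := p) ((B.smooth_act _).mdifferentiableAt (by simp))
    (mdifferentiableAt_id.prodMk mdifferentiableAt_const)
  have h5 : diffMap J (J.prod 𝓘(ℝ, EG)) (fun q : P => (q, g)) p =
      ContinuousLinearMap.inl ℝ EP EG := mfderiv_prod_left
  rw [h5] at h
  exact (DFunLike.congr_fun h w).symm

theorem diffMap_act_inr (B : PrincipalBundle EG I J M G P) (p : P) (g : G) (Y : EG) :
    diffMap (J.prod 𝓘(ℝ, EG)) J (fun q : P × G => B.act q.1 q.2) (p, g) (0, Y) =
      diffMap 𝓘(ℝ, EG) J (fun h => B.act p h) g Y := by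
  have h := diffMap_comp (I₁ := 𝓘(ℝ, EG)) (g := fun q : P × G => B.act q.1 q.2)
    (f := fun h : G => (p, h))
    (x := g) ((B.smooth_act _).mdifferentiableAt (by simp))
    (mdifferentiableAt_const.prodMk mdifferentiableAt_id)
  have h5 : diffMap 𝓘(ℝ, EG) (J.prod 𝓘(ℝ, EG)) (fun h : G => (p, h)) g =
      ContinuousLinearMap.inr ℝ EP EG := mfderiv_prod_right
  rw [h5] at h
  exact (DFunLike.congr_fun h Y).symm

theorem dact_one (B : PrincipalBundle EG I J M G P) (p : P) (w : EP) : dact B 1 p w = w := by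
  have h : (fun q => B.act q 1) = fun q : P => q := funext B.act_one
  change diffMap J J (fun q => B.act q 1) p w = w
  rw [h, diffMap_id]
  rfl

/-- The differential of an orbit map in terms of the fundamental vector fields. -/
theorem diffMap_orbit (B : PrincipalBundle EG I J M G P) (p : P) (g : G) (Y : EG) :
    diffMap 𝓘(ℝ, EG) J (fun h => B.act p h) g Y =
      fundVec B (B.act p g) (diffMap 𝓘(ℝ, EG) 𝓘(ℝ, EG) (fun h => g⁻¹ * h) g Y) := by
  have h := diffMap_comp (I₁ := 𝓘(ℝ, EG)) (I₂ := 𝓘(ℝ, EG)) (I₃ := J)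
    (g := fun h : G => B.act (B.act p g) h) (f := fun h : G => g⁻¹ * h) (x := g)
    ((B.contMDiff_act_left _ _).mdifferentiableAt (by simp))
    ((contMDiff_mul_left (I := 𝓘(ℝ, EG)) (n := ∞) (a := g⁻¹) g).mdifferentiableAt (by simp))
  have hc : (fun h : G => B.act (B.act p g) h) ∘ (fun h : G => g⁻¹ * h) = fun h => B.act p h := by
    funext h
    simp [← B.act_mul]
  rw [hc, inv_mul_cancel] at h
  exact DFunLike.congr_fun h Y

/-- Cartan calculus for a form on the total space which is equivariant up to a form on the group. -/
theorem curryLeft_extD_fundVec (R : G →* (W →L[ℝ] W))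
    (hR : ContMDiff 𝓘(ℝ, EG) 𝓘(ℝ, W →L[ℝ] W) ∞ R) {k : ℕ} {Ψ : P → EP [⋀^Fin k]→L[ℝ] W}
    (hΨ : IsSmoothForm J Ψ) {θ : G → EG [⋀^Fin k]→L[ℝ] W} (hθ : IsSmoothForm 𝓘(ℝ, EG) θ)
    (h : opForm (fun q : P × G => R q.2)
      (pullForm (J.prod 𝓘(ℝ, EG)) J (fun q : P × G => B.act q.1 q.2) Ψ) =
      pullForm (J.prod 𝓘(ℝ, EG)) J Prod.fst Ψ + pullForm (J.prod 𝓘(ℝ, EG)) 𝓘(ℝ, EG) Prod.snd θ)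
    (hθ0 : ∀ Y, (extD 𝓘(ℝ, EG) θ 1).curryLeft Y 0 = 0) (p : P) (Y : EG) :
    (extD J Ψ p).curryLeft (fundVec B p Y) =
      -(infRep R Y).compContinuousAlternatingMap (Ψ p) := by
  have hS : ContMDiff (J.prod 𝓘(ℝ, EG)) 𝓘(ℝ, W →L[ℝ] W) ∞ (fun q : P × G => R q.2) :=
    hR.comp contMDiff_snd
  have ha : IsSmoothForm (J.prod 𝓘(ℝ, EG))
      (pullForm (J.prod 𝓘(ℝ, EG)) J (fun q : P × G => B.act q.1 q.2) Ψ) := hΨ.pullForm B.smooth_act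
  -- The equivariance identity on `P × G` is differentiated exteriorly at `(p, 1)` and then
  -- evaluated on `(0, Y), (w₀, 0), …`. In the Leibniz term only the summand that differentiates `R`
  -- along `Y` survives.
  have h1 := congr_fun (congr_arg (extD (J.prod 𝓘(ℝ, EG))) h) (p, 1)
  rw [extD_add (hΨ.pullForm contMDiff_fst) (hθ.pullForm contMDiff_snd),
    extD_pullForm contMDiff_fst hΨ, extD_pullForm contMDiff_snd hθ,
    extD_opForm (hS (p, 1)) ha, extD_pullForm B.smooth_act hΨ] at h1
  have hdS : ∀ w Z, diffMap (J.prod 𝓘(ℝ, EG)) 𝓘(ℝ, W →L[ℝ] W) (fun q : P × G => R q.2) (p, 1)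
      (w, Z) = infRep R Z := by
    intro w Z
    have h2 := diffMap_comp (I₁ := J.prod 𝓘(ℝ, EG)) (g := R) (f := Prod.snd) (x := (p, (1 : G)))
      ((hR _).mdifferentiableAt (by simp)) mdifferentiableAt_snd
    rw [diffMap_snd] at h2
    exact DFunLike.congr_fun h2 (w, Z)
  have hone : B.act p 1 = p := B.act_one p
  ext w
  set v : Fin (k + 1) → EP × EG := Fin.cons (0, Y) fun i => (w i, 0) with hv
  have h3 := DFunLike.congr_fun h1 v
  rw [ContinuousAlternatingMap.add_apply, alternatizeUncurryFin_apply, Fin.sum_univ_succ,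
    Finset.sum_eq_zero, Pi.add_apply, ContinuousAlternatingMap.add_apply] at h3
  · have e1 : pullForm (J.prod 𝓘(ℝ, EG)) J Prod.fst (extD J Ψ) (p, (1 : G)) v = 0 := by
      rw [pullForm, diffMap_fst]
      exact (extD J Ψ p).map_coord_zero 0 rfl
    -- The group components of `v` are `Y, 0, …, 0`, so `hθ0` is a genuine condition only for `k =
    -- 0`.
    have e2 : pullForm (J.prod 𝓘(ℝ, EG)) 𝓘(ℝ, EG) Prod.snd (extD 𝓘(ℝ, EG) θ) (p, (1 : G)) v = 0 := by
      rw [pullForm, diffMap_snd, ← hθ0 Y, compContinuousLinearMap_apply, curryLeft_apply_apply]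
      congr 1
      funext i
      refine Fin.cases ?_ (fun i => ?_) i <;> simp [hv]
    have e3 : (R (1 : G)).compContinuousAlternatingMap (pullForm (J.prod 𝓘(ℝ, EG)) J
        (fun q : P × G => B.act q.1 q.2) (extD J Ψ) (p, 1)) v =
        (extD J Ψ p).curryLeft (fundVec B p Y) w := by
      rw [_root_.map_one, ContinuousLinearMap.compContinuousAlternatingMap_coe, Function.comp_apply,
        pullForm, compContinuousLinearMap_apply, curryLeft_apply_apply]
      simp only [hone]
      refine congr_arg (extD J Ψ p) (funext fun i => ?_)
      refine Fin.cases ?_ (fun i => ?_) i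
      · exact diffMap_act_inr B p 1 Y
      · exact (diffMap_act_inl B p 1 (w i)).trans (dact_one B p (w i))
    have e4 : pullForm (J.prod 𝓘(ℝ, EG)) J (fun q : P × G => B.act q.1 q.2) Ψ (p, 1)
        ((0 : Fin (k + 1)).removeNth v) = Ψ p w := by
      rw [pullForm, compContinuousLinearMap_apply]
      simp only [hone]
      refine congr_arg (Ψ p) (funext fun i => ?_)
      exact (diffMap_act_inl B p 1 (w i)).trans (dact_one B p (w i))
    rw [e1, e2, e3, add_zero, add_zero] at h3
    have e5 : (((ContinuousLinearMap.compContinuousAlternatingMapCLM ℝ (EP × EG) W W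
        (Fin k)).flip (pullForm (J.prod 𝓘(ℝ, EG)) J (fun q : P × G => B.act q.1 q.2) Ψ (p, 1))).comp
        (diffMap (J.prod 𝓘(ℝ, EG)) 𝓘(ℝ, W →L[ℝ] W) (fun q : P × G => R q.2) (p, 1)) (v 0))
        ((0 : Fin (k + 1)).removeNth v) = infRep R Y (Ψ p w) := by
      have h0 : v 0 = (0, Y) := rfl
      rw [← e4, ContinuousLinearMap.comp_apply, h0, hdS]
      rfl
    rw [e5, Fin.val_zero, pow_zero, one_smul] at h3
    rw [ContinuousAlternatingMap.neg_apply, ContinuousLinearMap.compContinuousAlternatingMap_coe,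
      Function.comp_apply]
    exact eq_neg_of_add_eq_zero_right h3
  · intro i _
    have h0 : v i.succ = (w i, 0) := rfl
    rw [ContinuousLinearMap.comp_apply, h0, hdS, _root_.map_zero, _root_.map_zero]
    simp

/-- The form on `P` given by a bundle-valued form, translated by the structure group. -/
theorem opForm_pullForm_pull (R : G →* (W →L[ℝ] W)) {k : ℕ} {τ : BForm E P W k}
    (hτ : IsForm B R τ) : opForm (fun q : P × G => R q.2)
      (pullForm (J.prod 𝓘(ℝ, EG)) J (fun q : P × G => B.act q.1 q.2) (pull B τ)) =
      pullForm (J.prod 𝓘(ℝ, EG)) J Prod.fst (pull B τ) := by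
  funext ⟨p, g⟩
  ext v
  have h := diffMap_comp (I₁ := J.prod 𝓘(ℝ, EG)) (I₂ := J) (I₃ := I) (g := B.proj)
    (f := fun q : P × G => B.act q.1 q.2) (x := (p, g))
    ((B.smooth_proj _).mdifferentiableAt (by simp)) ((B.smooth_act _).mdifferentiableAt (by simp))
  have h' := diffMap_comp (I₁ := J.prod 𝓘(ℝ, EG)) (I₂ := J) (I₃ := I) (g := B.proj)
    (f := Prod.fst) (x := (p, g))
    ((B.smooth_proj _).mdifferentiableAt (by simp)) mdifferentiableAt_fst
  have hc : B.proj ∘ (fun q : P × G => B.act q.1 q.2) = B.proj ∘ Prod.fst :=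
    funext fun q => B.proj_act q.1 q.2
  rw [hc, h'] at h
  have hv : ∀ w, dproj B (B.act p g)
      (diffMap (J.prod 𝓘(ℝ, EG)) J (fun q : P × G => B.act q.1 q.2) (p, g) w) =
      dproj B p (diffMap (J.prod 𝓘(ℝ, EG)) J Prod.fst (p, g) w) :=
    fun w => (DFunLike.congr_fun h w).symm
  have hRR : ∀ x, R g (R g⁻¹ x) = x := fun x => by
    change (R g * R g⁻¹) x = x
    rw [← _root_.map_mul, mul_inv_cancel, _root_.map_one]
    rfl
  change R g (τ (B.act p g) fun i => dproj B (B.act p g)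
    (diffMap (J.prod 𝓘(ℝ, EG)) J (fun q : P × G => B.act q.1 q.2) (p, g) (v i))) =
    τ p fun i => dproj B p (diffMap (J.prod 𝓘(ℝ, EG)) J Prod.fst (p, g) (v i))
  simp only [hv]
  rw [hτ.equivariant, hRR]

/-- Infinitesimal equivariance: a pulled-back form is horizontal, so its Lie derivative along a
fundamental field reduces to the contraction of its differential. No correction form on `G` is
needed here. -/
theorem IsForm.curryLeft_extD_fundVec {R : G →* (W →L[ℝ] W)}
    (hR : ContMDiff 𝓘(ℝ, EG) 𝓘(ℝ, W →L[ℝ] W) ∞ R) {k : ℕ} {τ : BForm E P W k}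
    (hτ : IsForm B R τ) (p : P) (Y : EG) :
    (extD J (pull B τ) p).curryLeft (fundVec B p Y) =
      -(infRep R Y).compContinuousAlternatingMap (pull B τ p) := by
  have h0 : IsSmoothForm 𝓘(ℝ, EG) (0 : G → EG [⋀^Fin k]→L[ℝ] W) :=
    fun _ => contDiffOn_const (c := (0 : EG [⋀^Fin k]→L[ℝ] W))
  refine GaugeDiffeo.curryLeft_extD_fundVec R hR hτ.smooth h0 ?_ (fun Y => ?_) p Y
  · rw [opForm_pullForm_pull R hτ]
    exact (add_zero _).symm
  · rw [extD_zero]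
    simp

/-- The Maurer-Cartan form of `G`, as the restriction of a connection form to an orbit. -/
theorem conn_orbit {A : P → EP →L[ℝ] EG} (hA : IsConnection B A) (p : P) (g : G) (Y : EG) :
    A (B.act p g) (diffMap 𝓘(ℝ, EG) J (fun h => B.act p h) g Y) =
      diffMap 𝓘(ℝ, EG) 𝓘(ℝ, EG) (fun h => g⁻¹ * h) g Y := by
  rw [diffMap_orbit, hA.vertical]

/-- Under the action map `A` pulls back to `Ad g⁻¹ A` plus the Maurer-Cartan form. Applying `Ad g`
leaves a discrepancy `θ` that lives on `G` alone, and it can be read off from the single orbit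
through `p`. -/
theorem IsConnection.extD_fundVec {A : P → EP →L[ℝ] EG} (hA : IsConnection B A) (p : P) (Y : EG)
    (w : EP) : extD J (fun q => asForm (A q)) p ![fundVec B p Y, w] =
      -infRep (Ad : G → EG →L[ℝ] EG) Y (A p w) := by
  have hθ : IsSmoothForm 𝓘(ℝ, EG) (opForm (adRep EG G)
      (pullForm 𝓘(ℝ, EG) J (fun h => B.act p h) (fun q => asForm (A q)))) :=
    (hA.smooth.pullForm (B.contMDiff_act_left p)).opForm contMDiff_adRep
  have h := curryLeft_extD_fundVec (adRep EG G) contMDiff_adRep hA.smooth hθ (B := B) ?_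
    (fun Y => map_coord_zero _ 0 rfl) p Y
  · have h1 := DFunLike.congr_fun h ![w]
    exact h1
  · funext ⟨q, g⟩
    ext v
    have hvv : ∀ z : EP × EG, diffMap (J.prod 𝓘(ℝ, EG)) J (fun q : P × G => B.act q.1 q.2) (q, g) z =
        dact B g q z.1 + diffMap 𝓘(ℝ, EG) J (fun h => B.act q h) g z.2 := by
      intro z
      rw [← diffMap_act_inl, ← diffMap_act_inr, ← _root_.map_add]
      simp
    have hRR : ∀ x : EG, Ad g (Ad g⁻¹ x) = x := fun x => by
      rw [← ContinuousLinearMap.comp_apply, ← Ad_mul, mul_inv_cancel, Ad_one]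
      rfl
    change Ad g (A (B.act q g) (diffMap (J.prod 𝓘(ℝ, EG)) J (fun q : P × G => B.act q.1 q.2) (q, g)
      (v 0))) = A q (diffMap (J.prod 𝓘(ℝ, EG)) J Prod.fst (q, g) (v 0)) +
      Ad g (A (B.act p g) (diffMap 𝓘(ℝ, EG) J (fun h => B.act p h) g
        (diffMap (J.prod 𝓘(ℝ, EG)) 𝓘(ℝ, EG) Prod.snd (q, g) (v 0))))
    rw [hvv, _root_.map_add, _root_.map_add, hA.equivariant, hRR, conn_orbit hA, conn_orbit hA,
      diffMap_fst, diffMap_snd]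
    rfl

theorem extD_const (v : W) : extD J (fun _ : P => constOfIsEmpty ℝ EP (Fin 0) v) = 0 := by
  funext p
  have h : inChart J (fun _ : P => constOfIsEmpty ℝ EP (Fin 0) v) p =
      fun _ => constOfIsEmpty ℝ EP (Fin 0) v := rfl
  rw [extD_eq, h, extDerivWithin, fderivWithin_const_apply]
  exact _root_.map_zero (alternatizeUncurryFinCLM ℝ EP W)

/-- The derivative of the adjoint representation is the bracket. -/
theorem IsConnection.infRep_Ad {A : P → EP →L[ℝ] EG} (hA : IsConnection B A) (p : P) (Y Z : EG) :
    infRep (Ad : G → EG →L[ℝ] EG) Y Z = lieBr G Y Z := by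
  -- Restricted to an orbit, `A` is the Maurer-Cartan form: constant on invariant fields, so `θ([Y,
  -- Z]) = -dθ(Y, Z)`, while naturality and `extD_fundVec` compute `dθ` through the differential of
  -- `Ad`.
  set θ := pullForm 𝓘(ℝ, EG) J (fun h : G => B.act p h) (fun q => asForm (A q)) with hθ
  have hθs : IsSmoothForm 𝓘(ℝ, EG) θ := hA.smooth.pullForm (B.contMDiff_act_left p)
  let X : EG → G → EG := fun v g => diffMap 𝓘(ℝ, EG) 𝓘(ℝ, EG) (fun h => g * h) 1 v
  have hX : ∀ v, IsSmoothVF 𝓘(ℝ, EG) (X v) := isSmoothVF_mulInvariantVectorField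
  have hX1 : ∀ v, X v 1 = v := fun v => by
    have h : (fun h : G => 1 * h) = fun h => h := funext one_mul
    simp only [X]
    rw [h, diffMap_id]
    rfl
  have hθX : ∀ v, contr (X v) θ = fun _ => constOfIsEmpty ℝ EG (Fin 0) v := by
    intro v
    funext g
    ext u
    change A (B.act p g) (diffMap 𝓘(ℝ, EG) J (fun h => B.act p h) g (X v g)) = v
    have h := diffMap_comp (I₁ := 𝓘(ℝ, EG)) (I₂ := 𝓘(ℝ, EG)) (I₃ := 𝓘(ℝ, EG))
      (g := fun h : G => g⁻¹ * h) (f := fun h : G => g * h) (x := 1)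
      ((contMDiff_mul_left (I := 𝓘(ℝ, EG)) (n := ∞) (a := g⁻¹) _).mdifferentiableAt (by simp))
      ((contMDiff_mul_left (I := 𝓘(ℝ, EG)) (n := ∞) (a := g) _).mdifferentiableAt (by simp))
    have hc : (fun h : G => g⁻¹ * h) ∘ (fun h : G => g * h) = fun h => h := by
      funext h
      simp
    rw [hc, diffMap_id, mul_one] at h
    rw [conn_orbit hA]
    exact (DFunLike.congr_fun h v).symm
  have hbr := congr_fun (contr_vfBr_one (hX Y) (hX Z) hθs) 1
  rw [hθX, hθX, extD_const, extD_const, contr_zero, contr_zero, sub_zero, zero_sub, hθ,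
    extD_pullForm (B.contMDiff_act_left p) hA.smooth] at hbr
  have hone : B.act p 1 = p := B.act_one p
  have h1 : A (B.act p 1) (fundVec B p (vfBr 𝓘(ℝ, EG) (X Y) (X Z) 1)) =
      -extD J (fun q => asForm (A q)) (B.act p 1) (fun i => fundVec B p
        ((Fin.cons (X Y 1) (Fin.cons (X Z 1) (0 : Fin 0 → EG)) : Fin 2 → EG) i)) :=
    DFunLike.congr_fun hbr 0
  have h2 : (fun i => fundVec B p
      ((Fin.cons (X Y 1) (Fin.cons (X Z 1) (0 : Fin 0 → EG)) : Fin 2 → EG) i)) =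
      ![fundVec B p Y, fundVec B p Z] := by
    funext i
    fin_cases i
    · exact congr_arg (fundVec B p) (hX1 Y)
    · exact congr_arg (fundVec B p) (hX1 Z)
  rw [h2, hone, hA.extD_fundVec, hA.vertical, hA.vertical, neg_neg] at h1
  exact h1.symm

end Vertical

/-! ### The components of the vector field Q -/

section Components

variable {E H EG EP HP : Type*} [NormedAddCommGroup E] [NormedSpace ℝ E] [FiniteDimensional ℝ E]
  [TopologicalSpace H] [NormedAddCommGroup EG] [NormedSpace ℝ EG] [FiniteDimensional ℝ EG]
  [NormedAddCommGroup EP] [NormedSpace ℝ EP] [FiniteDimensional ℝ EP] [TopologicalSpace HP]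
  {I : ModelWithCorners ℝ E H} {J : ModelWithCorners ℝ EP HP}
  {M : Type*} [TopologicalSpace M] [ChartedSpace H M] [IsManifold I ∞ M]
  {G : Type*} [TopologicalSpace G] [ChartedSpace EG G] [Group G] [LieGroup 𝓘(ℝ, EG) ∞ G]
  {P : Type*} [TopologicalSpace P] [ChartedSpace HP P] [IsManifold J ∞ P]
  {W : Type*} [NormedAddCommGroup W] [NormedSpace ℝ W]
  {B : PrincipalBundle EG I J M G P}
  {A : P → EP →L[ℝ] EG}

/-- By antisymmetry, invariance in the first slot passes to every slot, and arguments are replaced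
one at a time. It is applied to the horizontal projection `L`. -/
theorem compContinuousLinearMap_eq_of_curryLeft {k : ℕ} (γ : EP [⋀^Fin (k + 1)]→L[ℝ] W)
    (L : EP →L[ℝ] EP) (h : ∀ v, γ.curryLeft (L v) = γ.curryLeft v) :
    γ.compContinuousLinearMap L = γ := by
  induction k with
  | zero =>
    ext v
    have h1 := DFunLike.congr_fun (h (v 0)) (fun i => L (Fin.tail v i))
    rw [compContinuousLinearMap_apply]
    have h2 : (L ∘ v) = Fin.cons (L (v 0)) (fun i => L (Fin.tail v i)) := by
      funext i
      refine Fin.cases rfl (fun i => rfl) i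
    have h3 : v = Fin.cons (v 0) (fun i => L (Fin.tail v i)) := by
      funext i
      refine Fin.cases rfl (fun i => i.elim0) i
    rw [h2]
    conv_rhs => rw [h3]
    exact h1
  | succ k ih =>
    ext v
    have h1 := ih (γ.curryLeft (v 0)) fun w => by
      rw [curryLeft_swap, h, curryLeft_swap, neg_neg]
    have h2 := DFunLike.congr_fun h1 (Fin.tail v)
    have h3 := DFunLike.congr_fun (h (v 0)) (fun i => L (Fin.tail v i))
    have h4 : γ v = γ.curryLeft (v 0) (Fin.tail v) := by
      rw [curryLeft_apply_apply]
      exact congr_arg γ (Fin.cons_self_tail v).symm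
    rw [h4, ← h2, compContinuousLinearMap_apply, compContinuousLinearMap_apply]
    refine Eq.trans ?_ h3
    rw [curryLeft_apply_apply]
    refine congr_arg γ (funext fun i => ?_)
    refine Fin.cases rfl (fun i => rfl) i

theorem hlift_dproj (hA : IsConnection B A) (p : P) (w : EP) :
    hlift B A p (dproj B p w) = w - fundVec B p (A p w) := by
  refine (eq_liftVec hA (z := (dproj B p w, 0)) ?_ ?_).symm
  · rw [_root_.map_sub, dproj_fundVec, sub_zero]
  · rw [_root_.map_sub, hA.vertical, sub_self]

theorem conn_hlift (hA : IsConnection B A) (p : P) (u : E) : A p (hlift B A p u) = 0 :=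
  conn_liftVec hA p (u, 0)

theorem dproj_hlift (hA : IsConnection B A) (p : P) (u : E) : dproj B p (hlift B A p u) = u :=
  dproj_liftVec hA p (u, 0)

/-- The action of the connection form, through a representation, on a form on `P`. -/
def connAct (R : G → W →L[ℝ] W) (A : P → EP →L[ℝ] EG) {k : ℕ} (Ψ : P → EP [⋀^Fin k]→L[ℝ] W) (p : P) :
    EP →L[ℝ] EP [⋀^Fin k]→L[ℝ] W :=
  ((ContinuousLinearMap.compContinuousAlternatingMapCLM ℝ EP W W (Fin k)).flip (Ψ p)).comp
    ((infRep R).comp (A p))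

theorem connAct_apply (R : G → W →L[ℝ] W) {k : ℕ} (Ψ : P → EP [⋀^Fin k]→L[ℝ] W) (p : P)
    (w : EP) : connAct R A Ψ p w = (infRep R (A p w)).compContinuousAlternatingMap (Ψ p) := rfl

theorem contract_comp_connAct (R : G → W →L[ℝ] W) {k : ℕ}
    (Ψ : P → EP [⋀^Fin (k + 1)]→L[ℝ] W) (X : P → EP) (p : P) :
    (contract (X p)).comp (connAct R A Ψ p) = connAct R A (contr X Ψ) p := by
  ext w u
  rfl

theorem pull_curryLeft_fundVec {k : ℕ} (τ : BForm E P W (k + 1)) (p : P) (Y : EG) :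
    (pull B τ p).curryLeft (fundVec B p Y) = 0 := by
  ext u
  exact (τ p).map_coord_zero 0 (dproj_fundVec B p Y)

/-- The covariant exterior derivative in terms of the connection form. -/
theorem pull_covD {R : G →* (W →L[ℝ] W)} (hR : ContMDiff 𝓘(ℝ, EG) 𝓘(ℝ, W →L[ℝ] W) ∞ R)
    (hA : IsConnection B A) {k : ℕ} {τ : BForm E P W k} (hτ : IsForm B R τ) (p : P) :
    pull B (covD B A τ) p =
      extD J (pull B τ) p + alternatizeUncurryFin (connAct R A (pull B τ) p) := by
  set γ := extD J (pull B τ) p + alternatizeUncurryFin (connAct R A (pull B τ) p) with hγ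
  -- `γ` is horizontal: contraction of the differential with a fundamental vector gives `-ρ(Y)`,
  -- that of the connection term gives `ρ(Y)`, and the form itself vanishes on vertical vectors.
  have hfund : ∀ Y, γ.curryLeft (fundVec B p Y) = 0 := by
    intro Y
    rw [hγ, curryLeft_add, _root_.add_apply, hτ.curryLeft_extD_fundVec hR]
    cases k with
    | zero =>
      rw [curryLeft_alternatizeUncurryFin_zero, connAct_apply, hA.vertical]
      exact neg_add_cancel _
    | succ k =>
      rw [curryLeft_alternatizeUncurryFin, connAct_apply, hA.vertical]
      have h0 : (contract (fundVec B p Y)).comp (connAct R A (pull B τ) p) = 0 := by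
        ext w u
        change infRep R (A p w) ((pull B τ p).curryLeft (fundVec B p Y) u) = 0
        rw [pull_curryLeft_fundVec]
        exact _root_.map_zero _
      rw [h0]
      have h1 : alternatizeUncurryFin (0 : EP →L[ℝ] EP [⋀^Fin k]→L[ℝ] W) = 0 :=
        _root_.map_zero (alternatizeUncurryFinCLM ℝ EP W)
      rw [h1, sub_zero]
      exact neg_add_cancel _
  -- Being horizontal, `γ` may be evaluated on horizontal projections, where the connection term
  -- vanishes and the rest is the definition of `covD`.
  rw [← compContinuousLinearMap_eq_of_curryLeft γ ((hlift B A p).comp (dproj B p)) fun w => by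
    rw [ContinuousLinearMap.comp_apply, hlift_dproj hA, _root_.map_sub, hfund, sub_zero]]
  have h2 : (alternatizeUncurryFin (connAct R A (pull B τ) p)).compContinuousLinearMap
      ((hlift B A p).comp (dproj B p)) = 0 := by
    rw [alternatizeUncurryFin_compContinuousLinearMap]
    have h3 : (connAct R A (pull B τ) p).comp ((hlift B A p).comp (dproj B p)) = 0 := by
      ext w u
      change infRep R (A p (hlift B A p (dproj B p w))) _ = 0
      rw [conn_hlift hA, _root_.map_zero]
      rfl
    rw [h3, ContinuousLinearMap.comp_zero]
    exact _root_.map_zero (alternatizeUncurryFinCLM ℝ EP W)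
  have h4 : γ.compContinuousLinearMap ((hlift B A p).comp (dproj B p)) =
      (extD J (pull B τ) p).compContinuousLinearMap ((hlift B A p).comp (dproj B p)) +
      (alternatizeUncurryFin (connAct R A (pull B τ) p)).compContinuousLinearMap
      ((hlift B A p).comp (dproj B p)) := rfl
  rw [h4, h2, add_zero]
  rfl

theorem lieBr_antisymm (Y Z : EG) : lieBr G Y Z = -lieBr G Z Y := by
  exact congr_fun (VectorField.mlieBracket_swap (I := 𝓘(ℝ, EG))
    (V := mulInvariantVectorField (I := 𝓘(ℝ, EG)) (G := G) Y)
    (W := mulInvariantVectorField (I := 𝓘(ℝ, EG)) (G := G) Z)) 1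

/-- The structure equation. -/
theorem curvature_dproj (hA : IsConnection B A) (p : P) (v w : EP) :
    curvature B A p ![dproj B p v, dproj B p w] =
      extD J (fun q => asForm (A q)) p ![v, w] + lieBr G (A p v) (A p w) := by
  set Ω := extD J (fun q => asForm (A q)) p
  have hsub : ∀ a b c, Ω ![a - b, c] = Ω ![a, c] - Ω ![b, c] := by
    intro a b c
    have h := DFunLike.congr_fun (_root_.map_sub Ω.curryLeft a b) ![c]
    exact h
  have hswap : ∀ a b, Ω ![a, b] = - Ω ![b, a] := fun a b =>
    DFunLike.congr_fun (curryLeft_swap Ω a b) ![]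
  have hl : curvature B A p ![dproj B p v, dproj B p w] =
      Ω ![hlift B A p (dproj B p v), hlift B A p (dproj B p w)] := by
    refine congr_arg Ω (funext fun i => ?_)
    fin_cases i <;> rfl
  have hf : ∀ Y u, Ω ![fundVec B p Y, u] = -infRep (Ad : G → EG →L[ℝ] EG) Y (A p u) :=
    hA.extD_fundVec p
  -- The vertical correction in the first slot is paired with a horizontal vector and vanishes; the
  -- one in the second slot produces the bracket.
  rw [hl, hlift_dproj hA, hlift_dproj hA, hsub, hf, hswap v, hsub, hf, _root_.map_sub, hA.vertical,
    sub_self, _root_.map_zero, hA.infRep_Ad p, lieBr_antisymm (A p w), hswap w]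
  abel

/-- Pulled-back forms ignore vertical components, so any field over `ξ` may be used, in particular a
lift with an arbitrary `c`. -/
theorem pull_iota {k : ℕ} (τ : BForm E P W (k + 1)) {ξ : ∀ x : M, TangentSpace I x} {X : P → EP}
    (hX : ∀ p, dproj B p (X p) = ξ (B.proj p)) : pull B (iota B ξ τ) = contr X (pull B τ) := by
  funext p
  ext u
  change τ p _ = τ p _
  refine congr_arg (τ p) (funext fun i => ?_)
  refine Fin.cases ?_ (fun i => rfl) i
  exact (hX p).symm

theorem IsForm.iota {R : G → W →L[ℝ] W} {k : ℕ} {τ : BForm E P W (k + 1)} (hτ : IsForm B R τ)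
    (hA : IsConnection B A) {η : Ghost EG I M P} (hη : IsGhost B η) :
    IsForm B R (iota B η.1 τ) where
  smooth := by
    rw [pull_iota τ (dproj_lift hA η)]
    exact hτ.smooth.contr (isSmoothVF_lift hA hη)
  equivariant p g u := by
    have h := hτ.equivariant p g (Fin.cons (η.1 (B.proj p) : E) u)
    rw [← B.proj_act p g] at h
    refine h.trans ?_
    rw [B.proj_act p g]
    rfl

/-- Horizontal lifts form a right inverse of `dπ`. Identities between bundle-valued forms can
therefore be checked on `P`. -/
theorem pull_inj (hA : IsConnection B A) {k : ℕ} {τ τ' : BForm E P W k}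
    (h : pull B τ = pull B τ') : τ = τ' := by
  funext p
  ext u
  have h1 := DFunLike.congr_fun (congr_fun h p) (fun i => hlift B A p (u i))
  have h2 : (fun i => dproj B p (hlift B A p (u i))) = u := funext fun i => dproj_hlift hA p (u i)
  change τ p (fun i => dproj B p (hlift B A p (u i))) = τ' p _ at h1
  rw [h2] at h1
  exact h1.trans (congr_arg (τ' p) h2)

/-! ### The components of Q as Lie derivatives along lifts -/

section Ghosts

variable {V : Type*} [NormedAddCommGroup V] [NormedSpace ℝ V] {R : G →* (V →L[ℝ] V)}
  {x : Fields E EG EP P V}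

/-- The sign of `gD` at ghost number 1 turns `-d_A c` into a plus; the same happens to `-d_A ι_ξ` in
`Q_Φ_succ`. -/
theorem Q_A (η : Fin 1 → Ghost EG I M P) :
    (Q B R).A x η = iota B (η 0).1 (curvature B x.A) + covD B x.A (η 0).2 := by
  simp [Q, gIota, gD, oddMul, xiCoord, cCoord, curvFun]

theorem Q_Φ_zero (η : Fin 1 → Ghost EG I M P) :
    (Q B R).Φ x η 0 = iota B (η 0).1 (covD B x.A (x.Φ 0)) - rhoAct R (η 0).2 (x.Φ 0) := by
  simp [Q, covLie, gIota, gD, oddMul, xiCoord, cCoord, phiCoord]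

theorem Q_Φ_succ (η : Fin 1 → Ghost EG I M P) (k : ℕ) :
    (Q B R).Φ x η (k + 1) = iota B (η 0).1 (covD B x.A (x.Φ (k + 1))) +
      covD B x.A (iota B (η 0).1 (x.Φ (k + 1))) - rhoAct R (η 0).2 (x.Φ (k + 1)) := by
  simp [Q, covLie, gIota, gD, oddMul, xiCoord, cCoord, phiCoord]

theorem Q_ξ (η : Fin 2 → Ghost EG I M P) :
    (Q B R).ξ x η = VectorField.mlieBracket I (η 0).1 (η 1).1 := by
  have h : VectorField.mlieBracket I (η 1).1 (η 0).1 = -VectorField.mlieBracket I (η 0).1 (η 1).1 :=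
    VectorField.mlieBracket_swap
  have h0 : (Q B R).ξ x η = (1 / 2 : ℝ) • (VectorField.mlieBracket I (η 0).1 (η 1).1 -
      VectorField.mlieBracket I (η 1).1 (η 0).1) := by
    simp [Q, oddMul, xiCoord, Fin.sum_univ_two, Fin.removeNth, sub_eq_add_neg]
  rw [h0, h, sub_neg_eq_add, ← two_smul ℝ, smul_smul]
  norm_num

theorem Q_c (η : Fin 2 → Ghost EG I M P) :
    (Q B R).c x η = iota B (η 1).1 (iota B (η 0).1 (curvature B x.A)) -
      adBr G (η 0).2 (η 1).2 := by
  -- The minus sign comes from the outer `gIota`, which acts at ghost number 1. Each difference is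
  -- twice one of its terms, which absorbs the factor one half.
  have h0 : (Q B R).c x η = (1 / 2 : ℝ) • (-(iota B (η 0).1 (iota B (η 1).1 (curvature B x.A)) -
      iota B (η 1).1 (iota B (η 0).1 (curvature B x.A)))) -
      (1 / 2 : ℝ) • (adBr G (η 0).2 (η 1).2 - adBr G (η 1).2 (η 0).2) := by
    simp [Q, gIota, oddMul, xiCoord, cCoord, curvFun, Fin.sum_univ_two, Fin.removeNth,
      sub_eq_add_neg]
    exact add_comm _ _
  have h1 : iota B (η 0).1 (iota B (η 1).1 (curvature B x.A)) =
      -iota B (η 1).1 (iota B (η 0).1 (curvature B x.A)) := by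
    funext p
    exact curryLeft_swap _ _ _
  have h2 : adBr G (η 1).2 (η 0).2 = -adBr G (η 0).2 (η 1).2 := by
    funext p
    ext u
    exact lieBr_antisymm _ _
  rw [h0, h1, h2, sub_neg_eq_add, ← two_smul ℝ, ← neg_add', neg_neg, ← two_smul ℝ, smul_smul,
    smul_smul]
  norm_num

/-- Since `A` takes the values `c` on the lifts, the bracket in the structure equation is exactly
the one subtracted in `Q c`. -/
theorem pull_Q_c (hx : IsConnection B x.A) (η : Fin 2 → Ghost EG I M P) :
    pull B ((Q B R).c x η) = contr (lift B x.A (η 1)) (contr (lift B x.A (η 0))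
      (extD J (fun p => asForm (x.A p)))) := by
  funext p
  ext u
  have h := curvature_dproj hx p (lift B x.A (η 0) p) (lift B x.A (η 1) p)
  rw [conn_lift hx, conn_lift hx, dproj_lift hx, dproj_lift hx] at h
  rw [Q_c, pull_zero_apply]
  refine (eq_sub_of_add_eq ?_).symm
  refine Eq.trans ?_ (h.symm.trans ?_)
  · congr 1
    refine congr_arg (extD J (fun q => asForm (x.A q)) p) (funext fun i => ?_)
    refine Fin.cases rfl (fun i => ?_) i
    fin_cases i
    rfl
  · refine congr_arg (curvature B x.A p) (funext fun i => ?_)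
    refine Fin.cases rfl (fun i => ?_) i
    fin_cases i
    rfl

theorem contr_lift_conn (hx : IsConnection B x.A) (η : Ghost EG I M P) :
    contr (lift B x.A η) (fun p => asForm (x.A p)) = pull B η.2 := by
  funext p
  ext u
  rw [pull_zero_apply, ← conn_lift hx]
  rfl

/-- Cartan's formula gives `ι_X dA + dc`. The structure equation puts `[c, A]` into the curvature
term, `pull_covD` puts `[A, c]` into `d_A c`, and the two cancel. -/
theorem pull_Q_A (hx : IsConnection B x.A) {η : Fin 1 → Ghost EG I M P} (hη : IsGhost B (η 0)) :
    pull B ((Q B R).A x η) = lieD J (lift B x.A (η 0)) (fun p => asForm (x.A p)) := by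
  rw [lieD, contr_lift_conn hx]
  funext p
  have h1 : pull B ((Q B R).A x η) p = pull B (iota B (η 0).1 (curvature B x.A)) p +
      pull B (covD B x.A (η 0).2) p := by
    rw [Q_A]
    rfl
  have h2 := pull_covD (R := adRep EG G) contMDiff_adRep hx hη.c p
  rw [h1, h2, Pi.add_apply]
  ext u
  have hu : u = ![u 0] := by
    funext i
    fin_cases i
    rfl
  have h := curvature_dproj hx p (lift B x.A (η 0) p) (u 0)
  rw [conn_lift hx, dproj_lift hx, lieBr_antisymm] at h
  have h3 : pull B (iota B (η 0).1 (curvature B x.A)) p u = curvature B x.A p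
      ![((η 0).1 (B.proj p) : E), dproj B p (u 0)] := by
    refine congr_arg (curvature B x.A p) (funext fun i => ?_)
    refine Fin.cases rfl (fun i => ?_) i
    fin_cases i
    rfl
  have h4 : alternatizeUncurryFin (connAct (adRep EG G) x.A (pull B (η 0).2) p) u =
      lieBr G (x.A p (u 0)) ((η 0).2 p 0) := by
    rw [← hx.infRep_Ad p, ← pull_zero_apply B (η 0).2 p (Fin.tail u)]
    have h5 := DFunLike.congr_fun (curryLeft_alternatizeUncurryFin_zero
      (connAct (adRep EG G) x.A (pull B (η 0).2) p) (u 0)) (Fin.tail u)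
    rw [curryLeft_apply_apply] at h5
    refine Eq.trans (congr_arg _ ?_) h5
    exact (Fin.cons_self_tail u).symm
  rw [ContinuousAlternatingMap.add_apply, ContinuousAlternatingMap.add_apply,
    ContinuousAlternatingMap.add_apply, h3, h4, h]
  have h6 : contr (lift B x.A (η 0)) (extD J fun p => asForm (x.A p)) p u =
      extD J (fun q => asForm (x.A q)) p ![lift B x.A (η 0) p, u 0] := by
    refine congr_arg (extD J (fun q => asForm (x.A q)) p) (funext fun i => ?_)
    refine Fin.cases rfl (fun i => ?_) i
    fin_cases i
    rfl
  rw [h6]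
  abel

/-- Contracting the connection term of `d_A Φ` with the lift yields `ρ(c) Φ`, cancelled by the last
term of `Q Φ`, and minus the connection term of `d_A ι_ξ Φ`. -/
theorem pull_Q_Φ (hR : ContMDiff 𝓘(ℝ, EG) 𝓘(ℝ, V →L[ℝ] V) ∞ R) (hx : IsField B R x)
    {η : Fin 1 → Ghost EG I M P} (hη : IsGhost B (η 0)) (k : ℕ) :
    pull B ((Q B R).Φ x η k) = lieD J (lift B x.A (η 0)) (pull B (x.Φ k)) := by
  have hact : ∀ (k : ℕ) (τ : BForm E P V k) (p : P), connAct R x.A (pull B τ) p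
      (lift B x.A (η 0) p) = pull B (rhoAct R (η 0).2 τ) p := by
    intro k τ p
    rw [connAct_apply, conn_lift hx.A]
    rfl
  funext p
  cases k with
  | zero =>
    have h1 : pull B ((Q B R).Φ x η 0) p = pull B (iota B (η 0).1 (covD B x.A (x.Φ 0))) p -
        pull B (rhoAct R (η 0).2 (x.Φ 0)) p := by
      rw [Q_Φ_zero]
      rfl
    rw [h1, pull_iota _ (dproj_lift hx.A (η 0)), contr, pull_covD hR hx.A (hx.Φ 0), curryLeft_add,
      _root_.add_apply, curryLeft_alternatizeUncurryFin_zero, hact, add_sub_cancel_right]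
    rfl
  | succ k =>
    have h1 : pull B ((Q B R).Φ x η (k + 1)) p =
        pull B (iota B (η 0).1 (covD B x.A (x.Φ (k + 1)))) p +
        pull B (covD B x.A (iota B (η 0).1 (x.Φ (k + 1)))) p -
        pull B (rhoAct R (η 0).2 (x.Φ (k + 1))) p := by
      rw [Q_Φ_succ]
      rfl
    rw [h1, pull_iota _ (dproj_lift hx.A (η 0)), contr, pull_covD hR hx.A (hx.Φ (k + 1)),
      pull_covD hR hx.A ((hx.Φ (k + 1)).iota hx.A hη), curryLeft_add,
      _root_.add_apply, curryLeft_alternatizeUncurryFin, hact, contract_comp_connAct,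
      pull_iota _ (dproj_lift hx.A (η 0)), lieD, Pi.add_apply, contr]
    abel

end Ghosts

end Components

/-! ### The vector field Q is well defined -/

section WellDefined

variable {E H EG EP HP : Type*} [NormedAddCommGroup E] [NormedSpace ℝ E] [FiniteDimensional ℝ E]
  [TopologicalSpace H] [NormedAddCommGroup EG] [NormedSpace ℝ EG] [FiniteDimensional ℝ EG]
  [NormedAddCommGroup EP] [NormedSpace ℝ EP] [FiniteDimensional ℝ EP] [TopologicalSpace HP]
  {I : ModelWithCorners ℝ E H} {J : ModelWithCorners ℝ EP HP}
  {M : Type*} [TopologicalSpace M] [ChartedSpace H M] [IsManifold I ∞ M]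
  {G : Type*} [TopologicalSpace G] [ChartedSpace EG G] [Group G] [LieGroup 𝓘(ℝ, EG) ∞ G]
  {P : Type*} [TopologicalSpace P] [ChartedSpace HP P] [IsManifold J ∞ P]
  {W : Type*} [NormedAddCommGroup W] [NormedSpace ℝ W]
  {B : PrincipalBundle EG I J M G P}
  {A : P → EP →L[ℝ] EG}

/-- A form on `P` which is equivariant under the structure group. -/
def IsEquivariantForm (B : PrincipalBundle EG I J M G P) (R : G → W →L[ℝ] W) {k : ℕ}
    (Ψ : P → EP [⋀^Fin k]→L[ℝ] W) : Prop :=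
  ∀ g, pullForm J J (fun p => B.act p g) Ψ = opForm (fun _ => R g⁻¹) Ψ

theorem IsForm.isEquivariantForm {R : G → W →L[ℝ] W} {k : ℕ} {τ : BForm E P W k}
    (hτ : IsForm B R τ) : IsEquivariantForm B R (pull B τ) := by
  intro g
  funext p
  ext u
  refine Eq.trans ?_ (hτ.equivariant p g fun i => dproj B p (u i))
  exact congr_arg (τ (B.act p g)) (funext fun i => dproj_dact B g p (u i))

theorem IsConnection.isEquivariantForm (hA : IsConnection B A) :
    IsEquivariantForm B Ad (fun p => asForm (A p)) := by
  intro g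
  funext p
  ext u
  exact hA.equivariant p g (u 0)

theorem IsEquivariantForm.extD {R : G → W →L[ℝ] W} {k : ℕ} {Ψ : P → EP [⋀^Fin k]→L[ℝ] W}
    (h : IsEquivariantForm B R Ψ) (hs : IsSmoothForm J Ψ) : IsEquivariantForm B R (extD J Ψ) := by
  intro g
  rw [← extD_pullForm (B.contMDiff_act_right g) hs, h g, opForm_const_extD _ hs]

theorem IsEquivariantForm.contr {R : G → W →L[ℝ] W} {k : ℕ} {Ψ : P → EP [⋀^Fin (k + 1)]→L[ℝ] W}
    (h : IsEquivariantForm B R Ψ) {X : P → EP}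
    (hX : ∀ g p, dact B g p (X p) = X (B.act p g)) : IsEquivariantForm B R (contr X Ψ) := by
  intro g
  funext p
  ext u
  have h1 := DFunLike.congr_fun (congr_fun (h g) p) (Fin.cons (X p) u)
  refine Eq.trans ?_ h1
  refine congr_arg (Ψ (B.act p g)) (funext fun i => ?_)
  refine Fin.cases ?_ (fun i => rfl) i
  exact (hX g p).symm

theorem IsEquivariantForm.add {R : G → W →L[ℝ] W} {k : ℕ} {Ψ Ψ' : P → EP [⋀^Fin k]→L[ℝ] W}
    (h : IsEquivariantForm B R Ψ) (h' : IsEquivariantForm B R Ψ') :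
    IsEquivariantForm B R (Ψ + Ψ') := by
  intro g
  funext p
  ext u
  have h1 := DFunLike.congr_fun (congr_fun (h g) p) u
  have h2 := DFunLike.congr_fun (congr_fun (h' g) p) u
  refine (congr_arg₂ (· + ·) h1 h2).trans ?_
  exact (_root_.map_add (R g⁻¹) _ _).symm

theorem IsEquivariantForm.lieD {R : G → W →L[ℝ] W} {k : ℕ} {Ψ : P → EP [⋀^Fin k]→L[ℝ] W}
    (h : IsEquivariantForm B R Ψ) (hs : IsSmoothForm J Ψ) {X : P → EP} (hXs : IsSmoothVF J X)
    (hX : ∀ g p, dact B g p (X p) = X (B.act p g)) : IsEquivariantForm B R (lieD J X Ψ) := by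
  cases k with
  | zero => exact (h.extD hs).contr hX
  | succ k => exact ((h.extD hs).contr hX).add ((h.contr hX).extD (hs.contr hXs))

/-- Equivariance is tested on horizontal lifts: a lift of `u` and its right translate both project
to `u`. -/
theorem isForm_of_pull (hA : IsConnection B A) {R : G → W →L[ℝ] W} {k : ℕ} {τ : BForm E P W k}
    (hs : IsSmoothForm J (pull B τ)) (he : IsEquivariantForm B R (pull B τ)) : IsForm B R τ where
  smooth := hs
  equivariant p g u := by
    have h := DFunLike.congr_fun (congr_fun (he g) p) (fun i => hlift B A p (u i))
    have h1 : (fun i => dproj B p (hlift B A p (u i))) = u :=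
      funext fun i => dproj_hlift hA p (u i)
    have h2 : (fun i => dproj B (B.act p g) (dact B g p (hlift B A p (u i)))) = u :=
      funext fun i => (dproj_dact B g p _).trans (dproj_hlift hA p (u i))
    change τ (B.act p g) (fun i => dproj B (B.act p g) (dact B g p (hlift B A p (u i)))) =
      R g⁻¹ (τ p fun i => dproj B p (hlift B A p (u i))) at h
    rwa [h1, h2] at h

theorem lift_smul_add (B : PrincipalBundle EG I J M G P) (A : P → EP →L[ℝ] EG) (a : ℝ)
    (u v : Ghost EG I M P) : lift B A (a • u + v) = a • lift B A u + lift B A v := by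
  funext p
  have h : lift B A (a • u + v) p =
      liftVec B A p (a • (show E × EG from ((u.1 (B.proj p) : E), u.2 p 0)) +
        (show E × EG from ((v.1 (B.proj p) : E), v.2 p 0))) := rfl
  rw [h, _root_.map_add, _root_.map_smul]
  rfl

theorem IsVF.smul {ξ : ∀ x : M, TangentSpace I x} (h : IsVF I ξ) (a : ℝ) : IsVF I (a • ξ) := by
  have : IsManifold I (∞ + 1) M := .of_le (n := ∞) (by simp)
  exact ContMDiff.const_smul_section h

theorem IsVF.add {ξ ξ' : ∀ x : M, TangentSpace I x} (h : IsVF I ξ) (h' : IsVF I ξ') :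
    IsVF I (ξ + ξ') := by
  have : IsManifold I (∞ + 1) M := .of_le (n := ∞) (by simp)
  exact ContMDiff.add_section h h'

theorem IsForm.smul_add {R : G → W →L[ℝ] W} {k : ℕ} {τ τ' : BForm E P W k} (hτ : IsForm B R τ)
    (hτ' : IsForm B R τ') (a : ℝ) : IsForm B R (a • τ + τ') where
  smooth := (hτ.smooth.smul a).add hτ'.smooth
  equivariant p g u := by
    change a • τ (B.act p g) u + τ' (B.act p g) u = R g⁻¹ (a • τ p u + τ' p u)
    rw [hτ.equivariant, hτ'.equivariant, _root_.map_add, _root_.map_smul]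

theorem IsGhost.smul_add {u v : Ghost EG I M P} (hu : IsGhost B u) (hv : IsGhost B v) (a : ℝ) :
    IsGhost B (a • u + v) :=
  ⟨(hu.ξ.smul a).add hv.ξ, hu.c.smul_add hv.c a⟩

theorem lieD_lift_smul_add (hA : IsConnection B A) {u v : Ghost EG I M P} (hu : IsGhost B u)
    (hv : IsGhost B v) (a : ℝ) {k : ℕ} {Ψ : P → EP [⋀^Fin k]→L[ℝ] W} (hΨ : IsSmoothForm J Ψ) :
    lieD J (lift B A (a • u + v)) Ψ = a • lieD J (lift B A u) Ψ + lieD J (lift B A v) Ψ := by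
  rw [lift_smul_add, lieD_add_left ((isSmoothVF_lift hA hu).smul a) (isSmoothVF_lift hA hv) hΨ,
    lieD_smul_left]

theorem pull_smul_add (B : PrincipalBundle EG I J M G P) {k : ℕ} (a : ℝ) (τ τ' : BForm E P W k) :
    pull B (a • τ + τ') = a • pull B τ + pull B τ' := rfl

/-! ### Values, linearity and antisymmetry of the components of Q -/

section Ghosts

variable {V : Type*} [NormedAddCommGroup V] [NormedSpace ℝ V] {R : G →* (V →L[ℝ] V)}
  {x : Fields E EG EP P V}

theorem isForm_Q_A (hx : IsConnection B x.A) {η : Fin 1 → Ghost EG I M P} (hη : IsGhost B (η 0)) :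
    IsForm B Ad ((Q B R).A x η) := by
  refine isForm_of_pull hx ?_ ?_ <;> rw [pull_Q_A hx hη]
  · exact hx.smooth.lieD (isSmoothVF_lift hx hη)
  · exact hx.isEquivariantForm.lieD hx.smooth (isSmoothVF_lift hx hη) (dact_lift hx hη)

theorem isForm_Q_Φ (hR : ContMDiff 𝓘(ℝ, EG) 𝓘(ℝ, V →L[ℝ] V) ∞ R) (hx : IsField B R x)
    {η : Fin 1 → Ghost EG I M P} (hη : IsGhost B (η 0)) (k : ℕ) :
    IsForm B R ((Q B R).Φ x η k) := by
  refine isForm_of_pull hx.A ?_ ?_ <;> rw [pull_Q_Φ hR hx hη]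
  · exact (hx.Φ k).smooth.lieD (isSmoothVF_lift hx.A hη)
  · exact (hx.Φ k).isEquivariantForm.lieD (hx.Φ k).smooth (isSmoothVF_lift hx.A hη)
      (dact_lift hx.A hη)

theorem isForm_Q_c (hx : IsConnection B x.A) {η : Fin 2 → Ghost EG I M P}
    (hη : ∀ i, IsGhost B (η i)) : IsForm B Ad ((Q B R).c x η) := by
  refine isForm_of_pull hx ?_ ?_ <;> rw [pull_Q_c hx]
  · exact (hx.smooth.extD.contr (isSmoothVF_lift hx (hη 0))).contr (isSmoothVF_lift hx (hη 1))
  · exact ((hx.isEquivariantForm.extD hx.smooth).contr (dact_lift hx (hη 0))).contr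
      (dact_lift hx (hη 1))

theorem isVF_mlieBracket {ξ ξ' : ∀ x : M, TangentSpace I x} (h : IsVF I ξ) (h' : IsVF I ξ') :
    IsVF I (VectorField.mlieBracket I ξ ξ') := by
  have : CompleteSpace E := FiniteDimensional.complete ℝ E
  have : IsManifold I (minSmoothness ℝ 2) M := .of_le (n := ∞) minSmoothness_two_le_infty
  have : IsManifold I (((⊤ : ℕ∞) : WithTop ℕ∞) + 1) M := .of_le (n := ∞) (by simp)
  intro y
  exact ContMDiffAt.mlieBracket_vectorField (m := ⊤) (n := ⊤) (h y) (h' y) (by simp)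

theorem isVF_Q_ξ {η : Fin 2 → Ghost EG I M P} (hη : ∀ i, IsGhost B (η i)) :
    IsVF I ((Q B R).ξ x η) := by
  rw [Q_ξ]
  exact isVF_mlieBracket (hη 0).ξ (hη 1).ξ

theorem IsVF.mdifferentiableAt {ξ : ∀ x : M, TangentSpace I x} (h : IsVF I ξ) (y : M) :
    MDifferentiableAt I I.tangent (fun x => (⟨x, ξ x⟩ : TangentBundle I M)) y :=
  (h y).mdifferentiableAt (by simp)

theorem Q_A_linear (hx : IsConnection B x.A) (η : Fin 1 → Ghost EG I M P) (i : Fin 1)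
    {u v : Ghost EG I M P} (hu : IsGhost B u) (hv : IsGhost B v) (a : ℝ) :
    (Q B R).A x (Function.update η i (a • u + v)) =
      a • (Q B R).A x (Function.update η i u) + (Q B R).A x (Function.update η i v) := by
  fin_cases i
  have huv : IsGhost B (a • u + v) := hu.smul_add hv a
  apply pull_inj hx
  rw [pull_smul_add, pull_Q_A hx (by simpa using huv), pull_Q_A hx (by simpa using hu),
    pull_Q_A hx (by simpa using hv)]
  simp only [Fin.zero_eta, Function.update_self]
  exact lieD_lift_smul_add hx hu hv a hx.smooth

theorem Q_Φ_linear (hR : ContMDiff 𝓘(ℝ, EG) 𝓘(ℝ, V →L[ℝ] V) ∞ R) (hx : IsField B R x)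
    (η : Fin 1 → Ghost EG I M P) (i : Fin 1)
    {u v : Ghost EG I M P} (hu : IsGhost B u) (hv : IsGhost B v) (a : ℝ) :
    (Q B R).Φ x (Function.update η i (a • u + v)) =
      a • (Q B R).Φ x (Function.update η i u) + (Q B R).Φ x (Function.update η i v) := by
  fin_cases i
  have huv : IsGhost B (a • u + v) := hu.smul_add hv a
  funext k
  apply pull_inj hx.A
  rw [Pi.add_apply, Pi.smul_apply, pull_smul_add, pull_Q_Φ hR hx (by simpa using huv),
    pull_Q_Φ hR hx (by simpa using hu), pull_Q_Φ hR hx (by simpa using hv)]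
  simp only [Fin.zero_eta, Function.update_self]
  exact lieD_lift_smul_add hx.A hu hv a (hx.Φ k).smooth

/-- `Q c` involves the ghosts pointwise, without derivatives, so no smoothness of `u` and `v` is
required. -/
theorem Q_c_linear (hx : IsConnection B x.A) (η : Fin 2 → Ghost EG I M P) (i : Fin 2)
    (u v : Ghost EG I M P) (a : ℝ) :
    (Q B R).c x (Function.update η i (a • u + v)) =
      a • (Q B R).c x (Function.update η i u) + (Q B R).c x (Function.update η i v) := by
  apply pull_inj hx
  rw [pull_smul_add, pull_Q_c hx, pull_Q_c hx, pull_Q_c hx]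
  fin_cases i
  · simp [lift_smul_add, contr_add_left, contr_smul_left, contr_add, contr_smul]
  · simp [lift_smul_add, contr_add_left, contr_smul_left]

theorem Q_ξ_linear {η : Fin 2 → Ghost EG I M P} (i : Fin 2)
    {u v : Ghost EG I M P} (hu : IsVF I u.1) (hv : IsVF I v.1) (a : ℝ) :
    (Q B R).ξ x (Function.update η i (a • u + v)) =
      a • (Q B R).ξ x (Function.update η i u) + (Q B R).ξ x (Function.update η i v) := by
  have hau : IsVF I (a • u.1) := hu.smul a
  rw [Q_ξ, Q_ξ, Q_ξ]
  funext y
  fin_cases i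
  · have h := VectorField.mlieBracket_add_left (W := (η 1).1) (hau.mdifferentiableAt y)
      (hv.mdifferentiableAt y)
    rw [VectorField.mlieBracket_const_smul_left (hu.mdifferentiableAt y)] at h
    simpa using h
  · have h := VectorField.mlieBracket_add_right (V := (η 0).1) (hau.mdifferentiableAt y)
      (hv.mdifferentiableAt y)
    rw [VectorField.mlieBracket_const_smul_right (hu.mdifferentiableAt y)] at h
    simpa using h

theorem Q_ξ_alternating {η : Fin 2 → Ghost EG I M P} {i j : Fin 2} (hij : i ≠ j) (h : η i = η j) :
    (Q B R).ξ x η = 0 := by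
  have h01 : η 0 = η 1 := by
    fin_cases i <;> fin_cases j <;> first | exact absurd rfl hij | exact h | exact h.symm
  rw [Q_ξ, h01, VectorField.mlieBracket_self]

theorem Q_c_alternating (hx : IsConnection B x.A) {η : Fin 2 → Ghost EG I M P} {i j : Fin 2}
    (hij : i ≠ j) (h : η i = η j) : (Q B R).c x η = 0 := by
  have h01 : η 0 = η 1 := by
    fin_cases i <;> fin_cases j <;> first | exact absurd rfl hij | exact h | exact h.symm
  apply pull_inj hx
  rw [pull_Q_c hx, h01]
  funext p
  exact curryLeft_same _ _

end Ghosts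

end WellDefined

/-! ### Derivatives along lines in the space of fields -/

section Lines

variable {E H EG EP HP : Type*} [NormedAddCommGroup E] [NormedSpace ℝ E] [FiniteDimensional ℝ E]
  [TopologicalSpace H] [NormedAddCommGroup EG] [NormedSpace ℝ EG] [FiniteDimensional ℝ EG]
  [NormedAddCommGroup EP] [NormedSpace ℝ EP] [FiniteDimensional ℝ EP] [TopologicalSpace HP]
  {I : ModelWithCorners ℝ E H} {J : ModelWithCorners ℝ EP HP}
  {M : Type*} [TopologicalSpace M] [ChartedSpace H M] [IsManifold I ∞ M]
  {G : Type*} [TopologicalSpace G] [ChartedSpace EG G] [Group G] [LieGroup 𝓘(ℝ, EG) ∞ G]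
  {P : Type*} [TopologicalSpace P] [ChartedSpace HP P] [IsManifold J ∞ P]
  {W : Type*} [NormedAddCommGroup W] [NormedSpace ℝ W]
  {B : PrincipalBundle EG I J M G P}
  {A : P → EP →L[ℝ] EG}

/-- Field spaces carry the product topology over the points of `P` and no norm; the little-o
condition for topological vector spaces holds as soon as it holds in each coordinate. -/
theorem hasDerivAt_of_forall {ι : Type*} {T : ι → Type*} [∀ i, AddCommGroup (T i)]
    [∀ i, Module ℝ (T i)] [∀ i, TopologicalSpace (T i)] [∀ i, IsTopologicalAddGroup (T i)]
    [∀ i, ContinuousSMul ℝ (T i)] {f : ℝ → ∀ i, T i} {f' : ∀ i, T i} {t : ℝ}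
    (h : ∀ i, HasDerivAt (fun s => f s i) (f' i) t) : HasDerivAt f f' t := by
  rw [HasDerivAt, hasDerivAtFilter_iff_hasFDerivAtFilter]
  constructor
  refine Asymptotics.isLittleOTVS_pi.2 fun i => ?_
  have h1 := h i
  rw [HasDerivAt, hasDerivAtFilter_iff_hasFDerivAtFilter] at h1
  exact h1.1

theorem deriv_eq_of_hasDerivAt {T : Type*} [AddCommGroup T]
    [Module ℝ T] [TopologicalSpace T] [IsTopologicalAddGroup T]
    [ContinuousSMul ℝ T] [T2Space T] {f : ℝ → T} {f' : T} {t : ℝ}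
    (h : HasDerivAt f f' t) : deriv f t = f' := by
  have h1 := HasFDerivAt.unique (HasFDerivAt.differentiableAt h).hasFDerivAt h
  have h2 := DFunLike.congr_fun h1 1
  exact h2.trans (one_smul ℝ f')

/-- The bundle-valued form whose value at horizontal lifts is given by a form on `P`. -/
def descend (B : PrincipalBundle EG I J M G P) (A : P → EP →L[ℝ] EG) {k : ℕ}
    (Ψ : P → EP [⋀^Fin k]→L[ℝ] W) : BForm E P W k :=
  fun p => compContinuousLinearMapCLM (hlift B A p) (Ψ p)

theorem descend_pull (hA : IsConnection B A) {k : ℕ} (τ : BForm E P W k) :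
    descend B A (pull B τ) = τ := by
  funext p
  ext u
  exact congr_arg (τ p) (funext fun i => dproj_hlift hA p (u i))

theorem descend_add {k : ℕ} (Ψ Ψ' : P → EP [⋀^Fin k]→L[ℝ] W) :
    descend B A (Ψ + Ψ') = descend B A Ψ + descend B A Ψ' := rfl

theorem descend_sub {k : ℕ} (Ψ Ψ' : P → EP [⋀^Fin k]→L[ℝ] W) :
    descend B A (Ψ - Ψ') = descend B A Ψ - descend B A Ψ' := by
  funext p
  exact _root_.map_sub (compContinuousLinearMapCLM (hlift B A p)) _ _

theorem descend_zero {k : ℕ} : descend B A (0 : P → EP [⋀^Fin k]→L[ℝ] W) = 0 := rfl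

theorem hasDerivAt_cubic (a b c d : W) :
    HasDerivAt (fun t : ℝ => a + t • b + t ^ 2 • c + t ^ 3 • d) b 0 := by
  have h1 : HasDerivAt (fun t : ℝ => t • b) ((1 : ℝ) • b) 0 :=
    (hasDerivAt_id (0 : ℝ)).smul_const _
  have h2 : HasDerivAt (fun t : ℝ => t ^ 2 • c) ((2 * (0 : ℝ) ^ 1) • c) 0 := by
    simpa using (hasDerivAt_pow 2 (0 : ℝ)).smul_const c
  have h3 : HasDerivAt (fun t : ℝ => t ^ 3 • d) ((3 * (0 : ℝ) ^ 2) • d) 0 := by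
    simpa using (hasDerivAt_pow 3 (0 : ℝ)).smul_const d
  have h4 := ((h1.const_add a).add h2).add h3
  simp only [one_smul, pow_one, mul_zero, zero_smul, add_zero, ne_eq, OfNat.ofNat_ne_zero,
    not_false_eq_true, zero_pow] at h4
  exact h4

/-- Along a line of fields the pulled-back components of `Q` are polynomials in `t` of degree at
most three, and the derivative at `0` is the linear coefficient. As `pull` does not involve the
connection, one fixed `A` serves to descend for all `t`. -/
theorem hasDerivAt_of_pull (hA : IsConnection B A) {k : ℕ} {f : ℝ → BForm E P W k}
    {Ψ₀ Ψ₁ Ψ₂ Ψ₃ : P → EP [⋀^Fin k]→L[ℝ] W}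
    (h : ∀ t, pull B (f t) = Ψ₀ + t • Ψ₁ + t ^ 2 • Ψ₂ + t ^ 3 • Ψ₃) :
    HasDerivAt f (descend B A Ψ₁) 0 := by
  refine hasDerivAt_of_forall fun p => ?_
  set L := compContinuousLinearMapCLM (F := W) (ι := Fin k) (hlift B A p)
  have hf : ∀ t, f t p = L (Ψ₀ p) + t • L (Ψ₁ p) + t ^ 2 • L (Ψ₂ p) + t ^ 3 • L (Ψ₃ p) := by
    intro t
    rw [← descend_pull hA (f t), h]
    rfl
  have h4 := hasDerivAt_cubic (L (Ψ₀ p)) (L (Ψ₁ p)) (L (Ψ₂ p)) (L (Ψ₃ p))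
  rw [← funext hf] at h4
  exact h4

/-- The ghost given by the contraction of an `ad P`-valued one-form with a vector field. -/
def vertGhost (B : PrincipalBundle EG I J M G P) (η : Ghost EG I M P) (a : BForm E P EG 1) :
    Ghost EG I M P :=
  (0, iota B η.1 a)

theorem isGhost_vertGhost (hA : IsConnection B A) {η : Ghost EG I M P} (hη : IsGhost B η)
    {a : BForm E P EG 1} (ha : IsForm B Ad a) : IsGhost B (vertGhost B η a) where
  ξ := Bundle.contMDiff_zeroSection ℝ (TangentSpace I : M → Type _)
  c := ha.iota hA hη

theorem contr_lift_vertGhost (hA : IsConnection B A) (η : Ghost EG I M P) (a : BForm E P EG 1) :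
    contr (lift B A (vertGhost B η a)) (fun p => asForm (A p)) =
      contr (lift B A η) (pull B a) := by
  rw [← pull_iota a (dproj_lift hA η)]
  funext p
  ext u
  rw [pull_zero_apply]
  exact conn_lift hA _ _

variable {V : Type*} [NormedAddCommGroup V] [NormedSpace ℝ V] {R : G →* (V →L[ℝ] V)}
  {x : Fields E EG EP P V} {v : FieldVar E EG P V}

theorem asForm_line (x : Fields E EG EP P V) (v : FieldVar E EG P V) (t : ℝ) :
    (fun p => asForm ((x.line B v t).A p)) = (fun p => asForm (x.A p)) + t • pull B v.A := by
  funext p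
  ext u
  change x.A p (u 0) + t • asLin (v.A p) (dproj B p (u 0)) = x.A p (u 0) + t • v.A p _
  congr 2
  refine congr_arg (v.A p) (funext fun i => ?_)
  fin_cases i
  rfl

theorem pull_line (x : Fields E EG EP P V) (v : FieldVar E EG P V) (t : ℝ) (k : ℕ) :
    pull B ((x.line B v t).Φ k) = pull B (x.Φ k) + t • pull B (v.Φ k) := rfl

theorem asLin_apply {F : Type*} [NormedAddCommGroup F] [NormedSpace ℝ F] (a : F [⋀^Fin 1]→L[ℝ] W)
    (w : F) : asLin a w = a (fun _ => w) := rfl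

theorem isConnection_line (hA : IsConnection B x.A) (hv : IsForm B Ad v.A) (t : ℝ) :
    IsConnection B (x.line B v t).A where
  smooth := by
    rw [asForm_line]
    exact hA.smooth.add (hv.smooth.smul t)
  vertical p Y := by
    change x.A p (fundVec B p Y) + t • asLin (v.A p) (dproj B p (fundVec B p Y)) = Y
    rw [dproj_fundVec, hA.vertical, _root_.map_zero, smul_zero, add_zero]
  equivariant p g w := by
    change x.A _ (dact B g p w) + t • asLin (v.A _) (dproj B _ (dact B g p w)) =
      Ad g⁻¹ (x.A p w + t • asLin (v.A p) (dproj B p w))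
    rw [dproj_dact, hA.equivariant, asLin_apply, hv.equivariant, _root_.map_add, _root_.map_smul]
    rfl

theorem isField_line (hx : IsField B R x) (hv : IsFieldVar B R v) (t : ℝ) :
    IsField B R (x.line B v t) where
  A := isConnection_line hx.A hv.A t
  Φ k := by
    have h := (hv.Φ k).smul_add (hx.Φ k) t
    rw [add_comm] at h
    exact h

/-- The new lift must compensate `t a(ξ)` in its `A`-value. The compensating vector is vertical,
hence invisible to `a`, so the dependence on `t` is exactly affine. -/
theorem lift_line (hA : IsConnection B x.A) (hv : IsForm B Ad v.A) (η : Ghost EG I M P) (t : ℝ) :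
    lift B (x.line B v t).A η = lift B x.A η + (-t) • lift B x.A (vertGhost B η v.A) := by
  funext p
  have h0 : dproj B p (lift B x.A (vertGhost B η v.A) p) = 0 := dproj_lift hA _ p
  have h1 : x.A p (lift B x.A (vertGhost B η v.A) p) = v.A p (fun _ => (η.1 (B.proj p) : E)) := by
    rw [conn_lift hA]
    refine congr_arg (v.A p) (funext fun i => ?_)
    fin_cases i
    rfl
  have h2 : dproj B p (lift B x.A η p + (-t) • lift B x.A (vertGhost B η v.A) p) =
      η.1 (B.proj p) := by
    rw [_root_.map_add, _root_.map_smul, h0, smul_zero, add_zero, dproj_lift hA]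
  refine (eq_liftVec (isConnection_line hA hv t) h2 ?_).symm
  change x.A p _ + t • asLin (v.A p) (dproj B p _) = _
  rw [Pi.add_apply, Pi.smul_apply, h2, _root_.map_add, _root_.map_smul, h1]
  have h3 : ∀ e : E, x.A p (lift B x.A η p) + (-t) • v.A p (fun _ => e) + t • asLin (v.A p) e =
      x.A p (lift B x.A η p) := by
    intro e
    rw [asLin_apply, neg_smul, neg_add_cancel_right]
  exact (h3 _).trans (conn_lift hA η p)

theorem lieD_line {k : ℕ} {X Z : P → EP} (hX : IsSmoothVF J X) (hZ : IsSmoothVF J Z)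
    {Ψ ψ : P → EP [⋀^Fin k]→L[ℝ] W} (hΨ : IsSmoothForm J Ψ) (hψ : IsSmoothForm J ψ) (t : ℝ) :
    lieD J (X + (-t) • Z) (Ψ + t • ψ) = lieD J X Ψ + t • (lieD J X ψ - lieD J Z Ψ) +
      t ^ 2 • (-lieD J Z ψ) + t ^ 3 • 0 := by
  rw [lieD_add_left hX (hZ.smul _) (hΨ.add (hψ.smul t)), lieD_smul_left, lieD_add hX hΨ (hψ.smul t),
    lieD_add hZ hΨ (hψ.smul t), lieD_smul, lieD_smul]
  module

theorem hasDerivAt_Q_A (hx : IsConnection B x.A) (hv : IsForm B Ad v.A) {η : Fin 1 → Ghost EG I M P}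
    (hη : IsGhost B (η 0)) : HasDerivAt (fun t => (Q B R).A (x.line B v t) η)
      (descend B x.A (lieD J (lift B x.A (η 0)) (pull B v.A) -
        lieD J (lift B x.A (vertGhost B (η 0) v.A)) (fun p => asForm (x.A p)))) 0 := by
  refine hasDerivAt_of_pull hx
    (Ψ₀ := lieD J (lift B x.A (η 0)) (fun p => asForm (x.A p)))
    (Ψ₂ := -lieD J (lift B x.A (vertGhost B (η 0) v.A)) (pull B v.A)) (Ψ₃ := 0) fun t => ?_
  rw [pull_Q_A (isConnection_line hx hv t) hη, asForm_line, lift_line hx hv]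
  exact lieD_line (isSmoothVF_lift hx hη) (isSmoothVF_lift hx (isGhost_vertGhost hx hη hv))
    hx.smooth hv.smooth t

theorem hasDerivAt_Q_Φ (hR : ContMDiff 𝓘(ℝ, EG) 𝓘(ℝ, V →L[ℝ] V) ∞ R) (hx : IsField B R x)
    (hv : IsFieldVar B R v) {η : Fin 1 → Ghost EG I M P}
    (hη : IsGhost B (η 0)) : HasDerivAt (fun t => (Q B R).Φ (x.line B v t) η)
      (fun k => descend B x.A (lieD J (lift B x.A (η 0)) (pull B (v.Φ k)) -
        lieD J (lift B x.A (vertGhost B (η 0) v.A)) (pull B (x.Φ k)))) 0 := by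
  refine hasDerivAt_of_forall fun k => hasDerivAt_of_pull hx.A
    (Ψ₀ := lieD J (lift B x.A (η 0)) (pull B (x.Φ k)))
    (Ψ₂ := -lieD J (lift B x.A (vertGhost B (η 0) v.A)) (pull B (v.Φ k))) (Ψ₃ := 0) fun t => ?_
  rw [pull_Q_Φ hR (isField_line hx hv t) hη, pull_line, lift_line hx.A hv.A]
  exact lieD_line (isSmoothVF_lift hx.A hη) (isSmoothVF_lift hx.A (isGhost_vertGhost hx.A hη hv.A))
    (hx.Φ k).smooth (hv.Φ k).smooth t

/-- `dA(X₀, X₁)` depends on `A` through `dA` and through each lift, each time affinely: a cubic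
polynomial in `t` with three linear contributions. -/
theorem hasDerivAt_Q_c (hx : IsConnection B x.A) (hv : IsForm B Ad v.A)
    (η : Fin 2 → Ghost EG I M P) : HasDerivAt (fun t => (Q B R).c (x.line B v t) η)
      (descend B x.A (contr (lift B x.A (η 1)) (contr (lift B x.A (η 0)) (extD J (pull B v.A))) -
        contr (lift B x.A (η 1)) (contr (lift B x.A (vertGhost B (η 0) v.A))
          (extD J (fun p => asForm (x.A p)))) -
        contr (lift B x.A (vertGhost B (η 1) v.A)) (contr (lift B x.A (η 0))
          (extD J (fun p => asForm (x.A p)))))) 0 := by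
  set α := fun p => asForm (x.A p) with hα
  refine hasDerivAt_of_pull hx (Ψ₀ := contr (lift B x.A (η 1)) (contr (lift B x.A (η 0)) (extD J α)))
    (Ψ₂ := contr (lift B x.A (vertGhost B (η 1) v.A)) (contr (lift B x.A (vertGhost B (η 0) v.A))
      (extD J α)) -
      contr (lift B x.A (vertGhost B (η 1) v.A)) (contr (lift B x.A (η 0)) (extD J (pull B v.A))) -
      contr (lift B x.A (η 1)) (contr (lift B x.A (vertGhost B (η 0) v.A)) (extD J (pull B v.A))))
    (Ψ₃ := contr (lift B x.A (vertGhost B (η 1) v.A)) (contr (lift B x.A (vertGhost B (η 0) v.A))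
      (extD J (pull B v.A)))) fun t => ?_
  rw [pull_Q_c (isConnection_line hx hv t), asForm_line, lift_line hx hv, lift_line hx hv,
    extD_add hx.smooth (hv.smooth.smul t), extD_smul, ← hα]
  simp only [contr_add, contr_smul, contr_add_left, contr_smul_left]
  module

theorem isVecField_Q (hR : ContMDiff 𝓘(ℝ, EG) 𝓘(ℝ, V →L[ℝ] V) ∞ R) :
    (Q B R).IsVecField B R where
  A :=
    { mem := fun x hx η hη => isForm_Q_A hx.A (hη 0)
      linear := fun x hx η _ i u v hu hv a => Q_A_linear hx.A η i hu hv a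
      alternating := fun x _ η _ i j hij => absurd (Subsingleton.elim i j) hij
      differentiable := fun x hx v hv η hη =>
        HasFDerivAt.differentiableAt (hasDerivAt_Q_A hx.A hv.A (hη 0)) }
  Φ :=
    { mem := fun x hx η hη k => isForm_Q_Φ hR hx (hη 0) k
      linear := fun x hx η _ i u v hu hv a => Q_Φ_linear hR hx η i hu hv a
      alternating := fun x _ η _ i j hij => absurd (Subsingleton.elim i j) hij
      differentiable := fun x hx v hv η hη =>
        HasFDerivAt.differentiableAt (hasDerivAt_Q_Φ hR hx hv (hη 0)) }
  ξ :=
    { mem := fun x hx η hη => isVF_Q_ξ hη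
      linear := fun x hx η _ i u v hu hv a => Q_ξ_linear i hu.ξ hv.ξ a
      alternating := fun x _ η _ i j hij h => Q_ξ_alternating hij h
      differentiable := fun x hx v hv η hη => by
        simp only [Q_ξ]
        exact differentiableAt_const _ }
  c :=
    { mem := fun x hx η hη => isForm_Q_c hx.A hη
      linear := fun x hx η _ i u v _ _ a => Q_c_linear hx.A η i u v a
      alternating := fun x hx η _ i j hij h => Q_c_alternating hx.A hij h
      differentiable := fun x hx v hv η hη =>
        HasFDerivAt.differentiableAt (hasDerivAt_Q_c hx.A hv.A η) }

end Lines

/-! ### The vector field Q is cohomological -/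

section Cohomological

variable {E H EG EP HP : Type*} [NormedAddCommGroup E] [NormedSpace ℝ E] [FiniteDimensional ℝ E]
  [TopologicalSpace H] [NormedAddCommGroup EG] [NormedSpace ℝ EG] [FiniteDimensional ℝ EG]
  [NormedAddCommGroup EP] [NormedSpace ℝ EP] [FiniteDimensional ℝ EP] [TopologicalSpace HP]
  {I : ModelWithCorners ℝ E H} {J : ModelWithCorners ℝ EP HP}
  {M : Type*} [TopologicalSpace M] [ChartedSpace H M] [IsManifold I ∞ M]
  {G : Type*} [TopologicalSpace G] [ChartedSpace EG G] [Group G] [LieGroup 𝓘(ℝ, EG) ∞ G]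
  {P : Type*} [TopologicalSpace P] [ChartedSpace HP P] [IsManifold J ∞ P]
  {W : Type*} [NormedAddCommGroup W] [NormedSpace ℝ W]
  {B : PrincipalBundle EG I J M G P}
  {V : Type*} [NormedAddCommGroup V] [NormedSpace ℝ V] {R : G →* (V →L[ℝ] V)}
  {x : Fields E EG EP P V}

/-- The action of `Q` on a pair of ghosts. -/
def ghostQ (B : PrincipalBundle EG I J M G P) (R : G → V →L[ℝ] V) (x : Fields E EG EP P V)
    (u v : Ghost EG I M P) : Ghost EG I M P :=
  ((Q B R).ξ x ![u, v], (Q B R).c x ![u, v])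

/-- The variation of the fields determined by a ghost. -/
def fieldQ (B : PrincipalBundle EG I J M G P) (R : G → V →L[ℝ] V) (x : Fields E EG EP P V)
    (u : Ghost EG I M P) : FieldVar E EG P V :=
  ⟨(Q B R).A x ![u], (Q B R).Φ x ![u]⟩

theorem isFieldVar_fieldQ (hR : ContMDiff 𝓘(ℝ, EG) 𝓘(ℝ, V →L[ℝ] V) ∞ R) (hx : IsField B R x)
    {u : Ghost EG I M P} (hu : IsGhost B u) : IsFieldVar B R (fieldQ B R x u) :=
  ⟨isForm_Q_A (R := R) (η := ![u]) hx.A hu, isForm_Q_Φ (η := ![u]) hR hx hu⟩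

theorem isGhost_ghostQ (hx : IsConnection B x.A) {u v : Ghost EG I M P} (hu : IsGhost B u)
    (hv : IsGhost B v) : IsGhost B (ghostQ B R x u v) := by
  have h : ∀ i, IsGhost B ((![u, v] : Fin 2 → Ghost EG I M P) i) := by
    intro i
    fin_cases i
    exacts [hu, hv]
  exact ⟨isVF_Q_ξ (R := R) h, isForm_Q_c (R := R) hx h⟩

theorem ghostQ_swap (u v : Ghost EG I M P) : ghostQ B R x v u = -ghostQ B R x u v := by
  refine Prod.ext ?_ ?_
  · change (Q B R).ξ x ![v, u] = -(Q B R).ξ x ![u, v]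
    rw [Q_ξ, Q_ξ]
    exact VectorField.mlieBracket_swap
  · change (Q B R).c x ![v, u] = -(Q B R).c x ![u, v]
    rw [Q_c, Q_c]
    funext p
    ext w
    change curvature B x.A p _ - lieBr G (v.2 p 0) (u.2 p 0) =
      -(curvature B x.A p _ - lieBr G (u.2 p 0) (v.2 p 0))
    rw [lieBr_antisymm (v.2 p 0)]
    have h := DFunLike.congr_fun (curryLeft_swap (curvature B x.A p) (v.1 (B.proj p) : E)
      (u.1 (B.proj p) : E)) w
    refine (congr_arg (· - -lieBr G (u.2 p 0) (v.2 p 0)) h).trans ?_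
    rw [neg_sub, sub_neg_eq_add, add_comm, sub_eq_add_neg]
    rfl

theorem lift_neg (A : P → EP →L[ℝ] EG) (u : Ghost EG I M P) : lift B A (-u) = -lift B A u := by
  have h0 : lift B A (0 : Ghost EG I M P) = 0 := by
    have h := lift_smul_add B A (-1) 0 0
    simpa using h
  have h := lift_smul_add B A (-1) u 0
  rw [h0, add_zero, add_zero, neg_one_smul, neg_one_smul] at h
  exact h

/-- The ghost terms for the two orders of a pair are kept apart, here and in `apply_two`; they merge
later through the antisymmetry of `ghostQ`, using up the factor one half. -/
theorem apply_one {T : Type*} [AddCommGroup T] [Module ℝ T] [TopologicalSpace T]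
    (f : GFun E EG EP I M P V 1 T) (η : Fin 2 → Ghost EG I M P) :
    (Q B R).apply B f x η =
      deriv (fun t : ℝ => f (x.line B (fieldQ B R x (η 0)) t) ![η 1]) 0 -
      deriv (fun t : ℝ => f (x.line B (fieldQ B R x (η 1)) t) ![η 0]) 0 +
      (1 / 2 : ℝ) • (f x ![ghostQ B R x (η 0) (η 1)] - f x ![ghostQ B R x (η 1) (η 0)]) := by
  have h0 : (0 : Fin 2).removeNth η = ![η 1] := by
    funext i
    fin_cases i
    rfl
  have h1 : (1 : Fin 2).removeNth η = ![η 0] := by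
    funext i
    fin_cases i
    rfl
  have h2 : ∀ (a : Ghost EG I M P) (r : Fin 0 → Ghost EG I M P),
      (Fin.cons a r : Fin 1 → Ghost EG I M P) = ![a] :=
    fun a r => by
      funext i
      fin_cases i
      rfl
  rw [VecField.apply, VecField.ghostPart]
  beta_reduce
  rw [Fin.sum_univ_two, Fin.sum_univ_two, Fin.sum_univ_one,
    Fin.sum_univ_one, h2, h2, h0, h1]
  simp only [Fin.val_zero, Fin.val_one, pow_zero, pow_one, one_smul, neg_one_smul, add_zero,
    ← sub_eq_add_neg]
  rfl

theorem apply_two {T : Type*} [AddCommGroup T] [Module ℝ T] [TopologicalSpace T]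
    (f : GFun E EG EP I M P V 2 T) (η : Fin 3 → Ghost EG I M P) :
    (Q B R).apply B f x η =
      deriv (fun t : ℝ => f (x.line B (fieldQ B R x (η 0)) t) ![η 1, η 2]) 0 -
      deriv (fun t : ℝ => f (x.line B (fieldQ B R x (η 1)) t) ![η 0, η 2]) 0 +
      deriv (fun t : ℝ => f (x.line B (fieldQ B R x (η 2)) t) ![η 0, η 1]) 0 +
      (1 / 2 : ℝ) • (f x ![ghostQ B R x (η 0) (η 1), η 2] - f x ![ghostQ B R x (η 0) (η 2), η 1] +
        (-f x ![ghostQ B R x (η 1) (η 0), η 2] + f x ![ghostQ B R x (η 1) (η 2), η 0]) +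
        (f x ![ghostQ B R x (η 2) (η 0), η 1] - f x ![ghostQ B R x (η 2) (η 1), η 0])) := by
  have h0 : (0 : Fin 3).removeNth η = ![η 1, η 2] := by
    funext i
    fin_cases i <;> rfl
  have h1 : (1 : Fin 3).removeNth η = ![η 0, η 2] := by
    funext i
    fin_cases i <;> rfl
  have h2 : (2 : Fin 3).removeNth η = ![η 0, η 1] := by
    funext i
    fin_cases i <;> rfl
  have h3 : ∀ u v : Ghost EG I M P, (0 : Fin 2).removeNth ![u, v] = ![v] := by
    intro u v
    funext i
    fin_cases i
    rfl
  have h4 : ∀ u v : Ghost EG I M P, (1 : Fin 2).removeNth ![u, v] = ![u] := by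
    intro u v
    funext i
    fin_cases i
    rfl
  rw [VecField.apply, VecField.ghostPart]
  beta_reduce
  rw [Fin.sum_univ_three, Fin.sum_univ_three, Fin.sum_univ_two,
    Fin.sum_univ_two, Fin.sum_univ_two, h0, h1, h2, h3, h3, h3, h4, h4, h4]
  have e2 : (-1 : ℝ) ^ 2 = 1 := by norm_num
  have e3 : (-1 : ℝ) ^ 3 = -1 := by norm_num
  simp only [Fin.val_zero, Fin.val_one, Fin.val_two, pow_zero, pow_one, one_smul, neg_one_smul,
    add_zero, zero_add, e2, e3, Nat.reduceAdd, ← sub_eq_add_neg]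
  rfl

theorem eq_of_contr_conn (hA : IsConnection B x.A) {X Y : P → EP}
    (h1 : ∀ p, dproj B p (X p) = dproj B p (Y p))
    (h2 : contr X (fun p => asForm (x.A p)) = contr Y (fun p => asForm (x.A p))) : X = Y := by
  funext p
  have h3 : x.A p (X p) = x.A p (Y p) := DFunLike.congr_fun (congr_fun h2 p) 0
  exact (eq_liftVec hA (z := (dproj B p (Y p), x.A p (Y p))) (h1 p) h3).trans
    (eq_liftVec hA (z := (dproj B p (Y p), x.A p (Y p))) rfl rfl).symm

/-- The lift of the contraction of `Q A`, evaluated at a first ghost, with a second one. -/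
def vertLift (B : PrincipalBundle EG I J M G P) (R : G → V →L[ℝ] V) (x : Fields E EG EP P V)
    (u v : Ghost EG I M P) : P → EP :=
  lift B x.A (vertGhost B v (fieldQ B R x u).A)

theorem isSmoothVF_vertLift (hA : IsConnection B x.A) {u v : Ghost EG I M P} (hu : IsGhost B u)
    (hv : IsGhost B v) : IsSmoothVF J (vertLift B R x u v) :=
  isSmoothVF_lift hA (isGhost_vertGhost hA hv (isForm_Q_A (R := R) (η := ![u]) hA hu))

theorem contr_vertLift (hA : IsConnection B x.A) {u : Ghost EG I M P} (hu : IsGhost B u)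
    (v : Ghost EG I M P) : contr (vertLift B R x u v) (fun p => asForm (x.A p)) =
      contr (lift B x.A v) (lieD J (lift B x.A u) (fun p => asForm (x.A p))) := by
  rw [vertLift, contr_lift_vertGhost hA]
  congr 1
  exact pull_Q_A (R := R) (η := ![u]) hA hu

theorem descend_smul {A : P → EP →L[ℝ] EG} {k : ℕ} (a : ℝ) (Ψ : P → EP [⋀^Fin k]→L[ℝ] W) :
    descend B A (a • Ψ) = a • descend B A Ψ := rfl

theorem descend_neg {A : P → EP →L[ℝ] EG} {k : ℕ} (Ψ : P → EP [⋀^Fin k]→L[ℝ] W) :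
    descend B A (-Ψ) = -descend B A Ψ := rfl

/-- The Lie bracket of lifts. -/
theorem vfBr_lift (hA : IsConnection B x.A) {u v : Ghost EG I M P} (hu : IsGhost B u)
    (hv : IsGhost B v) : vfBr J (lift B x.A u) (lift B x.A v) =
      lift B x.A (ghostQ B R x u v) + vertLift B R x v u - vertLift B R x u v := by
  have hX := isSmoothVF_lift hA hu
  have hY := isSmoothVF_lift hA hv
  -- A field on `P` is determined by its projection and its `A`-value. The projection follows from
  -- relatedness to `u.1` and `v.1`; the `A`-value from the formula for `dA` on two fields, where
  -- the vertical terms supply the derivatives of `c`.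
  apply eq_of_contr_conn hA
  · intro p
    have h1 := diffMap_vfBr (I₁ := J) (I₂ := I) B.smooth_proj hX hY hu.isSmoothVF hv.isSmoothVF
      (fun q => dproj_lift hA u q) (fun q => dproj_lift hA v q) p
    have h2 : dproj B p (vertLift B R x v u p) = 0 := dproj_lift hA _ p
    have h3 : dproj B p (vertLift B R x u v p) = 0 := dproj_lift hA _ p
    have h4 : dproj B p (lift B x.A (ghostQ B R x u v) p) =
        vfBr I (fun y => (u.1 y : E)) (fun y => (v.1 y : E)) (B.proj p) :=
      (dproj_lift hA _ p).trans (congr_fun (Q_ξ (B := B) (R := R) (x := x) ![u, v]) (B.proj p))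
    rw [Pi.sub_apply, Pi.add_apply, _root_.map_sub, _root_.map_add, h2, h3, h4, add_zero, sub_zero]
    exact h1
  · rw [contr_vfBr_one hX hY hA.smooth, sub_eq_add_neg _ (vertLift B R x u v), contr_add_left,
      contr_add_left, ← neg_one_smul ℝ (vertLift B R x u v), contr_smul_left, contr_vertLift hA hu,
      contr_vertLift hA hv, contr_lift_conn hA (ghostQ B R x u v), lieD, lieD, contr_add, contr_add]
    have h5 : pull B (ghostQ B R x u v).2 = contr (lift B x.A v) (contr (lift B x.A u)
        (extD J (fun p => asForm (x.A p)))) := pull_Q_c (R := R) hA ![u, v]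
    rw [h5, contr_contr_swap (lift B x.A u) (lift B x.A v)]
    module

/-- This is `Q²` on a coordinate `Ψ` that transforms by the Lie derivative. Iterated Lie derivatives
come from varying `Ψ`, `vertLift` terms from varying the lift with `A`, and the last bracket from
varying the ghosts. `vfBr_lift` turns the sum into `L_[X,Y] = [L_X, L_Y]`. -/
theorem lieD_lift_commutator (hA : IsConnection B x.A) {u v : Ghost EG I M P} (hu : IsGhost B u)
    (hv : IsGhost B v) {k : ℕ} {Ψ : P → EP [⋀^Fin k]→L[ℝ] W} (hΨ : IsSmoothForm J Ψ) :
    lieD J (lift B x.A v) (lieD J (lift B x.A u) Ψ) - lieD J (vertLift B R x u v) Ψ -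
      (lieD J (lift B x.A u) (lieD J (lift B x.A v) Ψ) - lieD J (vertLift B R x v u) Ψ) +
      (1 / 2 : ℝ) • (lieD J (lift B x.A (ghostQ B R x u v)) Ψ -
        lieD J (lift B x.A (ghostQ B R x v u)) Ψ) = 0 := by
  have hX := isSmoothVF_lift hA hu
  have hY := isSmoothVF_lift hA hv
  have hQ := isSmoothVF_lift hA (isGhost_ghostQ (R := R) hA hu hv)
  have h := lieD_vfBr hX hY hΨ
  rw [vfBr_lift (R := R) hA hu hv, lieD_sub_left (hQ.add (isSmoothVF_vertLift hA hv hu))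
    (isSmoothVF_vertLift hA hu hv) hΨ, lieD_add_left hQ (isSmoothVF_vertLift hA hv hu) hΨ] at h
  rw [ghostQ_swap u v, lift_neg, ← neg_one_smul ℝ (lift B x.A (ghostQ B R x u v)), lieD_smul_left]
  have h' := eq_sub_of_add_eq (eq_add_of_sub_eq h)
  rw [h']
  module

theorem Q_apply_Q_A (hR : ContMDiff 𝓘(ℝ, EG) 𝓘(ℝ, V →L[ℝ] V) ∞ R) (hx : IsField B R x)
    {η : Fin 2 → Ghost EG I M P} (hη : ∀ i, IsGhost B (η i)) :
    (Q B R).apply B (Q B R).A x η = 0 := by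
  have hd : ∀ {u v : Ghost EG I M P}, IsGhost B u → IsGhost B v →
      deriv (fun t : ℝ => (Q B R).A (x.line B (fieldQ B R x u) t) ![v]) 0 =
      descend B x.A (lieD J (lift B x.A v) (lieD J (lift B x.A u) (fun p => asForm (x.A p))) -
        lieD J (vertLift B R x u v) (fun p => asForm (x.A p))) := by
    intro u v hu hv
    have h : pull B (fieldQ B R x u).A = lieD J (lift B x.A u) (fun p => asForm (x.A p)) :=
      pull_Q_A (R := R) (η := ![u]) hx.A hu
    rw [deriv_eq_of_hasDerivAt (hasDerivAt_Q_A hx.A (isFieldVar_fieldQ hR hx hu).A hv), h]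
    rfl
  have hg : ∀ {u v : Ghost EG I M P}, IsGhost B u → IsGhost B v →
      (Q B R).A x ![ghostQ B R x u v] =
      descend B x.A (lieD J (lift B x.A (ghostQ B R x u v)) (fun p => asForm (x.A p))) := by
    intro u v hu hv
    rw [← descend_pull hx.A ((Q B R).A x ![ghostQ B R x u v])]
    exact congr_arg (descend B x.A) (pull_Q_A (η := ![ghostQ B R x u v]) hx.A
      (isGhost_ghostQ hx.A hu hv))
  rw [apply_one, hd (hη 0) (hη 1), hd (hη 1) (hη 0), hg (hη 0) (hη 1), hg (hη 1) (hη 0),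
    ← descend_sub, ← descend_sub, ← descend_smul, ← descend_add,
    lieD_lift_commutator hx.A (hη 0) (hη 1) hx.A.smooth, descend_zero]

theorem Q_apply_Q_Φ (hR : ContMDiff 𝓘(ℝ, EG) 𝓘(ℝ, V →L[ℝ] V) ∞ R) (hx : IsField B R x)
    {η : Fin 2 → Ghost EG I M P} (hη : ∀ i, IsGhost B (η i)) :
    (Q B R).apply B (Q B R).Φ x η = 0 := by
  have hd : ∀ {u v : Ghost EG I M P}, IsGhost B u → IsGhost B v →
      deriv (fun t : ℝ => (Q B R).Φ (x.line B (fieldQ B R x u) t) ![v]) 0 =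
      fun k => descend B x.A (lieD J (lift B x.A v) (lieD J (lift B x.A u) (pull B (x.Φ k))) -
        lieD J (vertLift B R x u v) (pull B (x.Φ k))) := by
    intro u v hu hv
    rw [deriv_eq_of_hasDerivAt (hasDerivAt_Q_Φ hR hx (isFieldVar_fieldQ hR hx hu) hv)]
    funext k
    have h : pull B ((fieldQ B R x u).Φ k) = lieD J (lift B x.A u) (pull B (x.Φ k)) :=
      pull_Q_Φ (R := R) (η := ![u]) hR hx hu k
    rw [h]
    rfl
  have hg : ∀ {u v : Ghost EG I M P}, IsGhost B u → IsGhost B v →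
      (Q B R).Φ x ![ghostQ B R x u v] =
      fun k => descend B x.A (lieD J (lift B x.A (ghostQ B R x u v)) (pull B (x.Φ k))) := by
    intro u v hu hv
    funext k
    rw [← descend_pull hx.A ((Q B R).Φ x ![ghostQ B R x u v] k)]
    exact congr_arg (descend B x.A) (pull_Q_Φ (η := ![ghostQ B R x u v]) hR hx
      (isGhost_ghostQ hx.A hu hv) k)
  rw [apply_one, hd (hη 0) (hη 1), hd (hη 1) (hη 0), hg (hη 0) (hη 1), hg (hη 1) (hη 0)]
  funext k
  simp only [Pi.add_apply, Pi.sub_apply, Pi.smul_apply]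
  rw [← descend_sub, ← descend_sub, ← descend_smul, ← descend_add,
    lieD_lift_commutator hx.A (hη 0) (hη 1) (hx.Φ k).smooth, descend_zero]
  rfl

/-- `Q ξ` does not involve `A` or `Φ`, so the body derivatives vanish and the ghost part is the
Jacobi identity. -/
theorem Q_apply_Q_ξ {η : Fin 3 → Ghost EG I M P} (hη : ∀ i, IsGhost B (η i)) :
    (Q B R).apply B (Q B R).ξ x η = 0 := by
  have hd : ∀ w (η' : Fin 2 → Ghost EG I M P),
      deriv (fun t : ℝ => (Q B R).ξ (x.line B w t) η') 0 = 0 := by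
    intro w η'
    simp only [Q_ξ]
    simp [deriv]
  have hc : ∀ i, ContMDiff I I.tangent (minSmoothness ℝ 2)
      (fun y => (⟨y, (η i).1 y⟩ : TangentBundle I M)) :=
    fun i => (hη i).ξ.of_le minSmoothness_two_le_infty
  have hs : ∀ (u v : Ghost EG I M P), (ghostQ B R x u v).1 = VectorField.mlieBracket I u.1 v.1 :=
    fun u v => Q_ξ (B := B) (R := R) (x := x) ![u, v]
  have hn : minSmoothness ℝ 3 ≤ (∞ : WithTop ℕ∞) := by
    rw [minSmoothness_of_isRCLikeNormedField]
    exact WithTop.coe_le_coe.2 (le_top : (3 : ℕ∞) ≤ ⊤)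
  have : IsManifold I (minSmoothness ℝ 3) M := .of_le (n := ∞) hn
  have : CompleteSpace E := FiniteDimensional.complete ℝ E
  have hj := VectorField.leibniz_identity_mlieBracket (hc 0) (hc 1) (hc 2)
  have hq : ∀ u v w : Ghost EG I M P, (Q B R).ξ x ![ghostQ B R x u v, w] =
      VectorField.mlieBracket I (VectorField.mlieBracket I u.1 v.1) w.1 := by
    intro u v w
    rw [Q_ξ, ← hs u v]
    rfl
  have hn1 : ∀ i j k, VectorField.mlieBracket I (VectorField.mlieBracket I (η j).1 (η i).1) (η k).1 =
      -VectorField.mlieBracket I (VectorField.mlieBracket I (η i).1 (η j).1) (η k).1 := by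
    intro i j k
    funext y
    rw [VectorField.mlieBracket_swap (V := (η j).1), ← neg_one_smul ℝ,
      VectorField.mlieBracket_const_smul_left
        ((isVF_mlieBracket (hη i).ξ (hη j).ξ).mdifferentiableAt y), neg_one_smul]
    rfl
  rw [apply_two, hd, hd, hd, hq, hq, hq, hq, hq, hq, hn1 0 1 2, hn1 0 2 1, hn1 1 2 0]
  rw [VectorField.mlieBracket_swap (V := (η 0).1) (W := VectorField.mlieBracket I (η 1).1 (η 2).1),
    VectorField.mlieBracket_swap (V := (η 1).1) (W := VectorField.mlieBracket I (η 0).1 (η 2).1)]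
    at hj
  rw [neg_eq_iff_eq_neg.1 hj]
  module

/-- The identity expressing that the exterior derivative of a two-form vanishes, in terms of Lie
derivatives. -/
theorem contr_lieD_cyclic {τ : P → EP [⋀^Fin 2]→L[ℝ] W} (hτ : IsSmoothForm J τ)
    (h : extD J τ = 0) {X Y Z : P → EP} (hX : IsSmoothVF J X) (hY : IsSmoothVF J Y)
    (hZ : IsSmoothVF J Z) :
    contr Z (contr Y (lieD J X τ)) - contr Z (contr X (lieD J Y τ)) +
      contr Y (contr X (lieD J Z τ)) + contr Z (contr (vfBr J X Y) τ) -
      contr Y (contr (vfBr J X Z) τ) + contr X (contr (vfBr J Y Z) τ) = 0 := by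
  have hL : ∀ X : P → EP, lieD J X τ = extD J (contr X τ) := by
    intro X
    rw [lieD, h, contr_zero, zero_add]
  have hd : ∀ {X Y : P → EP}, IsSmoothVF J X → IsSmoothVF J Y →
      contr (vfBr J X Y) τ = contr X (extD J (contr Y τ)) + extD J (contr X (contr Y τ)) -
        contr Y (extD J (contr X τ)) := by
    intro X Y hX hY
    rw [contr_vfBr hX hY hτ, hL, lieD]
  have hn : ∀ {k : ℕ} (X : P → EP) (σ : P → EP [⋀^Fin (k + 1)]→L[ℝ] W),
      contr X (-σ) = -contr X σ := by
    intro k X σ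
    rw [← neg_one_smul ℝ σ, contr_smul, neg_one_smul]
  have hs : ∀ X Y Z : P → EP, contr Z (extD J (contr X (contr Y τ))) =
      -contr Z (extD J (contr Y (contr X τ))) := by
    intro X Y Z
    rw [contr_contr_swap X Y, extD_neg, hn]
  have hT : ∀ {X Y : P → EP}, IsSmoothVF J X → IsSmoothVF J Y → ∀ Z : P → EP,
      contr Z (contr (vfBr J X Y) τ) = contr Z (contr X (extD J (contr Y τ))) +
        contr Z (extD J (contr X (contr Y τ))) - contr Z (contr Y (extD J (contr X τ))) := by
    intro X Y hX hY Z
    rw [hd hX hY, sub_eq_add_neg, contr_add, contr_add, hn, ← sub_eq_add_neg]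
  -- With `L = d ι` on the closed form `τ`, the claim reduces to one relation, obtained by computing
  -- the contraction of `τ` with `Z` and `[X, Y]` in two ways: through the one-form `ι_Z τ`, and
  -- through `hT`.
  have h1 := contr_vfBr_one hX hY (hτ.contr hZ)
  rw [contr_contr_swap (vfBr J X Y), hT hX hY Z, hs X Y Z, hs Y Z X, hs X Z Y] at h1
  rw [hL, hL, hL, hT hX hY Z, hT hX hZ Y, hT hY hZ X, hs X Y Z, hs Y Z X, hs X Z Y,
    contr_contr_swap Y Z (extD J (contr X τ)), contr_contr_swap X Z (extD J (contr Y τ)),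
    contr_contr_swap X Y (extD J (contr Z τ))]
  linear_combination (norm := module) (-1 : ℝ) • h1

/-- Substituting `vfBr_lift` for the lifts of `ghostQ` cancels all `vertLift` terms, leaving the
cyclic identity for the closed form `dA` and three lifts. -/
theorem Q_apply_Q_c (hR : ContMDiff 𝓘(ℝ, EG) 𝓘(ℝ, V →L[ℝ] V) ∞ R) (hx : IsField B R x)
    {η : Fin 3 → Ghost EG I M P} (hη : ∀ i, IsGhost B (η i)) :
    (Q B R).apply B (Q B R).c x η = 0 := by
  set τ := extD J (fun p => asForm (x.A p)) with hτ
  have hd : ∀ {u : Ghost EG I M P}, IsGhost B u → ∀ v w : Ghost EG I M P,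
      deriv (fun t : ℝ => (Q B R).c (x.line B (fieldQ B R x u) t) ![v, w]) 0 =
      descend B x.A (contr (lift B x.A w) (contr (lift B x.A v) (lieD J (lift B x.A u) τ)) -
        contr (lift B x.A w) (contr (vertLift B R x u v) τ) -
        contr (vertLift B R x u w) (contr (lift B x.A v) τ)) := by
    intro u hu v w
    have h : pull B (fieldQ B R x u).A = lieD J (lift B x.A u) (fun p => asForm (x.A p)) :=
      pull_Q_A (R := R) (η := ![u]) hx.A hu
    rw [deriv_eq_of_hasDerivAt (hasDerivAt_Q_c hx.A (isFieldVar_fieldQ hR hx hu).A ![v, w]), h,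
      ← lieD_extD (isSmoothVF_lift hx.A hu) hx.A.smooth]
    rfl
  have hg : ∀ u v w : Ghost EG I M P, (Q B R).c x ![ghostQ B R x u v, w] =
      descend B x.A (contr (lift B x.A w) (contr (lift B x.A (ghostQ B R x u v)) τ)) := by
    intro u v w
    rw [← descend_pull hx.A ((Q B R).c x ![ghostQ B R x u v, w])]
    exact congr_arg (descend B x.A) (pull_Q_c (R := R) hx.A ![ghostQ B R x u v, w])
  have hv : ∀ i j, lift B x.A (ghostQ B R x (η i) (η j)) =
      vfBr J (lift B x.A (η i)) (lift B x.A (η j)) +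
        (-1 : ℝ) • vertLift B R x (η j) (η i) + vertLift B R x (η i) (η j) := by
    intro i j
    rw [vfBr_lift (R := R) hx.A (hη i) (hη j)]
    module
  have hs : ∀ i j, lift B x.A (ghostQ B R x (η j) (η i)) =
      (-1 : ℝ) • lift B x.A (ghostQ B R x (η i) (η j)) := by
    intro i j
    rw [ghostQ_swap (η i) (η j), lift_neg, neg_one_smul]
  have hX : ∀ i, IsSmoothVF J (lift B x.A (η i)) := fun i => isSmoothVF_lift hx.A (hη i)
  have key := contr_lieD_cyclic hx.A.smooth.extD (extD_extD hx.A.smooth) (hX 0) (hX 1) (hX 2)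
  rw [← hτ] at key
  rw [apply_two, hd (hη 0), hd (hη 1), hd (hη 2), hg, hg, hg, hg, hg, hg, hs 0 1, hs 0 2, hs 1 2,
    hv 0 1, hv 0 2, hv 1 2]
  simp only [contr_add_left, contr_smul_left, contr_add, contr_smul]
  -- Puts the double contractions that involve `vertLift` into a common order, so that they cancel
  -- as module elements.
  rw [contr_contr_swap (vertLift B R x (η 0) (η 2)), contr_contr_swap (vertLift B R x (η 1) (η 2)),
    contr_contr_swap (vertLift B R x (η 2) (η 1))]
  simp only [← descend_sub, ← descend_add, ← descend_smul, ← descend_neg]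
  -- Zero is replaced by the left side of the cyclic identity, so that only a linear identity
  -- between forms on `P` remains.
  rw [← descend_zero (B := B) (A := x.A), ← key]
  congr 1
  module

theorem Q_bracket_Q_vanishes (hR : ContMDiff 𝓘(ℝ, EG) 𝓘(ℝ, V →L[ℝ] V) ∞ R) :
    ((Q B R).bracket B (Q B R)).Vanishes B R where
  A x hx η hη := by
    change (Q B R).apply B (Q B R).A x η + (Q B R).apply B (Q B R).A x η = 0
    rw [Q_apply_Q_A hR hx hη, add_zero]
  Φ x hx η hη := by
    change (Q B R).apply B (Q B R).Φ x η + (Q B R).apply B (Q B R).Φ x η = 0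
    rw [Q_apply_Q_Φ hR hx hη, add_zero]
  ξ x hx η hη := by
    change (Q B R).apply B (Q B R).ξ x η + (Q B R).apply B (Q B R).ξ x η = 0
    rw [Q_apply_Q_ξ hη, add_zero]
  c x hx η hη := by
    change (Q B R).apply B (Q B R).c x η + (Q B R).apply B (Q B R).c x η = 0
    rw [Q_apply_Q_c hR hx hη, add_zero]

end Cohomological

end GaugeDiffeo

end

theorem theorem1
    {E H EG EP HP : Type*}
    [NormedAddCommGroup E] [NormedSpace ℝ E] [FiniteDimensional ℝ E] [TopologicalSpace H]
    [NormedAddCommGroup EG] [NormedSpace ℝ EG] [FiniteDimensional ℝ EG]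
    [NormedAddCommGroup EP] [NormedSpace ℝ EP] [FiniteDimensional ℝ EP] [TopologicalSpace HP]
    {I : ModelWithCorners ℝ E H} {J : ModelWithCorners ℝ EP HP}
    {M : Type*} [TopologicalSpace M] [ChartedSpace H M] [IsManifold I ∞ M]
    {G : Type*} [TopologicalSpace G] [ChartedSpace EG G] [Group G] [LieGroup 𝓘(ℝ, EG) ∞ G]
    {P : Type*} [TopologicalSpace P] [ChartedSpace HP P] [IsManifold J ∞ P]
    {V : Type*} [NormedAddCommGroup V] [NormedSpace ℝ V] [FiniteDimensional ℝ V]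
    (B : GaugeDiffeo.PrincipalBundle EG I J M G P)
    (R : G →* (V →L[ℝ] V)) (hR : ContMDiff 𝓘(ℝ, EG) 𝓘(ℝ, V →L[ℝ] V) ∞ R) :
    (GaugeDiffeo.Q B R).IsVecField B R ∧
      ((GaugeDiffeo.Q B R).bracket B (GaugeDiffeo.Q B R)).Vanishes B R :=
  ⟨GaugeDiffeo.isVecField_Q hR, GaugeDiffeo.Q_bracket_Q_vanishes hR⟩
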